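/- Let $G$ be a compact connected Lie group with simple Lie algebra $\mathfrak g$, and let $L\subset G$ be a closed connected subgroup with Lie algebra $\mathfrak l$. Definitions. $L$ is *admissible* if $M=G/L$ is almost effective (every normal subgroup of $G$ contained in $L$ is discrete) and $M$ admits a $G$-invariant Lorentzian metric. $M=G/L$ is *minimal admissible* if $L$ is admissible and there is no admissible closed connected subgroup $\tilde L\supset L$ with $\dim\tilde L>\dim L$. A *reductive decomposition* is $\mathfrak g=\mathfrak l\oplus\mathfrak m$ with $\mathfrak m$ an $\mathrm{Ad}_L$-invariant subspace; put $\mathfrak m^{\mathfrak l}=\{X\in\mathfrak m : [\mathfrak l,X]=0\}$. $M$ is *of Type Ib* if for some reductive decomposition $\mathfrak m^{\mathfrak l}$ is a three-dimensional simple regular subalgebra of $\mathfrak g$ (regular: normalized by a Cartan subalgebra of $\mathfrak g$). $M$ is a *contact homogeneous manifold of special type* if there are a reductive decomposition $$\mathfrak g=\mathfrak l\oplus\mathfrak m,\qquad \mathfrak m=\mathfrak s\oplus\mathfrak m',$$ with $\mathfrak m'$ an $\mathrm{Ad}_L$-invariant subspace and $\mathfrak s\cong\mathfrak{sp}(1)$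 a subalgebra, such that $\mathfrak m^{\mathfrak l}=\mathfrak s$, $C_{\mathfrak g}(\mathfrak s)=\mathfrak l$, and $C_{\mathfrak g}(Z)=\mathfrak l+\mathbb R Z$ for every non-zero $Z\in\mathfrak s$. Proposition. $M=G/L$ is minimal admissible of Type Ib if and only if it is a contact homogeneous manifold of special type. Moreover, for every decomposition as in the definition of special type, $\mathfrak s$ is a regular subalgebra of $\mathfrak g$; $L$ is the identity component of the centralizer $C_G(\mathfrak s)=\{a\in G:\mathrm{Ad}_a|_{\mathfrak s}=\mathrm{id}\}$ (so $M=G/C_G(\mathfrak{sp}(1))^0$ for a regular three-dimensional subalgebra); and for every non-zero $Z\in\mathfrak s$ the subspace $Z^\perp\cap\mathfrak m$ ($\perp$ with respect to the Killing form) of $\mathfrak m\cong T_oM$ defines a $G$-invariant contact structure on $M$. -/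

import Mathlib

open scoped Manifold ContDiff

noncomputable section

namespace HomogeneousLorentz

/-! ### Lie groups and their closed subgroups -/

section LieGroups

variable {n : ℕ} {G : Type*} [TopologicalSpace G] [ChartedSpace (EuclideanSpace ℝ (Fin n)) G]
  [Group G]

instance instLieGroupMinSmoothness [LieGroup (𝓡 n) ∞ G] :
    LieGroup (𝓡 n) (minSmoothness ℝ 3) G :=
  LieGroup.of_le (n := ∞) (by
    rw [minSmoothness_of_isRCLikeNormedField]; exact ENat.LEInfty.out)

variable (n G) in
/-- The Lie algebra `𝔤 = T₁G` of the Lie group `G`. -/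
abbrev LieAlg : Type := GroupLieAlgebra (𝓡 n) G

/-- The adjoint representation: `Ad a` is the derivative at `1` of `x ↦ a x a⁻¹`. -/
def Ad (a : G) : LieAlg n G → LieAlg n G :=
  fun X => (mfderiv (𝓡 n) (𝓡 n) (fun x : G => a * x * a⁻¹) 1 X : EuclideanSpace ℝ (Fin n))

/-- `X ∈ T₁G` is the velocity at time `0` of a curve through `1` that runs inside `L`. -/
def IsVelocity (L : Subgroup G) (X : LieAlg n G) : Prop :=
  ∃ γ : ℝ → G, γ 0 = 1 ∧ (∀ t, γ t ∈ L) ∧ MDifferentiableAt 𝓘(ℝ, ℝ) (𝓡 n) γ 0 ∧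
    (mfderiv 𝓘(ℝ, ℝ) (𝓡 n) γ 0 (1 : ℝ) : EuclideanSpace ℝ (Fin n)) = X

theorem mfderiv_eq_self {M : Type*} [TopologicalSpace M]
    [ChartedSpace (EuclideanSpace ℝ (Fin n)) M] {f : M → M} (hf : ∀ x, f x = x) (y : M)
    (v : EuclideanSpace ℝ (Fin n)) :
    (mfderiv (𝓡 n) (𝓡 n) f y v : EuclideanSpace ℝ (Fin n)) = v := by
  obtain rfl : f = id := funext hf
  rw [mfderiv_id]; rfl

theorem isVelocity_zero (L : Subgroup G) : IsVelocity L (0 : LieAlg n G) :=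
  ⟨fun _ => 1, rfl, fun _ => L.one_mem, mdifferentiableAt_const, by
    rw [mfderiv_const]; rfl⟩

theorem IsVelocity.smul {L : Subgroup G} {X : LieAlg n G} (h : IsVelocity L X) (c : ℝ) :
    IsVelocity L (c • X) := by
  obtain ⟨γ, h0, hL, hd, hX⟩ := h
  have hc : HasMFDerivAt 𝓘(ℝ, ℝ) 𝓘(ℝ, ℝ) (fun t : ℝ => c * t) 0
      (ContinuousLinearMap.toSpanSingleton ℝ c) := by
    have h : HasDerivAt (fun t : ℝ => c * t) c 0 := by
      simpa using (hasDerivAt_id (0 : ℝ)).const_mul c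
    exact hasMFDerivAt_iff_hasFDerivAt.2 h.hasFDerivAt
  have hd' : HasMFDerivAt 𝓘(ℝ, ℝ) (𝓡 n) γ (c * 0) (mfderiv 𝓘(ℝ, ℝ) (𝓡 n) γ (c * 0)) := by
    rw [mul_zero]; exact hd.hasMFDerivAt
  have hcomp := hd'.comp 0 hc
  refine ⟨γ ∘ fun t => c * t, by simpa using h0, fun t => hL _, hcomp.mdifferentiableAt, ?_⟩
  rw [hcomp.mfderiv]
  have h1 : ∀ s : ℝ, s = 0 →
      (mfderiv 𝓘(ℝ, ℝ) (𝓡 n) γ s (c : ℝ) : EuclideanSpace ℝ (Fin n)) = c • X := by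
    rintro s rfl
    have h2 := (mfderiv 𝓘(ℝ, ℝ) (𝓡 n) γ 0).map_smul c (1 : ℝ)
    have h3 : (c • (1 : ℝ)) = c := by simp
    rw [← hX]
    refine Eq.trans ?_ h2
    exact congrArg (mfderiv 𝓘(ℝ, ℝ) (𝓡 n) γ 0) h3.symm
  refine Eq.trans ?_ (h1 (c * 0) (mul_zero c))
  change (mfderiv 𝓘(ℝ, ℝ) (𝓡 n) γ (c * 0)) ((1 : ℝ) • c) = _
  rw [one_smul]

theorem IsVelocity.add [LieGroup (𝓡 n) ∞ G] {L : Subgroup G} {X Y : LieAlg n G}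
    (hX : IsVelocity L X) (hY : IsVelocity L Y) : IsVelocity L (X + Y) := by
  obtain ⟨γ, h0, hL, hd, hX⟩ := hX
  obtain ⟨δ, k0, kL, kd, hY⟩ := hY
  have hmul : MDifferentiableAt ((𝓡 n).prod (𝓡 n)) (𝓡 n) (fun p : G × G => p.1 * p.2)
      (γ 0, δ 0) :=
    (contMDiff_mul (𝓡 n) ∞).mdifferentiable (by simp) _
  have hpair := hd.hasMFDerivAt.prodMk kd.hasMFDerivAt
  have hcomp := HasMFDerivAt.comp (0 : ℝ) hmul.hasMFDerivAt hpair
  refine ⟨fun t => γ t * δ t, by simp [h0, k0], fun t => L.mul_mem (hL t) (kL t),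
    hcomp.mdifferentiableAt, ?_⟩
  have e1 := hcomp.mfderiv
  have e2 : (mfderiv 𝓘(ℝ, ℝ) (𝓡 n) (fun t => γ t * δ t) 0 (1 : ℝ) : EuclideanSpace ℝ (Fin n)) =
      mfderiv ((𝓡 n).prod (𝓡 n)) (𝓡 n) (fun p : G × G => p.1 * p.2) (γ 0, δ 0)
        (mfderiv 𝓘(ℝ, ℝ) (𝓡 n) γ 0 (1 : ℝ), mfderiv 𝓘(ℝ, ℝ) (𝓡 n) δ 0 (1 : ℝ)) :=
    congrArg (fun T => T (1 : ℝ)) e1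
  refine e2.trans ((mfderiv_prod_eq_add_apply hmul).trans ?_)
  rw [← hX, ← hY]
  exact congrArg₂ (fun a b : EuclideanSpace ℝ (Fin n) => a + b)
    (mfderiv_eq_self (by simp [k0]) _ _) (mfderiv_eq_self (by simp [h0]) _ _)

/-- The Lie algebra `Lie(L) ⊆ 𝔤` of a closed subgroup `L`: the tangent space of `L` at `1`. -/
def lie [LieGroup (𝓡 n) ∞ G] (L : Subgroup G) : Submodule ℝ (LieAlg n G) where
  carrier := {X | IsVelocity L X}
  zero_mem' := isVelocity_zero L
  add_mem' := IsVelocity.add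
  smul_mem' c _ h := h.smul c

end LieGroups
/-! ### Notions of the Lie algebra -/

section Algebra

variable {𝔤 : Type*} [LieRing 𝔤] [LieAlgebra ℝ 𝔤]

/-- The centralizer `C_𝔤(S)` of a subset `S` of the Lie algebra `𝔤`. -/
def centralizer (S : Set 𝔤) : Submodule ℝ 𝔤 where
  carrier := {X | ∀ Y ∈ S, ⁅Y, X⁆ = 0}
  zero_mem' Y _ := lie_zero Y
  add_mem' hX hX' Y hY := by rw [lie_add, hX Y hY, hX' Y hY, add_zero]
  smul_mem' c X hX Y hY := by rw [lie_smul, hX Y hY, smul_zero]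

/-- A subalgebra is regular if it is normalized by some Cartan subalgebra. -/
def IsRegularSubalgebra (s : LieSubalgebra ℝ 𝔤) : Prop :=
  ∃ c : LieSubalgebra ℝ 𝔤, c.IsCartanSubalgebra ∧ c ≤ s.normalizer

/-- The orthogonal complement `Z^⊥` of `Z` for the Killing form. -/
def killingPerp (Z : 𝔤) : Submodule ℝ 𝔤 := LinearMap.ker (killingForm ℝ 𝔤 Z)

end Algebra

/-- The commutator bracket of quaternions. -/
instance instLieRingQuaternion : LieRing (Quaternion ℝ) := LieRing.ofAssociativeRing

/-- `sp(1)`: the purely imaginary quaternions with the commutator bracket. -/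
def sp1 : LieSubalgebra ℝ (Quaternion ℝ) where
  carrier := {q | q.re = 0}
  zero_mem' := rfl
  add_mem' {p q} (hp : p.re = 0) (hq : q.re = 0) := by
    change p.re + q.re = 0
    rw [hp, hq, add_zero]
  smul_mem' c q (hq : q.re = 0) := by
    change c * q.re = 0
    rw [hq, mul_zero]
  lie_mem' {p q} _ _ := by
    change (p * q).re - (q * p).re = 0
    rw [Quaternion.re_mul, Quaternion.re_mul]
    ring

/-! ### Homogeneous manifolds `M = G/L` -/

section Homogeneous

variable {n : ℕ} {G : Type*} [TopologicalSpace G] [ChartedSpace (EuclideanSpace ℝ (Fin n)) G]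
  [Group G] [LieGroup (𝓡 n) ∞ G]

/-- `G` acts almost effectively on `G/L`: every normal subgroup of `G` inside `L` is discrete. -/
def IsAlmostEffective (L : Subgroup G) : Prop :=
  ∀ N : Subgroup G, N.Normal → N ≤ L → DiscreteTopology N

/-- The tangent space at `a` of the fibre `aL` of `π : G → G/L`, i.e. the kernel of
`dπ : T_a G → T_{aL}(G/L)`. -/
def vertical (L : Subgroup G) (a : G) : Set (TangentSpace (𝓡 n) a) :=
  {u | ∃ X ∈ lie (n := n) L, mulInvariantVectorField X a = u}

/-- A `G`-invariant Lorentzian metric `g` on `M = G/L` (signature `(-,+,…,+)`), described by its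
pull-back `π^* g` under `π : G → G/L`. On `T_a G / ker dπ = T_{aL} M` the form is Lorentzian: it
has a negative vector `v` and is positive definite on the orthogonal complement of `v`.
Smoothness of the field of forms is automatic from left invariance. -/
structure InvariantLorentzMetric (n : ℕ) {G : Type*} [TopologicalSpace G]
    [ChartedSpace (EuclideanSpace ℝ (Fin n)) G] [Group G] [LieGroup (𝓡 n) ∞ G]
    (L : Subgroup G) where
  /-- the value of `π^* g` at `a` -/
  form : ∀ a : G, LinearMap.BilinForm ℝ (TangentSpace (𝓡 n) a)
  symm : ∀ a u v, form a u v = form a v u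
  vertical_eq_zero : ∀ a, ∀ u ∈ vertical L a, ∀ v, form a u v = 0
  lorentzian : ∀ a, ∃ v, form a v v < 0 ∧
    ∀ w, form a v w = 0 → w ∉ vertical L a → 0 < form a w w
  /-- the form is constant along the fibres of `π` -/
  right_invariant : ∀ a, ∀ b ∈ L, ∀ u v : TangentSpace (𝓡 n) a,
    form (a * b) (mfderiv (𝓡 n) (𝓡 n) (fun x => x * b) a u)
      (mfderiv (𝓡 n) (𝓡 n) (fun x => x * b) a v) = form a u v
  /-- `G` acts on `M` by isometries -/
  left_invariant : ∀ b a, ∀ u v : TangentSpace (𝓡 n) a,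
    form (b * a) (mfderiv (𝓡 n) (𝓡 n) (fun x => b * x) a u)
      (mfderiv (𝓡 n) (𝓡 n) (fun x => b * x) a v) = form a u v

variable (n) in
/-- `L` is an admissible subgroup of `G`. -/
def IsAdmissible (L : Subgroup G) : Prop :=
  IsClosed (L : Set G) ∧ IsConnected (L : Set G) ∧ IsAlmostEffective L ∧
    Nonempty (InvariantLorentzMetric n L)

variable (n) in
/-- `M = G/L` is minimal admissible, i.e. `L` is maximal admissible. -/
def IsMinimalAdmissible (L : Subgroup G) : Prop :=
  IsAdmissible n L ∧ ∀ L' : Subgroup G, IsAdmissible n L' → L ≤ L' →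
    ¬ Module.finrank ℝ (lie (n := n) L) < Module.finrank ℝ (lie (n := n) L')

/-- A subspace of `𝔤` that is invariant under `Ad_L`. -/
def IsAdInvariant (L : Subgroup G) (V : Submodule ℝ (LieAlg n G)) : Prop :=
  ∀ a ∈ L, ∀ X ∈ V, Ad a X ∈ V

/-- `𝔤 = 𝔩 + 𝔪` is a reductive decomposition for `G/L`. -/
def IsReductiveDecomposition (L : Subgroup G) (m : Submodule ℝ (LieAlg n G)) : Prop :=
  IsCompl (lie L) m ∧ IsAdInvariant L m

/-- `𝔪^𝔩`, the centralizer of `𝔩 = Lie(L)` in `𝔪`. -/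
def fixed (L : Subgroup G) (m : Submodule ℝ (LieAlg n G)) : Submodule ℝ (LieAlg n G) :=
  m ⊓ centralizer (lie (n := n) L : Set (LieAlg n G))

variable (n) in
/-- `M = G/L` is of Type Ib: for some reductive decomposition, `𝔪^𝔩` is a three-dimensional simple
regular subalgebra. -/
def IsTypeIb (L : Subgroup G) : Prop :=
  ∃ m : Submodule ℝ (LieAlg n G), IsReductiveDecomposition L m ∧
    ∃ s : LieSubalgebra ℝ (LieAlg n G), s.toSubmodule = fixed L m ∧
      Module.finrank ℝ s = 3 ∧ LieAlgebra.IsSimple ℝ s ∧ IsRegularSubalgebra s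

/-- The reductive decomposition `𝔤 = 𝔩 + 𝔪 = 𝔩 + (𝔰 + 𝔪')`, `𝔰 ≅ sp(1)`, of a contact homogeneous
manifold of special type. -/
structure IsSpecialDecomposition (L : Subgroup G) (m m' : Submodule ℝ (LieAlg n G))
    (s : LieSubalgebra ℝ (LieAlg n G)) : Prop where
  reductive : IsReductiveDecomposition L m
  sup_eq : s.toSubmodule ⊔ m' = m
  disjoint : Disjoint s.toSubmodule m'
  invariant : IsAdInvariant L m'
  fixed_eq : fixed L m = s.toSubmodule
  iso_sp1 : Nonempty (s ≃ₗ⁅ℝ⁆ sp1)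
  centralizer_eq : centralizer (s : Set (LieAlg n G)) = lie L
  centralizer_singleton : ∀ Z ∈ s, Z ≠ 0 → centralizer {Z} = lie L ⊔ Submodule.span ℝ {Z}

variable (n) in
/-- `M = G/L` is a contact homogeneous manifold of special type. -/
def IsContactOfSpecialType (L : Subgroup G) : Prop :=
  ∃ (m m' : Submodule ℝ (LieAlg n G)) (s : LieSubalgebra ℝ (LieAlg n G)),
    IsSpecialDecomposition L m m' s

/-- The `G`-invariant distribution on `M = G/L` with value `d/𝔩 ⊆ 𝔤/𝔩 = T_o M` at `o = eL` is well
defined and a contact structure: `d` is an `Ad_L`-invariant hyperplane containing `𝔩`, and the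
Levi form `(X, Y) ↦ [X, Y] mod d` on `d` has kernel `𝔩`. -/
structure IsInvariantContactStructure (L : Subgroup G) (d : Submodule ℝ (LieAlg n G)) :
    Prop where
  le : lie L ≤ d
  invariant : IsAdInvariant L d
  hyperplane : Module.finrank ℝ d + 1 = Module.finrank ℝ (LieAlg n G)
  nondegenerate : ∀ X ∈ d, (∀ Y ∈ d, ⁅X, Y⁆ ∈ d) → X ∈ lie L

/-- The centralizer `C_G(𝔰)` of a subset of `𝔤` in the group `G`. -/
def groupCentralizer (s : Set (LieAlg n G)) : Set G :=
  {a | ∀ X ∈ s, Ad a X = X}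

end Homogeneous

end HomogeneousLorentz

end

open HomogeneousLorentz

noncomputable section

open scoped Topology

open Set Filter

set_option linter.unusedSectionVars false

namespace HomogeneousLorentz

/-! Write b for the negative Killing form, 𝔩 for Lie(L), C(·) for centralizers in 𝔤. Since G is
compact with simple Lie algebra, b is an `Ad`-invariant inner product (`killingForm_neg`,
`killingForm_Ad`), and the argument runs on orthogonality with respect to b.

Admissibility reduces to the existence of a fixed vector. An invariant Lorentzian form has only one
negative eigenline relative to b, so L acts on that line by signs, and exp(tX) = exp(tX/2)² acts
trivially. Hence an admissible L centralizes a nonzero vector orthogonal to 𝔩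
(`InvariantLorentzMetric.exists_fixed`). Conversely, reversing the sign of b along a fixed vector
outside 𝔩 gives an invariant Lorentzian metric, and almost effectiveness is automatic because 𝔤 has
no proper nonzero ideals (`isAdmissible_of_fixed`).

For a special decomposition, 𝔰 is orthogonal to its centralizer 𝔩, so C(Z) ∩ Z^⊥ = 𝔩 for nonzero Z
in 𝔰 (`IsSpecialDecomposition.mem_lie`). If K ⊇ L is admissible, its fixed vector Z' is orthogonal
to 𝔩, hence lies in 𝔪^𝔩 = 𝔰, and Lie(K) ⊆ C(Z') ∩ Z'^⊥ = 𝔩; this is minimality. The same identity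
makes the Levi form on Z^⊥ nondegenerate modulo 𝔩. Regularity holds because a maximal abelian
subalgebra through Z is Cartan and lies in C(Z) = 𝔩 + ℝZ, which normalizes 𝔰.

For the converse, maximality of L applied to the centralizer of 𝔰 gives C(𝔰) = 𝔩. The delicate point
is C(Z) = 𝔩 + ℝZ, which needs a closed subgroup of C_G(Z) that contains L and is transversal to Z.
Normalize Z like an imaginary unit. Then C_G(Z) acts complex linearly on the space where (ad Z)² =
-4, with complex structure ad Z / 2, and the subgroup wanted is the one where the complex
determinant is real and nonnegative (`phaseKernel`). Since exp(tZ) acts as the scalar e^{2it}, the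
phase of the determinant turns along Z. The group L commutes with a half-turn of 𝔰 that reverses Z;
this half-turn acts antilinearly, so determinants on L are real, and positive on squares
(`le_phaseKernel`). Maximality then identifies the Lie algebra of this subgroup with 𝔩
(`IsMinimalAdmissible.lie_eq`).

The underlying theory of closed subgroups rests on the exponential map. Because ad is injective, exp
can be recovered near 0 from the matrix exponential through Ad exp X = exp(ad X), which gives its
regularity without smooth dependence of integral curves on parameters (`eventually_expM_eq`). -/

/-- The model space of an `n`-dimensional manifold. -/
abbrev Model (n : ℕ) : Type := EuclideanSpace ℝ (Fin n)

/-! ### Derivatives as endomorphisms of the model space -/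

section TangentDerivative

variable {n : ℕ} {M M' M'' : Type*} [TopologicalSpace M] [ChartedSpace (Model n) M]
  [TopologicalSpace M'] [ChartedSpace (Model n) M'] [TopologicalSpace M'']
  [ChartedSpace (Model n) M'']

/-- The derivative of a map between `n`-manifolds as an endomorphism of the model space. -/
def tderiv (n : ℕ) {M M' : Type*} [TopologicalSpace M] [ChartedSpace (Model n) M]
    [TopologicalSpace M'] [ChartedSpace (Model n) M'] (f : M → M') (x : M) : Model n →L[ℝ] Model n :=
  mfderiv (𝓡 n) (𝓡 n) f x

theorem tderiv_comp {g : M' → M''} {f : M → M'} {x : M}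
    (hg : MDifferentiableAt (𝓡 n) (𝓡 n) g (f x)) (hf : MDifferentiableAt (𝓡 n) (𝓡 n) f x) :
    tderiv n (g ∘ f) x = (tderiv n g (f x)).comp (tderiv n f x) :=
  mfderiv_comp x hg hf

theorem tderiv_congr {f g : M → M'} {x : M} (h : f =ᶠ[𝓝 x] g) : tderiv n f x = tderiv n g x :=
  h.mfderiv_eq

theorem tderiv_id (x : M) : tderiv n (fun y : M => y) x = ContinuousLinearMap.id ℝ (Model n) :=
  mfderiv_id

theorem tderiv_eq_fderiv (f : Model n → Model n) (x : Model n) : tderiv n f x = fderiv ℝ f x :=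
  mfderiv_eq_fderiv

end TangentDerivative

/-! ### The adjoint representation and its smoothness -/

section Adjoint

variable {n : ℕ} {G : Type*} [TopologicalSpace G] [ChartedSpace (EuclideanSpace ℝ (Fin n)) G]
  [Group G] [LieGroup (𝓡 n) ∞ G]

theorem mdifferentiable_of_contMDiff {M M' : Type*} [TopologicalSpace M] [ChartedSpace (Model n) M]
    [TopologicalSpace M'] [ChartedSpace (Model n) M'] {f : M → M'}
    (hf : ContMDiff (𝓡 n) (𝓡 n) ∞ f) (x : M) : MDifferentiableAt (𝓡 n) (𝓡 n) f x :=
  hf.mdifferentiable (by simp) x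

theorem mdifferentiableAt_mul_left' (a x : G) :
    MDifferentiableAt (𝓡 n) (𝓡 n) (fun y : G => a * y) x :=
  mdifferentiable_of_contMDiff contMDiff_mul_left x

theorem mdifferentiableAt_mul_right' (a x : G) :
    MDifferentiableAt (𝓡 n) (𝓡 n) (fun y : G => y * a) x :=
  mdifferentiable_of_contMDiff contMDiff_mul_right x

theorem mdifferentiableAt_conj (a x : G) :
    MDifferentiableAt (𝓡 n) (𝓡 n) (fun y : G => a * y * a⁻¹) x :=
  mdifferentiable_of_contMDiff (contMDiff_mul_right.comp contMDiff_mul_left) x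

/-- The adjoint representation with values in the endomorphisms of the model space. -/
def adjointCLM (n : ℕ) {G : Type*} [TopologicalSpace G]
    [ChartedSpace (EuclideanSpace ℝ (Fin n)) G] [Group G] (a : G) : Model n →L[ℝ] Model n :=
  tderiv n (fun x : G => a * x * a⁻¹) 1

theorem adjointCLM_one : adjointCLM n (1 : G) = ContinuousLinearMap.id ℝ (Model n) := by
  unfold adjointCLM
  rw [← tderiv_id (1 : G)]
  exact tderiv_congr (Eventually.of_forall fun x => by simp)

theorem adjointCLM_mul (a b : G) :
    adjointCLM n (a * b) = (adjointCLM n a).comp (adjointCLM n b) := by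
  unfold adjointCLM
  have h : (fun x : G => a * b * x * (a * b)⁻¹) =
      (fun x : G => a * x * a⁻¹) ∘ (fun x : G => b * x * b⁻¹) := by
    ext x; simp [mul_assoc]
  rw [h, tderiv_comp (mdifferentiableAt_conj _ _) (mdifferentiableAt_conj _ _)]
  simp

theorem tderiv_mul_left_eq (a : G) :
    tderiv n (fun x : G => a * x) 1 =
      (tderiv n (fun x : G => x * a) 1).comp (adjointCLM n a) := by
  unfold adjointCLM
  have h : (fun x : G => a * x) = (fun x : G => x * a) ∘ (fun x : G => a * x * a⁻¹) := by
    ext x; simp [mul_assoc]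
  rw [h, tderiv_comp (mdifferentiableAt_mul_right' _ _) (mdifferentiableAt_conj _ _)]
  simp

/-- The map a x a⁻¹ is jointly smooth and sends 1 to 1 for every a, so its x-derivative at 1 acts on
one fixed tangent space. In the preferred trivializations no coordinate change intervenes, and
smoothness of the derivative family is smoothness of Ad. -/
theorem contMDiff_adjointCLM :
    ContMDiff (𝓡 n) 𝓘(ℝ, Model n →L[ℝ] Model n) ∞ (fun a : G => adjointCLM n a) := by
  intro a₀
  have hf : ContMDiffAt ((𝓡 n).prod (𝓡 n)) (𝓡 n) ∞
      (Function.uncurry fun (a x : G) => a * x * a⁻¹) (a₀, 1) := by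
    have : ContMDiff ((𝓡 n).prod (𝓡 n)) (𝓡 n) ∞ (fun p : G × G => p.1 * p.2 * p.1⁻¹) :=
      (contMDiff_fst.mul contMDiff_snd).mul contMDiff_fst.inv
    exact this.contMDiffAt
  have key := ContMDiffAt.mfderiv (m := ∞) (fun (a x : G) => a * x * a⁻¹) (fun _ => 1) hf
    contMDiffAt_const (by simp)
  refine key.congr_of_eventuallyEq (Eventually.of_forall fun a => ?_)
  have h1 : a * 1 * a⁻¹ = 1 := by simp
  have h2 : a₀ * 1 * a₀⁻¹ = 1 := by simp
  have := inTangentCoordinates_eq_mfderiv_comp (I := 𝓡 n) (I' := 𝓡 n) (f := fun _ : G => (1 : G))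
    (g := fun a : G => a * 1 * a⁻¹) (x₀ := a₀) (x := a)
    (ϕ := fun a => mfderiv (𝓡 n) (𝓡 n) (fun x : G => a * x * a⁻¹) 1)
    (mem_chart_source _ _) (by simp only [h1, h2]; exact mem_chart_source _ _)
  refine Eq.trans ?_ this.symm
  rw [mfderivWithin_range_extChartAt_symm]
  -- Both base points are the identity, where the preferred chart has derivative the identity map.
  have h3 : tderiv n (extChartAt (𝓡 n) (a₀ * 1 * a₀⁻¹)) (a * 1 * a⁻¹) =
      ContinuousLinearMap.id ℝ (Model n) := by
    rw [h1, h2]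
    exact mfderiv_extChartAt_self
  change adjointCLM n a = (tderiv n (extChartAt (𝓡 n) (a₀ * 1 * a₀⁻¹)) (a * 1 * a⁻¹)).comp
    ((adjointCLM n a).comp (ContinuousLinearMap.id ℝ (Model n)))
  rw [h3]
  rfl

end Adjoint

end HomogeneousLorentz

namespace HomogeneousLorentz

/-! ### The derivative of Ad is the Lie bracket -/

section AdjointDerivative

variable {n : ℕ} {G : Type*} [TopologicalSpace G] [ChartedSpace (EuclideanSpace ℝ (Fin n)) G]
  [Group G] [LieGroup (𝓡 n) ∞ G]

variable (n G) in
/-- The preferred chart of `G` at the identity. -/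
abbrev oneChart : PartialEquiv G (Model n) := extChartAt (𝓡 n) (1 : G)

variable (n G) in
/-- The multiplication of `G` in the preferred chart at the identity. -/
def chartMul (p : Model n × Model n) : Model n :=
  oneChart n G ((oneChart n G).symm p.1 * (oneChart n G).symm p.2)

theorem oneChart_symm_self : (oneChart n G).symm (oneChart n G 1) = 1 :=
  extChartAt_to_inv (I := 𝓡 n) (1 : G)

theorem contMDiffAt_oneChart_symm {x : Model n} (hx : x ∈ (oneChart n G).target) :
    ContMDiffAt (𝓡 n) (𝓡 n) ∞ (oneChart n G).symm x :=
  (contMDiffOn_extChartAt_symm (I := 𝓡 n) (n := ∞) (1 : G)).contMDiffAt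
    ((isOpen_extChartAt_target (I := 𝓡 n) (1 : G)).mem_nhds hx)

theorem contMDiffAt_oneChart {a : G} (ha : a ∈ (oneChart n G).source) :
    ContMDiffAt (𝓡 n) (𝓡 n) ∞ (oneChart n G) a :=
  (contMDiffOn_extChartAt (I := 𝓡 n) (n := ∞) (x := (1 : G))).contMDiffAt
    ((chartAt (EuclideanSpace ℝ (Fin n)) (1 : G)).open_source.mem_nhds (by simpa using ha))

theorem contDiffAt_chartMul :
    ContDiffAt ℝ ∞ (chartMul n G) (oneChart n G 1, oneChart n G 1) := by
  rw [← contMDiffAt_iff_contDiffAt]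
  have h1 := contMDiffAt_oneChart_symm (G := G) (mem_extChartAt_target (I := 𝓡 n) (1 : G))
  have hfst : ContMDiffAt 𝓘(ℝ, Model n × Model n) (𝓡 n) ∞
      (fun p : Model n × Model n => p.1) (oneChart n G 1, oneChart n G 1) :=
    contDiff_fst.contDiffAt.contMDiffAt
  have hsnd : ContMDiffAt 𝓘(ℝ, Model n × Model n) (𝓡 n) ∞
      (fun p : Model n × Model n => p.2) (oneChart n G 1, oneChart n G 1) :=
    contDiff_snd.contDiffAt.contMDiffAt
  have hm := (ContMDiffAt.comp (oneChart n G 1, oneChart n G 1) h1 hfst).mul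
    (ContMDiffAt.comp (oneChart n G 1, oneChart n G 1) h1 hsnd)
  refine ContMDiffAt.comp (oneChart n G 1, oneChart n G 1) (contMDiffAt_oneChart ?_) hm
  simp only [oneChart_symm_self, mul_one]
  exact mem_extChartAt_source (I := 𝓡 n) (1 : G)

theorem tderiv_oneChart_symm_one :
    tderiv n (oneChart n G).symm (oneChart n G 1) = ContinuousLinearMap.id ℝ (Model n) := by
  have := mfderivWithin_range_extChartAt_symm (I := 𝓡 n) (x := (1 : G))
  rw [(𝓡 n).range_eq_univ, mfderivWithin_univ] at this
  exact this

theorem eventually_oneChart_target : ∀ᶠ x in 𝓝 (oneChart n G 1), x ∈ (oneChart n G).target :=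
  (isOpen_extChartAt_target (I := 𝓡 n) (1 : G)).mem_nhds (mem_extChartAt_target (1 : G))

/-- Near the identity, the derivative of the chart is a left inverse of that of its inverse. -/
theorem tderiv_oneChart_comp_symm {x : Model n} (hx : x ∈ (oneChart n G).target) :
    (tderiv n (oneChart n G) ((oneChart n G).symm x)).comp (tderiv n (oneChart n G).symm x) =
      ContinuousLinearMap.id ℝ (Model n) := by
  have hs := (oneChart n G).map_target hx
  rw [← tderiv_comp ((contMDiffAt_oneChart hs).mdifferentiableAt (by simp))
    ((contMDiffAt_oneChart_symm hx).mdifferentiableAt (by simp)), ← tderiv_id x]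
  refine tderiv_congr ?_
  filter_upwards [(isOpen_extChartAt_target (I := 𝓡 n) (1 : G)).mem_nhds hx] with y hy
  exact (oneChart n G).right_inv hy

theorem tderiv_oneChart_symm_comp {x : Model n} (hx : x ∈ (oneChart n G).target) :
    (tderiv n (oneChart n G).symm x).comp (tderiv n (oneChart n G) ((oneChart n G).symm x)) =
      ContinuousLinearMap.id ℝ (Model n) := by
  have hs := (oneChart n G).map_target hx
  have h := (oneChart n G).right_inv hx
  have hc := (contMDiffAt_oneChart_symm hx).mdifferentiableAt (by simp)
  rw [← h] at hc
  have := tderiv_comp hc ((contMDiffAt_oneChart hs).mdifferentiableAt (by simp))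
  rw [h] at this
  rw [← this, ← tderiv_id ((oneChart n G).symm x)]
  refine tderiv_congr ?_
  filter_upwards [(isOpen_extChartAt_source (I := 𝓡 n) (1 : G)).mem_nhds hs] with y hy
  exact (oneChart n G).left_inv hy

variable (n G) in
/-- The partial derivative of `chartMul` in the second variable, at the identity. -/
def chartMulSnd (x : Model n) : Model n →L[ℝ] Model n :=
  (fderiv ℝ (chartMul n G) (x, oneChart n G 1)).comp (ContinuousLinearMap.inr ℝ _ _)

variable (n G) in
/-- The partial derivative of `chartMul` in the first variable, at the identity. -/
def chartMulFst (x : Model n) : Model n →L[ℝ] Model n :=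
  (fderiv ℝ (chartMul n G) (oneChart n G 1, x)).comp (ContinuousLinearMap.inl ℝ _ _)

theorem eventually_chartMul :
    ∀ᶠ p in 𝓝 (oneChart n G 1, oneChart n G 1), DifferentiableAt ℝ (chartMul n G) p := by
  have := ((contDiffAt_chartMul (n := n) (G := G)).of_le (m := 1) (by simp)).eventually (by simp)
  exact this.mono fun p hp => hp.differentiableAt (by simp)

theorem chartMulSnd_eq {x : Model n} (hx : x ∈ (oneChart n G).target)
    (hd : DifferentiableAt ℝ (chartMul n G) (x, oneChart n G 1)) :
    chartMulSnd n G x = (tderiv n (oneChart n G) ((oneChart n G).symm x)).comp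
      (tderiv n (fun y : G => (oneChart n G).symm x * y) 1) := by
  have h1 : HasFDerivAt (fun y => chartMul n G (x, y)) (chartMulSnd n G x) (oneChart n G 1) :=
    hd.hasFDerivAt.comp (oneChart n G 1) (hasFDerivAt_prodMk_right x _)
  rw [← h1.fderiv, ← tderiv_eq_fderiv]
  have hs := (oneChart n G).map_target hx
  have hc := (contMDiffAt_oneChart_symm (G := G)
    (mem_extChartAt_target (I := 𝓡 n) (1 : G))).mdifferentiableAt (by simp)
  have hm := mdifferentiableAt_mul_left' (n := n) ((oneChart n G).symm x)
    ((oneChart n G).symm (oneChart n G 1))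
  have hφ := (contMDiffAt_oneChart hs).mdifferentiableAt (by simp)
  have hm1 : (oneChart n G).symm x * (oneChart n G).symm (oneChart n G 1) =
      (oneChart n G).symm x := by rw [oneChart_symm_self]; simp
  have e : (fun y => chartMul n G (x, y)) = (oneChart n G) ∘
      ((fun y : G => (oneChart n G).symm x * y) ∘ (oneChart n G).symm) := rfl
  rw [e, tderiv_comp (by rw [Function.comp_apply, hm1]; exact hφ) (hm.comp _ hc),
    tderiv_comp hm hc, tderiv_oneChart_symm_one, Function.comp_apply, hm1, oneChart_symm_self]
  rfl

theorem chartMulFst_eq {x : Model n} (hx : x ∈ (oneChart n G).target)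
    (hd : DifferentiableAt ℝ (chartMul n G) (oneChart n G 1, x)) :
    chartMulFst n G x = (tderiv n (oneChart n G) ((oneChart n G).symm x)).comp
      (tderiv n (fun y : G => y * (oneChart n G).symm x) 1) := by
  have h1 : HasFDerivAt (fun y => chartMul n G (y, x)) (chartMulFst n G x) (oneChart n G 1) :=
    HasFDerivAt.comp (g := chartMul n G) (f := fun y => (y, x)) (oneChart n G 1) hd.hasFDerivAt
      (hasFDerivAt_prodMk_left _ x)
  rw [← h1.fderiv, ← tderiv_eq_fderiv]
  have hs := (oneChart n G).map_target hx
  have hc := (contMDiffAt_oneChart_symm (G := G)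
    (mem_extChartAt_target (I := 𝓡 n) (1 : G))).mdifferentiableAt (by simp)
  have hm := mdifferentiableAt_mul_right' (n := n) ((oneChart n G).symm x)
    ((oneChart n G).symm (oneChart n G 1))
  have hφ := (contMDiffAt_oneChart hs).mdifferentiableAt (by simp)
  have hm1 : (oneChart n G).symm (oneChart n G 1) * (oneChart n G).symm x =
      (oneChart n G).symm x := by rw [oneChart_symm_self]; simp
  have e : (fun y => chartMul n G (y, x)) = (oneChart n G) ∘
      ((fun y : G => y * (oneChart n G).symm x) ∘ (oneChart n G).symm) := rfl
  rw [e, tderiv_comp (by rw [Function.comp_apply, hm1]; exact hφ) (hm.comp _ hc),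
    tderiv_comp hm hc, tderiv_oneChart_symm_one, Function.comp_apply, hm1, oneChart_symm_self]
  rfl

theorem eventually_chartMul_left :
    ∀ᶠ x in 𝓝 (oneChart n G 1), DifferentiableAt ℝ (chartMul n G) (x, oneChart n G 1) :=
  (Continuous.prodMk_left (oneChart n G 1)).continuousAt.eventually eventually_chartMul

theorem eventually_chartMul_right :
    ∀ᶠ x in 𝓝 (oneChart n G 1), DifferentiableAt ℝ (chartMul n G) (oneChart n G 1, x) :=
  (Continuous.prodMk_right (oneChart n G 1)).continuousAt.eventually eventually_chartMul

variable (n G) in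
/-- The adjoint representation in the preferred chart at the identity. -/
def chartAdjoint (x : Model n) : Model n →L[ℝ] Model n := adjointCLM n ((oneChart n G).symm x)

theorem contDiffAt_chartAdjoint : ContDiffAt ℝ ∞ (chartAdjoint n G) (oneChart n G 1) := by
  rw [← contMDiffAt_iff_contDiffAt]
  exact ContMDiffAt.comp _ contMDiff_adjointCLM.contMDiffAt
    (contMDiffAt_oneChart_symm (mem_extChartAt_target (I := 𝓡 n) (1 : G)))

/-- Left translation is right translation after conjugation. Differentiating this factorization at
the identity is how the derivative of Ad is found. -/
theorem eventually_chartMulSnd_eq :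
    ∀ᶠ x in 𝓝 (oneChart n G 1),
      chartMulSnd n G x = (chartMulFst n G x).comp (chartAdjoint n G x) := by
  filter_upwards [eventually_oneChart_target, eventually_chartMul_left,
    eventually_chartMul_right] with x hx h1 h2
  rw [chartMulSnd_eq hx h1, chartMulFst_eq hx h2, chartAdjoint, ContinuousLinearMap.comp_assoc,
    tderiv_mul_left_eq]

variable (n G) in
/-- The second derivative of `chartMul` at the identity. -/
def chartMulSecond : Model n × Model n →L[ℝ] Model n × Model n →L[ℝ] Model n :=
  fderiv ℝ (fderiv ℝ (chartMul n G)) (oneChart n G 1, oneChart n G 1)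

theorem hasFDerivAt_fderiv_chartMul :
    HasFDerivAt (fderiv ℝ (chartMul n G)) (chartMulSecond n G)
      (oneChart n G 1, oneChart n G 1) :=
  ((contDiffAt_chartMul (n := n) (G := G)).fderiv_right (m := ∞) (by simp)
    |>.differentiableAt (by simp)).hasFDerivAt

theorem hasFDerivAt_chartMulSnd (Y : Model n) :
    HasFDerivAt (fun x => chartMulSnd n G x Y)
      (((chartMulSecond n G).comp (ContinuousLinearMap.inl ℝ _ _)).flip (0, Y))
      (oneChart n G 1) := by
  have h := HasFDerivAt.comp (f := fun y => (y, oneChart n G 1)) (oneChart n G 1)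
    (hasFDerivAt_fderiv_chartMul (n := n) (G := G))
    (hasFDerivAt_prodMk_left (oneChart n G 1) (oneChart n G 1))
  have h' := h.clm_apply (hasFDerivAt_const ((0 : Model n), Y) (oneChart n G 1))
  rw [ContinuousLinearMap.comp_zero, zero_add] at h'
  exact h'

theorem hasFDerivAt_chartMulFst (Y : Model n) :
    HasFDerivAt (fun x => chartMulFst n G x Y)
      (((chartMulSecond n G).comp (ContinuousLinearMap.inr ℝ _ _)).flip (Y, 0))
      (oneChart n G 1) := by
  have h := (hasFDerivAt_fderiv_chartMul (n := n) (G := G)).comp (oneChart n G 1)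
    (hasFDerivAt_prodMk_right (oneChart n G 1) (oneChart n G 1))
  have h' := h.clm_apply (hasFDerivAt_const (Y, (0 : Model n)) (oneChart n G 1))
  rw [ContinuousLinearMap.comp_zero, zero_add] at h'
  exact h'

theorem chartMulFst_one :
    chartMulFst n G (oneChart n G 1) = ContinuousLinearMap.id ℝ (Model n) := by
  rw [chartMulFst_eq eventually_oneChart_target.self_of_nhds
    eventually_chartMul_right.self_of_nhds, oneChart_symm_self,
    tderiv_congr (g := fun y : G => y) (Eventually.of_forall fun y => mul_one y), tderiv_id]
  exact mfderiv_extChartAt_self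

theorem chartMulSnd_one :
    chartMulSnd n G (oneChart n G 1) = ContinuousLinearMap.id ℝ (Model n) := by
  rw [chartMulSnd_eq eventually_oneChart_target.self_of_nhds
    eventually_chartMul_left.self_of_nhds, oneChart_symm_self,
    tderiv_congr (g := fun y : G => y) (Eventually.of_forall fun y => one_mul y), tderiv_id]
  exact mfderiv_extChartAt_self

/-- Product rule for the factorization `eventually_chartMulSnd_eq`; both factors on the right are
the identity at the base point, so the derivative of Ad is the difference of the derivatives of the
two partials. -/
theorem fderiv_chartAdjoint_apply (X Y : Model n) :
    fderiv ℝ (chartAdjoint n G) (oneChart n G 1) X Y =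
      chartMulSecond n G (X, 0) (0, Y) - chartMulSecond n G (0, X) (Y, 0) := by
  have hA : HasFDerivAt (chartAdjoint n G) (fderiv ℝ (chartAdjoint n G) (oneChart n G 1))
      (oneChart n G 1) :=
    (contDiffAt_chartAdjoint.differentiableAt (by simp)).hasFDerivAt
  have hF : DifferentiableAt ℝ (chartMulFst n G) (oneChart n G 1) := by
    have h := HasFDerivAt.comp (f := fun y => (oneChart n G 1, y)) (oneChart n G 1)
      (hasFDerivAt_fderiv_chartMul (n := n) (G := G))
      (hasFDerivAt_prodMk_right (oneChart n G 1) (oneChart n G 1))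
    exact (h.clm_comp (hasFDerivAt_const
      (ContinuousLinearMap.inl ℝ (Model n) (Model n)) (oneChart n G 1))).differentiableAt
  have hFY : fderiv ℝ (chartMulFst n G) (oneChart n G 1) X Y =
      chartMulSecond n G (0, X) (Y, 0) := by
    have h1 := hF.hasFDerivAt.clm_apply (hasFDerivAt_const Y (oneChart n G 1))
    have h2 := h1.unique (hasFDerivAt_chartMulFst Y)
    simpa using congrArg (fun T => T X) h2
  have h1 := (hF.hasFDerivAt.clm_comp hA).clm_apply (hasFDerivAt_const Y (oneChart n G 1))
  have h2 := (hasFDerivAt_chartMulSnd (n := n) (G := G) Y).congr_of_eventuallyEq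
    (f₁ := fun x => ((chartMulFst n G x).comp (chartAdjoint n G x)) Y)
    (eventually_chartMulSnd_eq.mono fun x hx => congrArg (fun T => T Y) hx.symm)
  have h3 := congrArg (fun T => T X) (h1.unique h2)
  have hA1 : chartAdjoint n G (oneChart n G 1) = ContinuousLinearMap.id ℝ (Model n) := by
    rw [chartAdjoint, oneChart_symm_self, adjointCLM_one]
  have hF1 := chartMulFst_one (n := n) (G := G)
  clear h1 h2 hA hF
  generalize oneChart n G 1 = o at *
  simp [hF1, hA1, hFY] at h3
  rw [← h3, add_sub_cancel_right]

/-- Left-invariant fields in the preferred chart at the identity. -/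
theorem mpullback_mulInvariantVectorField_eq (X : LieAlg n G) :
    VectorField.mpullbackWithin (𝓡 n) (𝓡 n) (oneChart n G).symm
      (mulInvariantVectorField X) (range (𝓡 n)) =ᶠ[𝓝 (oneChart n G 1)]
      fun x => chartMulSnd n G x X := by
  filter_upwards [eventually_oneChart_target, eventually_chartMul_left] with x hx h1
  rw [VectorField.mpullbackWithin_apply, (𝓡 n).range_eq_univ, mfderivWithin_univ,
    chartMulSnd_eq hx h1]
  have := ContinuousLinearMap.inverse_eq (tderiv_oneChart_symm_comp (G := G) hx)
    (tderiv_oneChart_comp_symm hx)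
  exact congrArg (fun T : Model n →L[ℝ] Model n =>
    T (tderiv n (fun y : G => (oneChart n G).symm x * y) 1 X)) this

variable (G) in
/-- The bracket of `𝔤` as an operation on the model space. -/
def modelBracket (X Y : Model n) : Model n := 
  Bracket.bracket (L := LieAlg n G) (M := LieAlg n G) X Y

/-- In the chart a left-invariant field is x ↦ `chartMulSnd n G x X`, and the bracket of vector
fields is DY(X) - DX(Y), a difference of mixed second derivatives of the multiplication. -/
theorem modelBracket_eq_chartMulSecond (X Y : Model n) :
    modelBracket G X Y =
      chartMulSecond n G (X, 0) (0, Y) - chartMulSecond n G (Y, 0) (0, X) := by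
  have h0 : modelBracket G X Y = ((tderiv n (oneChart n G) 1).inverse
      (VectorField.lieBracketWithin ℝ
        (VectorField.mpullbackWithin (𝓡 n) (𝓡 n) (oneChart n G).symm
          (mulInvariantVectorField (I := 𝓡 n) (G := G) X) (range (𝓡 n)))
        (VectorField.mpullbackWithin (𝓡 n) (𝓡 n) (oneChart n G).symm
          (mulInvariantVectorField (I := 𝓡 n) (G := G) Y) (range (𝓡 n)))
        ((oneChart n G).symm ⁻¹' univ ∩ range (𝓡 n)) (oneChart n G 1))) :=
    (congrFun VectorField.mlieBracketWithin_univ.symm 1).trans VectorField.mlieBracketWithin_apply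
  have h1 : tderiv n (oneChart n G) 1 = ContinuousLinearMap.id ℝ (Model n) :=
    mfderiv_extChartAt_self
  rw [h0, h1, ContinuousLinearMap.inverse_id, preimage_univ, univ_inter]
  have hX := mpullback_mulInvariantVectorField_eq (G := G) X
  have hY := mpullback_mulInvariantVectorField_eq (G := G) Y
  rw [(𝓡 n).range_eq_univ] at hX hY ⊢
  refine Eq.trans (b := VectorField.lieBracket ℝ (fun x => chartMulSnd n G x X)
    (fun x => chartMulSnd n G x Y) (oneChart n G 1)) ?_ ?_
  · refine Eq.trans ?_ (hX.lieBracket_vectorField_eq hY)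
    exact congrFun VectorField.lieBracketWithin_univ (oneChart n G 1)
  · rw [VectorField.lieBracket_eq]
    simp only [(hasFDerivAt_chartMulSnd _).fderiv, chartMulSnd_one]
    rfl

/-- The two expressions through the second derivative agree by its symmetry. -/
theorem fderiv_chartAdjoint_eq_bracket (X Y : Model n) :
    fderiv ℝ (chartAdjoint n G) (oneChart n G 1) X Y = modelBracket G X Y := by
  rw [modelBracket_eq_chartMulSecond, fderiv_chartAdjoint_apply]
  have h : IsSymmSndFDerivAt ℝ (chartMul n G) (oneChart n G 1, oneChart n G 1) :=
    contDiffAt_chartMul.isSymmSndFDerivAt (by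
      rw [minSmoothness_of_isRCLikeNormedField]; exact ENat.LEInfty.out)
  have := h (0, X) (Y, 0)
  exact congrArg (fun v => chartMulSecond n G (X, 0) (0, Y) - v) this

end AdjointDerivative

end HomogeneousLorentz

namespace HomogeneousLorentz

/-! ### One-parameter subgroups and Ad exp = exp ad -/

section OneParameterSubgroups

variable {n : ℕ} {G : Type*} [TopologicalSpace G] [ChartedSpace (EuclideanSpace ℝ (Fin n)) G]
  [Group G] [LieGroup (𝓡 n) ∞ G]

theorem isTopologicalGroup_of_lieGroup (n : ℕ) (G : Type*) [TopologicalSpace G]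
    [ChartedSpace (EuclideanSpace ℝ (Fin n)) G] [Group G] [LieGroup (𝓡 n) ∞ G] :
    IsTopologicalGroup G :=
  topologicalGroup_of_lieGroup (𝓡 n) ∞

theorem t2Space_of_lieGroup (n : ℕ) (G : Type*) [TopologicalSpace G]
    [ChartedSpace (EuclideanSpace ℝ (Fin n)) G] [Group G] [LieGroup (𝓡 n) ∞ G] : T2Space G := by
  have := isTopologicalGroup_of_lieGroup n G
  have : T1Space G := ChartedSpace.t1Space (EuclideanSpace ℝ (Fin n)) G
  infer_instance

variable (G) in
/-- The adjoint representation of `𝔤`, as a continuous bilinear map on the model space. -/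
def adCLM : Model n →L[ℝ] Model n →L[ℝ] Model n := fderiv ℝ (chartAdjoint n G) (oneChart n G 1)

theorem adCLM_apply (X Y : Model n) : adCLM G X Y = modelBracket G X Y :=
  fderiv_chartAdjoint_eq_bracket X Y

theorem hasStrictFDerivAt_chartAdjoint :
    HasStrictFDerivAt (chartAdjoint n G) (adCLM G) (oneChart n G 1) :=
  contDiffAt_chartAdjoint.hasStrictFDerivAt (by simp)

theorem hasMFDerivAt_oneChart :
    HasMFDerivAt (𝓡 n) (𝓡 n) (oneChart n G) 1 (ContinuousLinearMap.id ℝ (Model n)) := by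
  have := (contMDiffAt_oneChart (n := n)
    (mem_extChartAt_source (I := 𝓡 n) (1 : G))).mdifferentiableAt (by simp) |>.hasMFDerivAt
  rwa [mfderiv_extChartAt_self] at this

theorem hasDerivAt_oneChart_comp {γ : ℝ → G} {X : Model n} (h0 : γ 0 = 1)
    (hd : MDifferentiableAt 𝓘(ℝ, ℝ) (𝓡 n) γ 0)
    (hX : (mfderiv 𝓘(ℝ, ℝ) (𝓡 n) γ 0 (1 : ℝ) : EuclideanSpace ℝ (Fin n)) = X) :
    HasDerivAt (fun t => oneChart n G (γ t)) X 0 := by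
  have h := hasMFDerivAt_oneChart (n := n) (G := G)
  rw [← h0] at h
  obtain ⟨T, hT⟩ : ∃ T : ℝ →L[ℝ] Model n, T = mfderiv 𝓘(ℝ, ℝ) (𝓡 n) γ 0 := ⟨_, rfl⟩
  have hc : HasFDerivAt (fun t => oneChart n G (γ t)) T 0 := by
    rw [hT]
    exact hasMFDerivAt_iff_hasFDerivAt.1 (HasMFDerivAt.comp (0 : ℝ) h hd.hasMFDerivAt)
  have e : T 1 = X := by rw [← hX, hT]; rfl
  rw [← e]
  exact hc.hasDerivAt

theorem hasDerivAt_adjointCLM {γ : ℝ → G} {X : Model n} (h0 : γ 0 = 1) (hcont : ContinuousAt γ 0)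
    (h : HasDerivAt (fun t => oneChart n G (γ t)) X 0) :
    HasDerivAt (fun t => adjointCLM n (γ t)) (adCLM G X) 0 := by
  have hA := (hasStrictFDerivAt_chartAdjoint (n := n) (G := G)).hasFDerivAt
  rw [← h0] at hA
  have hc := hA.comp_hasDerivAt (0 : ℝ) h
  refine hc.congr_of_eventuallyEq ?_
  have hs : ∀ᶠ t in 𝓝 (0 : ℝ), γ t ∈ (oneChart n G).source :=
    hcont.eventually (by
      rw [h0]; exact (isOpen_extChartAt_source (1 : G)).mem_nhds (mem_extChartAt_source (1 : G)))
  filter_upwards [hs] with t ht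
  rw [Function.comp_apply, chartAdjoint, (oneChart n G).left_inv ht]

theorem tderiv_mul_left_mul (a b : G) :
    tderiv n (fun x : G => a * b * x) 1 =
      (tderiv n (fun x : G => a * x) b).comp (tderiv n (fun x : G => b * x) 1) := by
  have h : (fun x : G => a * b * x) = (fun x : G => a * x) ∘ (fun x : G => b * x) := by
    ext x; simp [mul_assoc]
  rw [h, tderiv_comp (mdifferentiableAt_mul_left' _ _) (mdifferentiableAt_mul_left' _ _)]
  simp

theorem hasMFDerivAt_mul_left_comp {γ : ℝ → G} {X : LieAlg n G} (a : G) {t : ℝ}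
    (h : HasMFDerivAt 𝓘(ℝ, ℝ) (𝓡 n) γ t
      ((1 : ℝ →L[ℝ] ℝ).smulRight (mulInvariantVectorField X (γ t)))) :
    HasMFDerivAt 𝓘(ℝ, ℝ) (𝓡 n) (fun s => a * γ s) t
      ((1 : ℝ →L[ℝ] ℝ).smulRight (mulInvariantVectorField X (a * γ t))) := by
  have hc := HasMFDerivAt.comp t (mdifferentiableAt_mul_left' (n := n) a (γ t)).hasMFDerivAt h
  have e := congrArg (fun T => T X) (tderiv_mul_left_mul (n := n) a (γ t))
  refine HasMFDerivAt.congr_mfderiv hc ?_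
  refine ContinuousLinearMap.ext fun (s : ℝ) => ?_
  change tderiv n (fun x : G => a * x) (γ t) (s • tderiv n (fun x : G => γ t * x) 1 X) =
    s • tderiv n (fun x : G => a * γ t * x) 1 X
  rw [map_smul]
  exact congrArg (fun v => s • v) e.symm

theorem isMIntegralCurve_mul_left {γ : ℝ → G} {X : LieAlg n G} (a : G)
    (h : IsMIntegralCurve γ (mulInvariantVectorField (I := 𝓡 n) X)) :
    IsMIntegralCurve (fun t => a * γ t) (mulInvariantVectorField (I := 𝓡 n) X) :=
  fun t => hasMFDerivAt_mul_left_comp a (h t)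

theorem contMDiff_mulInvariantVectorField_one (X : LieAlg n G) :
    ContMDiff (𝓡 n) (𝓡 n).tangent 1
      (fun g : G => (⟨g, mulInvariantVectorField X g⟩ : TangentBundle (𝓡 n) G)) :=
  (contMDiff_mulInvariantVectorField X).of_le (by
    rw [minSmoothness_of_isRCLikeNormedField]; norm_num)

/-- Left translates of a local integral curve through 1 are integral curves through every point with
the same lifetime ε; a uniform lifetime forces completeness. -/
theorem exists_isMIntegralCurve_mulInvariantVectorField (X : LieAlg n G) :
    ∃ γ : ℝ → G, γ 0 = 1 ∧ IsMIntegralCurve γ (mulInvariantVectorField (I := 𝓡 n) X) := by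
  have := t2Space_of_lieGroup n G
  obtain ⟨γ, h0, hγ⟩ := exists_isMIntegralCurveAt_of_contMDiffAt_boundaryless (0 : ℝ)
    ((contMDiff_mulInvariantVectorField_one X) 1)
  obtain ⟨ε, hε, h⟩ := isMIntegralCurveAt_iff'.1 hγ
  refine exists_isMIntegralCurve_of_isMIntegralCurveOn
    (contMDiff_mulInvariantVectorField_one X) hε (fun a => ?_) 1
  refine ⟨fun t => a * γ t, by simp [h0], fun t ht => ?_⟩
  rw [Real.ball_eq_Ioo, zero_sub, zero_add] at h
  exact (hasMFDerivAt_mul_left_comp a ((h t ht).hasMFDerivAt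
    (Ioo_mem_nhds ht.1 ht.2))).hasMFDerivWithinAt

/-- The one-parameter subgroup with velocity `X`. -/
def oneParam (X : LieAlg n G) : ℝ → G :=
  (exists_isMIntegralCurve_mulInvariantVectorField X).choose

theorem oneParam_zero (X : LieAlg n G) : oneParam X 0 = 1 :=
  (exists_isMIntegralCurve_mulInvariantVectorField X).choose_spec.1

theorem isMIntegralCurve_oneParam (X : LieAlg n G) :
    IsMIntegralCurve (oneParam X) (mulInvariantVectorField (I := 𝓡 n) X) :=
  (exists_isMIntegralCurve_mulInvariantVectorField X).choose_spec.2

theorem oneParam_unique {X : LieAlg n G} {γ γ' : ℝ → G}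
    (h : IsMIntegralCurve γ (mulInvariantVectorField (I := 𝓡 n) X))
    (h' : IsMIntegralCurve γ' (mulInvariantVectorField (I := 𝓡 n) X)) (h0 : γ 0 = γ' 0) :
    γ = γ' := by
  have := t2Space_of_lieGroup n G
  exact isMIntegralCurve_Ioo_eq_of_contMDiff_boundaryless (t₀ := 0)
    (contMDiff_mulInvariantVectorField_one X) h h' h0

theorem oneParam_add (X : LieAlg n G) (s t : ℝ) :
    oneParam X (s + t) = oneParam X s * oneParam X t := by
  have h1 := (isMIntegralCurve_oneParam X).comp_add s
  have h2 := isMIntegralCurve_mul_left (oneParam X s) (isMIntegralCurve_oneParam X)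
  have := congrFun (oneParam_unique h1 h2 (by simp [oneParam_zero])) t
  simpa [add_comm] using this

theorem oneParam_smul (X : LieAlg n G) (c t : ℝ) :
    oneParam (c • X) t = oneParam X (t * c) := by
  have h1 := (isMIntegralCurve_oneParam X).comp_mul c
  rw [← mulInvariantVectorField_smul] at h1
  exact congrFun (oneParam_unique (isMIntegralCurve_oneParam (c • X)) h1
    (by simp [oneParam_zero])) t

/-- The exponential map of `G`. -/
def expG (X : LieAlg n G) : G := oneParam X 1

theorem expG_smul (t : ℝ) (X : LieAlg n G) : expG (t • X) = oneParam X t := by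
  rw [expG, oneParam_smul, one_mul]

theorem expG_add_smul (s t : ℝ) (X : LieAlg n G) :
    expG ((s + t) • X) = expG (s • X) * expG (t • X) := by
  simp only [expG_smul, oneParam_add]

theorem expG_zero : expG (0 : LieAlg n G) = 1 := by
  have := expG_smul 0 (0 : LieAlg n G)
  rwa [smul_zero, oneParam_zero] at this

theorem expG_neg (X : LieAlg n G) : expG (-X) = (expG X)⁻¹ := by
  have := expG_add_smul (-1) 1 X
  rw [neg_add_cancel, zero_smul, expG_zero, neg_one_smul, one_smul] at this
  exact eq_inv_of_mul_eq_one_left this.symm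

theorem expG_natCast_smul (k : ℕ) (X : LieAlg n G) : expG ((k : ℝ) • X) = expG X ^ k := by
  induction k with
  | zero => simp [expG_zero]
  | succ k ih => rw [Nat.cast_succ, expG_add_smul, ih, one_smul, pow_succ]

theorem continuous_oneParam (X : LieAlg n G) : Continuous (oneParam X) :=
  continuous_iff_continuousAt.2 fun t => (isMIntegralCurve_oneParam X t).continuousAt

theorem tderiv_one_mul : tderiv n (fun x : G => 1 * x) 1 = ContinuousLinearMap.id ℝ (Model n) := by
  rw [tderiv_congr (g := fun x : G => x) (Eventually.of_forall fun x => one_mul x), tderiv_id]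

theorem oneParam_velocity (X : LieAlg n G) :
    MDifferentiableAt 𝓘(ℝ, ℝ) (𝓡 n) (oneParam X) 0 ∧
      (mfderiv 𝓘(ℝ, ℝ) (𝓡 n) (oneParam X) 0 (1 : ℝ) : EuclideanSpace ℝ (Fin n)) = X := by
  have h := isMIntegralCurve_oneParam X 0
  refine ⟨h.mdifferentiableAt, ?_⟩
  rw [h.mfderiv]
  change (1 : ℝ) • tderiv n (fun x : G => oneParam X 0 * x) 1 X = X
  rw [one_smul, oneParam_zero]
  exact congrArg (fun T => T X) (tderiv_one_mul (n := n) (G := G))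

theorem hasDerivAt_oneChart_oneParam (X : LieAlg n G) :
    HasDerivAt (fun t => oneChart n G (oneParam X t)) (X : Model n) 0 :=
  hasDerivAt_oneChart_comp (oneParam_zero X) (oneParam_velocity X).1 (oneParam_velocity X).2

/-- The product f(t) exp(-tA) has zero derivative. -/
theorem eq_exp_smul_of_hasDerivAt {𝔸 : Type*} [NormedRing 𝔸] [NormedAlgebra ℝ 𝔸]
    [CompleteSpace 𝔸] {f : ℝ → 𝔸} {A : 𝔸} (h0 : f 0 = 1) (hf : ∀ s, HasDerivAt f (f s * A) s)
    (t : ℝ) : f t = NormedSpace.exp (t • A) := by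
  let : NormedAlgebra ℚ 𝔸 := NormedAlgebra.restrictScalars ℚ ℝ 𝔸
  have hg : ∀ s, HasDerivAt (fun u => f u * NormedSpace.exp (u • (-A))) 0 s := by
    intro s
    have h1 := (hf s).mul (hasDerivAt_exp_smul_const' (𝕂 := ℝ) (-A) s)
    have e : f s * A * NormedSpace.exp (s • (-A)) + f s * (-A * NormedSpace.exp (s • (-A))) = 0 := by
      noncomm_ring
    rwa [e] at h1
  have hconst := is_const_of_deriv_eq_zero (fun s => (hg s).differentiableAt)
    (fun s => (hg s).deriv) t 0
  simp only [zero_smul, NormedSpace.exp_zero, mul_one, h0] at hconst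
  have hinv : NormedSpace.exp (t • (-A)) * NormedSpace.exp (t • A) = 1 := by
    rw [smul_neg, ← NormedSpace.exp_add_of_commute (Commute.neg_left (Commute.refl _)),
      neg_add_cancel, NormedSpace.exp_zero]
  calc f t = f t * (NormedSpace.exp (t • (-A)) * NormedSpace.exp (t • A)) := by rw [hinv, mul_one]
    _ = NormedSpace.exp (t • A) := by rw [← mul_assoc, hconst, one_mul]

theorem adjointCLM_oneParam (X : LieAlg n G) (t : ℝ) :
    adjointCLM n (oneParam X t) = NormedSpace.exp (t • adCLM G X) := by
  set A : Model n →L[ℝ] Model n := adCLM G X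
  set f : ℝ → (Model n →L[ℝ] Model n) := fun t => adjointCLM n (oneParam X t)
  have h0 : HasDerivAt f A 0 := hasDerivAt_adjointCLM (oneParam_zero X)
    (continuous_oneParam X).continuousAt (hasDerivAt_oneChart_oneParam X)
  have hf : ∀ s, HasDerivAt f (f s * A) s := by
    intro s
    have h1 : HasDerivAt (fun u => f (u - s)) A s := by
      have : HasDerivAt f A (s - s) := by rwa [sub_self]
      simpa using this.comp_sub_const s s
    refine (h1.const_mul (f s)).congr_of_eventuallyEq (Eventually.of_forall fun u => ?_)
    change adjointCLM n (oneParam X u) =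
      (adjointCLM n (oneParam X s)).comp (adjointCLM n (oneParam X (u - s)))
    rw [← adjointCLM_mul, ← oneParam_add, add_sub_cancel]
  refine eq_exp_smul_of_hasDerivAt ?_ hf t
  change adjointCLM n (oneParam X 0) = 1
  rw [oneParam_zero, adjointCLM_one]; rfl

end OneParameterSubgroups

end HomogeneousLorentz

namespace HomogeneousLorentz

/-! ### The exponential map near the origin -/

section ExponentialChart

variable {n : ℕ} {G : Type*} [TopologicalSpace G] [ChartedSpace (EuclideanSpace ℝ (Fin n)) G]
  [Group G] [LieGroup (𝓡 n) ∞ G]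

variable (G) in
/-- The exponential map of `G`, as a map on the model space. -/
def expM (X : Model n) : G := expG (n := n) X

theorem expM_smul_eq (t : ℝ) (X : Model n) :
    expM G (t • X) = oneParam (n := n) (G := G) X t := expG_smul (n := n) t X

theorem expM_zero : expM G (0 : Model n) = 1 := expG_zero

theorem expM_neg (X : Model n) : expM G (-X) = (expM G X)⁻¹ := expG_neg (n := n) X

theorem expM_natCast_smul (k : ℕ) (X : Model n) : expM G ((k : ℝ) • X) = expM G X ^ k :=
  expG_natCast_smul (n := n) k X

theorem continuous_expM_smul (X : Model n) : Continuous fun t : ℝ => expM G (t • X) := by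
  have h : (fun t : ℝ => expM G (t • X)) = oneParam (n := n) (G := G) X :=
    funext fun t => expM_smul_eq t X
  rw [h]
  exact continuous_oneParam (n := n) (G := G) X

theorem adjointCLM_expM (X : Model n) :
    adjointCLM n (expM G X) = NormedSpace.exp (adCLM G X) := by
  have h := adjointCLM_oneParam (n := n) (G := G) X 1
  rwa [one_smul] at h

theorem map_oneChart_symm_nhds :
    map (oneChart n G).symm (𝓝 (oneChart n G 1)) = 𝓝 (1 : G) := by
  rw [← map_extChartAt_nhds_of_boundaryless (I := 𝓡 n) (1 : G), map_map]
  have : (oneChart n G).symm ∘ oneChart n G =ᶠ[𝓝 (1 : G)] id := by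
    filter_upwards [(isOpen_extChartAt_source (I := 𝓡 n) (1 : G)).mem_nhds
      (mem_extChartAt_source (1 : G))] with x hx using (oneChart n G).left_inv hx
  rw [map_congr this, map_id]

/-- The inverse function theorem, read through the chart at 1. -/
theorem map_nhds_zero_of_hasStrictFDerivAt {f : Model n → G} (h0 : f 0 = 1)
    (hc : ContinuousAt f 0)
    (hf : HasStrictFDerivAt (fun X => oneChart n G (f X)) (ContinuousLinearMap.id ℝ (Model n)) 0) :
    map f (𝓝 0) = 𝓝 1 := by
  have h1 : map (fun X => oneChart n G (f X)) (𝓝 0) = 𝓝 (oneChart n G 1) := by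
    have := hf.map_nhds_eq_of_equiv (f' := ContinuousLinearEquiv.refl ℝ (Model n))
    rwa [h0] at this
  have h2 : (fun X => (oneChart n G).symm (oneChart n G (f X))) =ᶠ[𝓝 0] f := by
    have : ∀ᶠ X in 𝓝 (0 : Model n), f X ∈ (oneChart n G).source :=
      hc.eventually (by
        rw [h0]
        exact (isOpen_extChartAt_source (1 : G)).mem_nhds (mem_extChartAt_source (1 : G)))
    filter_upwards [this] with X hX using (oneChart n G).left_inv hX
  rw [← map_oneChart_symm_nhds (n := n), ← h1, map_map, ← map_congr h2]
  rfl

theorem exists_leftInverse_adCLM (hinj : Function.Injective (adCLM (n := n) G)) :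
    ∃ P : (Model n →L[ℝ] Model n) →L[ℝ] Model n,
      P.comp (adCLM G) = ContinuousLinearMap.id ℝ (Model n) := by
  obtain ⟨P, hP⟩ := LinearMap.exists_leftInverse_of_injective
    (adCLM (n := n) G : Model n →ₗ[ℝ] Model n →L[ℝ] Model n) (LinearMap.ker_eq_bot.2 hinj)
  refine ⟨LinearMap.toContinuousLinearMap P, ContinuousLinearMap.ext fun X => ?_⟩
  exact congrArg (fun T => T X) hP

/-- Let P be a left inverse of ad. Then P ∘ Ad, read in the chart, has derivative the identity at
the base point and so has a local inverse, while P(Ad exp X) = P(exp(ad X)) is an explicit regular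
function u of X. Inverting P ∘ Ad expresses exp X through u(X). The inversion is valid only once exp
X is known to be close to 1; this is propagated along the segment t ↦ tX. -/
theorem eventually_expM_eq (hinj : Function.Injective (adCLM (n := n) G)) :
    ∃ ρ : Model n → Model n,
      HasStrictFDerivAt ρ (ContinuousLinearMap.id ℝ (Model n)) 0 ∧
      ∀ᶠ X in 𝓝 (0 : Model n), ρ X ∈ (oneChart n G).target ∧ ContinuousAt ρ X ∧
        expM G X = (oneChart n G).symm (ρ X) := by
  have hT2 := t2Space_of_lieGroup n G
  obtain ⟨P, hP⟩ := exists_leftInverse_adCLM hinj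
  set o := oneChart n G 1
  have hh : HasStrictFDerivAt (fun x => P (chartAdjoint n G x))
      ((ContinuousLinearEquiv.refl ℝ (Model n) : Model n ≃L[ℝ] Model n) : Model n →L[ℝ] Model n)
      o := by
    have := P.hasStrictFDerivAt.comp o (hasStrictFDerivAt_chartAdjoint (n := n) (G := G))
    rw [hP] at this
    exact this
  set e := hh.toOpenPartialHomeomorph
  have he : ∀ x, e x = P (chartAdjoint n G x) := fun x =>
    congrFun hh.toOpenPartialHomeomorph_coe x
  have heo : o ∈ e.source := hh.mem_toOpenPartialHomeomorph_source
  have hu : HasStrictFDerivAt (fun X : Model n => P (NormedSpace.exp (adCLM G X)))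
      (ContinuousLinearMap.id ℝ (Model n)) 0 := by
    have h1 : HasStrictFDerivAt (NormedSpace.exp : (Model n →L[ℝ] Model n) → _)
        (1 : (Model n →L[ℝ] Model n) →L[ℝ] (Model n →L[ℝ] Model n)) (adCLM (n := n) G 0) := by
      rw [map_zero]; exact hasStrictFDerivAt_exp_zero
    have := P.hasStrictFDerivAt.comp 0 (h1.comp 0 (adCLM (n := n) G).hasStrictFDerivAt)
    rw [show P.comp ((1 : (Model n →L[ℝ] Model n) →L[ℝ] (Model n →L[ℝ] Model n)).comp (adCLM G)) =
      ContinuousLinearMap.id ℝ (Model n) from hP] at this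
    exact this
  set u : Model n → Model n := fun X => P (NormedSpace.exp (adCLM G X))
  have huc : Continuous u :=
    let : NormedAlgebra ℚ (Model n →L[ℝ] Model n) := NormedAlgebra.restrictScalars ℚ ℝ _
    P.continuous.comp ((NormedSpace.exp_continuous (𝔸 := Model n →L[ℝ] Model n)).comp
      (adCLM (n := n) G).continuous)
  have hu0 : u 0 = e o := by
    rw [he]
    simp only [u, map_zero, NormedSpace.exp_zero]
    rw [chartAdjoint, oneChart_symm_self, adjointCLM_one]
    rfl
  have hρ : HasStrictFDerivAt (fun X => e.symm (u X)) (ContinuousLinearMap.id ℝ (Model n)) 0 := by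
    have h1 := hh.to_localInverse
    have h2 : HasStrictFDerivAt e.symm (ContinuousLinearMap.id ℝ (Model n)) (u 0) := by
      rw [hu0, he]; exact h1
    exact h2.comp 0 hu
  refine ⟨fun X => e.symm (u X), hρ, ?_⟩
  have hev : ∀ᶠ X in 𝓝 (0 : Model n), u X ∈ e.target ∧ e.symm (u X) ∈ (oneChart n G).target := by
    have h1 : ∀ᶠ v in 𝓝 (u 0), v ∈ e.target ∧ e.symm v ∈ (oneChart n G).target := by
      have ht : u 0 ∈ e.target := hu0 ▸ e.map_source heo
      refine Filter.Eventually.and (e.open_target.mem_nhds ht)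
        ((e.continuousAt_symm ht).eventually ?_)
      rw [hu0, e.left_inv heo]
      exact eventually_oneChart_target
    exact huc.continuousAt.eventually h1
  obtain ⟨δ, hδ, hball⟩ := Metric.eventually_nhds_iff_ball.1 hev
  filter_upwards [Metric.ball_mem_nhds (0 : Model n) hδ] with X hX
  have hcont : ∀ Y ∈ Metric.ball (0 : Model n) δ, ContinuousAt (fun X => e.symm (u X)) Y :=
    fun Y hY => (e.continuousAt_symm (hball Y hY).1).comp huc.continuousAt
  refine ⟨(hball X hX).2, hcont X hX, ?_⟩
  have hscale : ∀ t ∈ Icc (0 : ℝ) 1, t • X ∈ Metric.ball (0 : Model n) δ := by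
    intro t ht
    rw [mem_ball_zero_iff] at hX ⊢
    rw [norm_smul, Real.norm_eq_abs, abs_of_nonneg ht.1]
    exact (mul_le_of_le_one_left (norm_nonneg _) ht.2).trans_lt hX
  have hγ : ∀ t : ℝ, P (adjointCLM n (expM G (t • X))) = u (t • X) := by
    intro t
    simp only [u, adjointCLM_expM]
  set s : Set ℝ := {t | expM G (t • X) = (oneChart n G).symm (e.symm (u (t • X)))}
  -- Continuity method on [0, 1]: the set of good t is closed, contains 0, and is open to the right.
  have hsub : Icc (0 : ℝ) 1 ⊆ s := by
    refine IsClosed.Icc_subset_of_forall_mem_nhdsWithin ?_ ?_ ?_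
    · have hc : ContinuousOn (fun t : ℝ => (expM G (t • X),
          (oneChart n G).symm (e.symm (u (t • X))))) (Icc 0 1) := by
        refine (continuous_expM_smul (G := G) X).continuousOn.prodMk fun t ht => ?_
        refine ContinuousAt.continuousWithinAt ?_
        have h1 : ContinuousAt (fun t : ℝ => e.symm (u (t • X))) t :=
          ContinuousAt.comp (f := fun t : ℝ => t • X) (hcont _ (hscale t ht))
            (by fun_prop)
        exact ContinuousAt.comp (f := fun t : ℝ => e.symm (u (t • X)))
          (contMDiffAt_oneChart_symm (hball _ (hscale t ht)).2).continuousAt h1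
      have := hc.preimage_isClosed_of_isClosed isClosed_Icc (isClosed_diagonal (X := G))
      rw [inter_comm]
      exact this
    · change expM G ((0 : ℝ) • X) = _
      rw [zero_smul, expM_zero, hu0, e.left_inv heo]
      exact oneChart_symm_self.symm
    -- From a good t, exp(rX) stays for nearby r in the domain where P ∘ Ad is injective, and there
    -- its value u(rX) determines it.
    · rintro t ⟨hts, ht⟩
      have ht' : t ∈ Icc (0 : ℝ) 1 := ⟨ht.1, ht.2.le⟩
      have hts : expM G (t • X) = _ := hts
      have hb := hball _ (hscale t ht')
      have hsrc : expM G (t • X) ∈ (oneChart n G).source := by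
        rw [hts]; exact (oneChart n G).map_target hb.2
      have hval : oneChart n G (expM G (t • X)) = e.symm (u (t • X)) := by
        rw [hts]; exact (oneChart n G).right_inv hb.2
      have hc := (continuous_expM_smul (G := G) X).continuousAt (x := t)
      have ev1 : ∀ᶠ r in 𝓝 t, expM G (r • X) ∈ (oneChart n G).source :=
        hc.eventually ((isOpen_extChartAt_source (1 : G)).mem_nhds hsrc)
      have ev2 : ∀ᶠ r in 𝓝 t, oneChart n G (expM G (r • X)) ∈ e.source := by
        have h3 : ContinuousAt (fun r => oneChart n G (expM G (r • X))) t :=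
          ContinuousAt.comp (f := fun t : ℝ => expM G (t • X))
            (contMDiffAt_oneChart hsrc).continuousAt hc
        refine h3.eventually ?_
        beta_reduce
        rw [hval]
        exact e.open_source.mem_nhds (e.map_target hb.1)
      refine mem_nhdsWithin_of_mem_nhds ?_
      filter_upwards [ev1, ev2] with r h1 h2
      change expM G (r • X) = _
      rw [← hγ r]
      have h4 : P (adjointCLM n (expM G (r • X))) =
          e (oneChart n G (expM G (r • X))) := by
        rw [he, chartAdjoint, (oneChart n G).left_inv h1]
      rw [h4, e.left_inv h2, (oneChart n G).left_inv h1]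
  have := hsub (right_mem_Icc.2 zero_le_one)
  have h5 : expM G ((1 : ℝ) • X) = (oneChart n G).symm (e.symm (u ((1 : ℝ) • X))) := this
  simp only [one_smul] at h5
  exact h5

theorem hasStrictFDerivAt_expM (hinj : Function.Injective (adCLM (n := n) G)) :
    HasStrictFDerivAt (fun X : Model n => oneChart n G (expM G X))
      (ContinuousLinearMap.id ℝ (Model n)) 0 := by
  obtain ⟨ρ, h1, h2⟩ := eventually_expM_eq hinj
  refine h1.congr_of_eventuallyEq ?_
  filter_upwards [h2] with X hX
  rw [hX.2.2, (oneChart n G).right_inv hX.1]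

/-- Continuity near 0 spreads to everything through exp X = exp(X/k)^k with k large. -/
theorem continuous_expM (hinj : Function.Injective (adCLM (n := n) G)) :
    Continuous (fun X : Model n => expM G X) := by
  have hG := isTopologicalGroup_of_lieGroup n G
  obtain ⟨ρ, h1, h2⟩ := eventually_expM_eq hinj
  obtain ⟨δ, hδ, hball⟩ := Metric.eventually_nhds_iff_ball.1 (eventually_eventually_nhds.2 h2)
  refine continuous_iff_continuousAt.2 fun X => ?_
  obtain ⟨k, hk⟩ := exists_nat_gt (‖X‖ / δ)
  have hk0 : (0 : ℝ) < k := lt_of_le_of_lt (by positivity) hk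
  have hmem : (k : ℝ)⁻¹ • X ∈ Metric.ball (0 : Model n) δ := by
    rw [mem_ball_zero_iff, norm_smul, norm_inv, Real.norm_natCast, inv_mul_lt_iff₀ hk0]
    rwa [div_lt_iff₀ hδ] at hk
  have hc : ContinuousAt (fun X : Model n => expM G X) ((k : ℝ)⁻¹ • X) := by
    have h3 := hball _ hmem
    have h4 := h3.self_of_nhds
    refine ContinuousAt.congr ?_ (h3.mono fun Y hY => hY.2.2.symm)
    exact ContinuousAt.comp (f := ρ) (contMDiffAt_oneChart_symm h4.1).continuousAt h4.2.1
  have he : (fun X : Model n => expM G X) =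
      fun X : Model n => (expM G ((k : ℝ)⁻¹ • X)) ^ k := by
    funext Y
    rw [← expM_natCast_smul, smul_inv_smul₀ hk0.ne']
  rw [he]
  have hs : ContinuousAt (fun X : Model n => (k : ℝ)⁻¹ • X) X := by fun_prop
  exact (ContinuousAt.comp (f := fun X : Model n => (k : ℝ)⁻¹ • X) hc hs).pow k

end ExponentialChart

end HomogeneousLorentz

namespace HomogeneousLorentz

/-! ### Closed subgroups and their Lie algebras -/

section ClosedSubgroups

variable {n : ℕ} {G : Type*} [TopologicalSpace G] [ChartedSpace (EuclideanSpace ℝ (Fin n)) G]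
  [Group G] [LieGroup (𝓡 n) ∞ G]

variable (n) in
/-- The Lie algebra of a subgroup, as a subspace of the model space. -/
def lieM (H : Subgroup G) : Submodule ℝ (Model n) := lie (n := n) H

theorem mem_lieM_of_expM_mem {H : Subgroup G} {X : Model n} (h : ∀ t : ℝ, expM G (t • X) ∈ H) :
    X ∈ lieM n H := by
  have e : oneParam (n := n) (G := G) X = fun t : ℝ => expM G (t • X) :=
    funext fun t => (expM_smul_eq t X).symm
  refine ⟨oneParam (n := n) (G := G) X, oneParam_zero _, fun t => ?_, oneParam_velocity _⟩
  rw [e]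
  exact h t

theorem eventually_expM_source (hinj : Function.Injective (adCLM (n := n) G)) :
    ∀ᶠ X in 𝓝 (0 : Model n), expM G X ∈ (oneChart n G).source :=
  (continuous_expM hinj).continuousAt.eventually (by
    beta_reduce
    rw [expM_zero]
    exact (isOpen_extChartAt_source (1 : G)).mem_nhds (mem_extChartAt_source (1 : G)))

/-- Curves through the identity lift through the exponential map. -/
theorem exists_log_curve (hinj : Function.Injective (adCLM (n := n) G)) {γ : ℝ → G} {X : Model n}
    (h0 : γ 0 = 1) (hc : ContinuousAt γ 0) (h : HasDerivAt (fun t => oneChart n G (γ t)) X 0) :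
    ∃ Y : ℝ → Model n, Y 0 = 0 ∧ HasDerivAt Y X 0 ∧ ∀ᶠ t in 𝓝 0, expM G (Y t) = γ t := by
  have hE : HasStrictFDerivAt (fun X : Model n => oneChart n G (expM G X))
      ((ContinuousLinearEquiv.refl ℝ (Model n) : Model n ≃L[ℝ] Model n) : Model n →L[ℝ] Model n)
      0 := hasStrictFDerivAt_expM hinj
  set ℓ := hE.localInverse with hℓ
  have e0 : oneChart n G (expM G (0 : Model n)) = oneChart n G (γ 0) := by rw [expM_zero, h0]
  have hℓ0 : ℓ (oneChart n G (γ 0)) = 0 := by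
    rw [← e0]; exact hE.localInverse_apply_image
  have hd : HasDerivAt (fun t => ℓ (oneChart n G (γ t))) X 0 := by
    have h1 : HasStrictFDerivAt ℓ (ContinuousLinearMap.id ℝ (Model n)) (oneChart n G (γ 0)) := by
      rw [← e0]; exact hE.to_localInverse
    exact h1.hasFDerivAt.comp_hasDerivAt (0 : ℝ) h
  refine ⟨fun t => ℓ (oneChart n G (γ t)), hℓ0, hd, ?_⟩
  have ev1 : ∀ᶠ x in 𝓝 (oneChart n G (γ 0)), oneChart n G (expM G (ℓ x)) = x := by
    rw [← e0]; exact hE.eventually_right_inverse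
  have ev2 := h.continuousAt.eventually ev1
  have ev3 : ∀ᶠ t in 𝓝 (0 : ℝ), expM G (ℓ (oneChart n G (γ t))) ∈ (oneChart n G).source :=
    hd.continuousAt.eventually
      (p := fun Z => expM G Z ∈ (oneChart n G).source)
      (by beta_reduce; rw [hℓ0]; exact eventually_expM_source hinj)
  have ev4 : ∀ᶠ t in 𝓝 (0 : ℝ), γ t ∈ (oneChart n G).source :=
    hc.eventually (by
      rw [h0]; exact (isOpen_extChartAt_source (1 : G)).mem_nhds (mem_extChartAt_source (1 : G)))
  filter_upwards [ev2, ev3, ev4] with t h2 h3 h4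
  exact (oneChart n G).injOn h3 h4 h2

/-- For a curve γ in H with velocity X, the powers γ(1/(k+1))^(k+1) lie in H and tend to exp X,
since the logarithm of γ(t) is tX up to o(t). -/
theorem expM_mem_of_mem_lieM (hinj : Function.Injective (adCLM (n := n) G)) {H : Subgroup G}
    (hH : IsClosed (H : Set G)) {X : Model n} (hX : X ∈ lieM n H) : expM G X ∈ H := by
  obtain ⟨γ, h0, hL, hd, hv⟩ := hX
  obtain ⟨Y, hY0, hY, hev⟩ := exists_log_curve hinj h0 hd.continuousAt
    (hasDerivAt_oneChart_comp h0 hd hv)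
  have hlim : Tendsto (fun k : ℕ => ((k : ℝ) + 1) • Y (1 / ((k : ℝ) + 1))) atTop (𝓝 X) := by
    have h1 := hY.tendsto_slope_zero
    have h2 : Tendsto (fun k : ℕ => 1 / ((k : ℝ) + 1)) atTop (𝓝[≠] 0) :=
      tendsto_nhdsWithin_iff.2 ⟨tendsto_one_div_add_atTop_nhds_zero_nat,
        Eventually.of_forall fun k => (by positivity : (1 / ((k : ℝ) + 1)) ≠ 0)⟩
    refine (h1.comp h2).congr fun k => ?_
    simp [hY0]
  have hE := ((continuous_expM hinj).tendsto X).comp hlim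
  have hmem : ∀ᶠ k : ℕ in atTop, expM G (((k : ℝ) + 1) • Y (1 / ((k : ℝ) + 1))) ∈ (H : Set G) := by
    filter_upwards [(tendsto_one_div_add_atTop_nhds_zero_nat (𝕜 := ℝ)).eventually hev] with k hk
    have := expM_natCast_smul (G := G) (k + 1) (Y (1 / ((k : ℝ) + 1)))
    rw [Nat.cast_succ] at this
    rw [this, hk]
    exact H.pow_mem (hL _) _
  exact hH.mem_of_tendsto hE hmem

theorem mem_lieM_iff (hinj : Function.Injective (adCLM (n := n) G)) {H : Subgroup G}
    (hH : IsClosed (H : Set G)) {X : Model n} :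
    X ∈ lieM n H ↔ ∀ t : ℝ, expM G (t • X) ∈ H :=
  ⟨fun h t => expM_mem_of_mem_lieM hinj hH ((lieM n H).smul_mem t h), mem_lieM_of_expM_mem⟩

/-- Otherwise there are nonzero Y_k → 0 in W with exp Y_k in H. A limit U of their directions lies
in W, and integer multiples of Y_k approximate tU, so closedness puts exp(tU) in H. Thus U is a unit
vector in both W and Lie(H), which is impossible. -/
theorem exists_pos_eq_zero_of_expM_mem (hinj : Function.Injective (adCLM (n := n) G))
    {H : Subgroup G} (hH : IsClosed (H : Set G)) {W : Submodule ℝ (Model n)}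
    (hW : Disjoint (lieM n H) W) :
    ∃ ε > 0, ∀ Y ∈ W, ‖Y‖ < ε → expM G Y ∈ H → Y = 0 := by
  by_contra! hcon
  choose Y hYW hYn hYH hY0 using fun k : ℕ => hcon (1 / ((k : ℝ) + 1)) (by positivity)
  have hYlim : Tendsto (fun k => ‖Y k‖) atTop (𝓝 0) :=
    squeeze_zero (fun k => norm_nonneg _) (fun k => (hYn k).le)
      tendsto_one_div_add_atTop_nhds_zero_nat
  have hU : ∀ k, ‖Y k‖⁻¹ • Y k ∈ Metric.sphere (0 : Model n) 1 := fun k => by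
    rw [mem_sphere_zero_iff_norm, norm_smul, norm_inv, norm_norm,
      inv_mul_cancel₀ (norm_ne_zero_iff.2 (hY0 k))]
  obtain ⟨U, hU1, φ, hφ, hUlim⟩ := (isCompact_sphere (0 : Model n) 1).tendsto_subseq hU
  have hUW : U ∈ W := W.closed_of_finiteDimensional.mem_of_tendsto hUlim
    (Eventually.of_forall fun k => W.smul_mem _ (hYW _))
  have hpos : ∀ t : ℝ, 0 ≤ t → expM G (t • U) ∈ H := by
    intro t ht
    -- The integer ⌊t/‖Y_k‖⌋ is chosen so that this multiple of Y_k has length tending to t.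
    have h1 : Tendsto (fun k => (⌊t / ‖Y (φ k)‖⌋₊ : ℝ) * ‖Y (φ k)‖) atTop (𝓝 t) := by
      have h2 := hYlim.comp hφ.tendsto_atTop
      have h3 : Tendsto (fun k => t - ‖Y (φ k)‖) atTop (𝓝 t) := by
        simpa using tendsto_const_nhds.sub h2
      refine tendsto_of_tendsto_of_tendsto_of_le_of_le h3 tendsto_const_nhds (fun k => ?_)
        (fun k => ?_)
      · have hp : 0 < ‖Y (φ k)‖ := norm_pos_iff.2 (hY0 _)
        have := (Nat.lt_floor_add_one (t / ‖Y (φ k)‖))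
        rw [div_lt_iff₀ hp] at this
        change t - ‖Y (φ k)‖ ≤ _
        nlinarith
      · have hp : 0 < ‖Y (φ k)‖ := norm_pos_iff.2 (hY0 _)
        have := Nat.floor_le (a := t / ‖Y (φ k)‖) (by positivity)
        rwa [le_div_iff₀ hp] at this
    have h4 : Tendsto (fun k => expM G ((⌊t / ‖Y (φ k)‖⌋₊ : ℝ) • Y (φ k))) atTop
        (𝓝 (expM G (t • U))) := by
      refine ((continuous_expM hinj).tendsto _).comp ?_
      refine (h1.smul hUlim).congr fun k => ?_
      rw [Function.comp_apply, smul_smul, mul_assoc,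
        mul_inv_cancel₀ (norm_ne_zero_iff.2 (hY0 _)), mul_one]
    refine hH.mem_of_tendsto h4 (Eventually.of_forall fun k => ?_)
    rw [expM_natCast_smul]
    exact H.pow_mem (hYH _) _
  have hUH : U ∈ lieM n H := by
    refine mem_lieM_of_expM_mem fun t => ?_
    rcases le_total 0 t with ht | ht
    · exact hpos t ht
    · have := H.inv_mem (hpos (-t) (neg_nonneg.2 ht))
      rwa [← expM_neg, neg_smul, neg_neg] at this
  have hU0 : U = 0 := Submodule.disjoint_def.1 hW U hUH hUW
  rw [mem_sphere_zero_iff_norm, hU0, norm_zero] at hU1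
  exact zero_ne_one hU1

theorem fderiv_chartMul_one (v w : Model n) :
    fderiv ℝ (chartMul n G) (oneChart n G 1, oneChart n G 1) (v, w) = v + w := by
  have h1 := congrArg (fun T => T v) (chartMulFst_one (n := n) (G := G))
  have h2 := congrArg (fun T => T w) (chartMulSnd_one (n := n) (G := G))
  simp only [chartMulFst, chartMulSnd, ContinuousLinearMap.comp_apply,
    ContinuousLinearMap.inl_apply, ContinuousLinearMap.inr_apply,
    ContinuousLinearMap.id_apply] at h1 h2
  have h3 : ((v, w) : Model n × Model n) = (v, 0) + (0, w) := by simp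
  rw [h3, map_add, h1, h2]

/-- The product has derivative p + q = id at 0, so the inverse function theorem applies. -/
theorem map_nhds_expM_mul_expM (hinj : Function.Injective (adCLM (n := n) G))
    (p q : Model n →L[ℝ] Model n) (hpq : ∀ X, p X + q X = X) :
    map (fun X => expM G (p X) * expM G (q X)) (𝓝 0) = 𝓝 1 := by
  have hG := isTopologicalGroup_of_lieGroup n G
  have hE := continuous_expM hinj
  refine map_nhds_zero_of_hasStrictFDerivAt (by simp [expM_zero])
    (((hE.comp p.continuous).mul (hE.comp q.continuous)).continuousAt) ?_
  have hp : HasStrictFDerivAt (fun X => oneChart n G (expM G (p X))) p 0 := by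
    have h1 : HasStrictFDerivAt (fun X : Model n => oneChart n G (expM G X))
      (ContinuousLinearMap.id ℝ (Model n)) (p 0) := by
      rw [map_zero]; exact hasStrictFDerivAt_expM hinj
    exact h1.comp 0 p.hasStrictFDerivAt
  have hq : HasStrictFDerivAt (fun X => oneChart n G (expM G (q X))) q 0 := by
    have h1 : HasStrictFDerivAt (fun X : Model n => oneChart n G (expM G X))
      (ContinuousLinearMap.id ℝ (Model n)) (q 0) := by
      rw [map_zero]; exact hasStrictFDerivAt_expM hinj
    exact h1.comp 0 q.hasStrictFDerivAt
  have hm : HasStrictFDerivAt (chartMul n G)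
      (fderiv ℝ (chartMul n G) (oneChart n G 1, oneChart n G 1))
      (oneChart n G (expM G (p 0)), oneChart n G (expM G (q 0))) := by
    rw [map_zero, map_zero, expM_zero]
    exact contDiffAt_chartMul.hasStrictFDerivAt (by simp)
  have hc := hm.comp 0 (hp.prodMk hq)
  have e : (fderiv ℝ (chartMul n G) (oneChart n G 1, oneChart n G 1)).comp (p.prod q) =
      ContinuousLinearMap.id ℝ (Model n) := by
    ext1 X
    change fderiv ℝ (chartMul n G) (oneChart n G 1, oneChart n G 1) (p X, q X) = X
    rw [fderiv_chartMul_one, hpq]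
  rw [e] at hc
  refine hc.congr_of_eventuallyEq ?_
  have evp : ∀ᶠ X in 𝓝 (0 : Model n), expM G (p X) ∈ (oneChart n G).source :=
    p.continuous.continuousAt.eventually (by rw [map_zero]; exact eventually_expM_source hinj)
  have evq : ∀ᶠ X in 𝓝 (0 : Model n), expM G (q X) ∈ (oneChart n G).source :=
    q.continuous.continuousAt.eventually (by rw [map_zero]; exact eventually_expM_source hinj)
  filter_upwards [evp, evq] with X h1 h2
  simp only [chartMul, (oneChart n G).left_inv h1, (oneChart n G).left_inv h2]

/-- Near the identity, a closed subgroup is the exponential image of its Lie algebra. -/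
theorem eventually_mem_expM_lieM (hinj : Function.Injective (adCLM (n := n) G))
    {H : Subgroup G} (hH : IsClosed (H : Set G)) :
    ∀ᶠ a in 𝓝 (1 : G), a ∈ H → ∃ X ∈ lieM n H, expM G X = a := by
  obtain ⟨W, hW⟩ := Submodule.exists_isCompl (lieM n H)
  set p : Model n →L[ℝ] Model n := LinearMap.toContinuousLinearMap
    ((lieM n H).projection W hW)
  set q : Model n →L[ℝ] Model n := LinearMap.toContinuousLinearMap
    (W.projection (lieM n H) hW.symm)
  have hpq : ∀ X, p X + q X = X := fun X =>
    Submodule.projection_add_projection_eq_self hW X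
  have hp : ∀ X, p X ∈ lieM n H := fun X => Submodule.projection_apply_mem _ X
  have hq : ∀ X, q X ∈ W := fun X => Submodule.projection_apply_mem _ X
  obtain ⟨ε, hε, hεW⟩ := exists_pos_eq_zero_of_expM_mem hinj hH hW.disjoint
  rw [← map_nhds_expM_mul_expM hinj p q hpq, eventually_map]
  have hev : ∀ᶠ X in 𝓝 (0 : Model n), ‖q X‖ < ε := by
    have : Tendsto (fun X => ‖q X‖) (𝓝 0) (𝓝 0) := by
      have := (q.continuous.norm).tendsto 0
      simpa using this
    exact this.eventually (gt_mem_nhds hε)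
  filter_upwards [hev] with X hX hmem
  -- Write the element as exp(pX) exp(qX). The first factor is in H, hence so is the second, and
  -- being a small element of the complement it must be trivial.
  have h1 : expM G (p X) ∈ H := expM_mem_of_mem_lieM hinj hH (hp X)
  have h2 : expM G (q X) ∈ H := (H.mul_mem_cancel_left h1).1 hmem
  have h3 := hεW _ (hq X) hX h2
  exact ⟨p X, hp X, by rw [h3, expM_zero, mul_one]⟩

/-- The exponentials of Lie(H) fill a neighbourhood of 1 in H, so K ∩ H is open in H; an open
subgroup of a connected group is everything. -/
theorem le_of_expM_lieM_mem (hinj : Function.Injective (adCLM (n := n) G))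
    {H K : Subgroup G} (hH : IsClosed (H : Set G)) (hH' : IsConnected (H : Set G))
    (hK : ∀ X ∈ lieM n H, expM G X ∈ K) : H ≤ K := by
  have hG := isTopologicalGroup_of_lieGroup n G
  have hev : ∀ᶠ a in 𝓝 (1 : H), a ∈ K.subgroupOf H := by
    have h1 : ContinuousAt (Subtype.val : H → G) 1 := continuous_subtype_val.continuousAt
    have h2 := h1.eventually (eventually_mem_expM_lieM hinj hH)
    filter_upwards [h2] with a ha
    obtain ⟨X, hX, hXa⟩ := ha a.2
    rw [Subgroup.mem_subgroupOf, ← hXa]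
    exact hK X hX
  have hopen : IsOpen (K.subgroupOf H : Set H) := Subgroup.isOpen_of_mem_nhds _ hev
  have hclopen : IsClopen (K.subgroupOf H : Set H) :=
    ⟨Subgroup.isClosed_of_isOpen _ hopen, hopen⟩
  have hconn : ConnectedSpace H := isConnected_iff_connectedSpace.1 hH'
  have huniv := hclopen.eq_univ ⟨1, (K.subgroupOf H).one_mem⟩
  intro a ha
  have : (⟨a, ha⟩ : H) ∈ (K.subgroupOf H : Set H) := by rw [huniv]; trivial
  exact this

theorem discreteTopology_of_lieM_eq_bot (hinj : Function.Injective (adCLM (n := n) G))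
    {H : Subgroup G} (hH : IsClosed (H : Set G)) (h : lieM n H = ⊥) : DiscreteTopology H := by
  have hG := isTopologicalGroup_of_lieGroup n G
  have hev : ∀ᶠ a in 𝓝 (1 : H), a ∈ (⊥ : Subgroup H) := by
    have h1 : ContinuousAt (Subtype.val : H → G) 1 := continuous_subtype_val.continuousAt
    filter_upwards [h1.eventually (eventually_mem_expM_lieM hinj hH)] with a ha
    obtain ⟨X, hX, hXa⟩ := ha a.2
    rw [h, Submodule.mem_bot] at hX
    rw [hX, expM_zero] at hXa
    exact Subgroup.mem_bot.2 (Subtype.ext hXa.symm)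
  have hopen : IsOpen ((⊥ : Subgroup H) : Set H) := Subgroup.isOpen_of_mem_nhds _ hev
  exact discreteTopology_of_isOpen_singleton_one hopen

end ClosedSubgroups

end HomogeneousLorentz

namespace HomogeneousLorentz

/-! ### Invariant inner products by averaging -/

section InvariantForms

variable {n : ℕ}

theorem exp_apply_eq_self {V : Type*} [NormedAddCommGroup V] [NormedSpace ℝ V] [CompleteSpace V]
    {A : V →L[ℝ] V} {Z : V} (h : A Z = 0) :
    NormedSpace.exp A Z = Z := by
  have hd : ∀ t : ℝ, HasDerivAt (fun t : ℝ => NormedSpace.exp (t • A) Z) 0 t := by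
    intro t
    have h1 := (hasDerivAt_exp_smul_const (𝕂 := ℝ) A t).clm_apply (hasDerivAt_const t Z)
    simpa [h] using h1
  have := is_const_of_deriv_eq_zero (fun s => (hd s).differentiableAt) (fun s => (hd s).deriv) 1 0
  simpa [NormedSpace.exp_zero] using this

/-- Skewness of A says precisely that B has zero derivative along the flow exp(tA). -/
theorem bilin_exp_apply {V : Type*} [NormedAddCommGroup V] [NormedSpace ℝ V]
    [FiniteDimensional ℝ V] [CompleteSpace V] {A : V →L[ℝ] V} (B : LinearMap.BilinForm ℝ V)
    (h : ∀ X Y, B (A X) Y + B X (A Y) = 0) (X Y : V) :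
    B (NormedSpace.exp A X) (NormedSpace.exp A Y) = B X Y := by
  set C : V →L[ℝ] V →L[ℝ] ℝ := LinearMap.toContinuousBilinearMap B
  have hC : ∀ X Y, C X Y = B X Y := fun _ _ => rfl
  have hd : ∀ t : ℝ, HasDerivAt
      (fun t : ℝ => C (NormedSpace.exp (t • A) X) (NormedSpace.exp (t • A) Y)) 0 t := by
    intro t
    have hX := (hasDerivAt_exp_smul_const' (𝕂 := ℝ) A t).clm_apply (hasDerivAt_const t X)
    have hY := (hasDerivAt_exp_smul_const' (𝕂 := ℝ) A t).clm_apply (hasDerivAt_const t Y)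
    have h1 := (C.hasFDerivAt.comp_hasDerivAt t hX).clm_apply hY
    refine h1.congr_deriv ?_
    simpa [hC] using h (NormedSpace.exp (t • A) X) (NormedSpace.exp (t • A) Y)
  have := is_const_of_deriv_eq_zero (fun s => (hd s).differentiableAt) (fun s => (hd s).deriv) 1 0
  simpa [NormedSpace.exp_zero, hC] using this

/-- The inner product space structure given by a positive definite symmetric bilinear form. -/
abbrev innerCore {V : Type*} [AddCommGroup V] [Module ℝ V]
    (B : LinearMap.BilinForm ℝ V) (hs : ∀ x y, B x y = B y x) (hp : ∀ x, x ≠ 0 → 0 < B x x) :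
    InnerProductSpace.Core ℝ V where
  inner x y := B x y
  conj_inner_symm x y := by simp [hs x y]
  re_inner_nonneg x := by
    by_cases hx : x = 0
    · simp [hx]
    · exact (hp x hx).le
  add_left x y z := by simp
  smul_left x y r := by simp
  definite x hx := by
    by_contra hne
    exact (hp x hne).ne' hx

/-- In an orthonormal basis, tr(A²) = -∑ |A e_i|². -/
theorem trace_sq_of_skew {V : Type*} [AddCommGroup V] [Module ℝ V] [FiniteDimensional ℝ V]
    (B : LinearMap.BilinForm ℝ V) (hs : ∀ x y, B x y = B y x) (hp : ∀ x, x ≠ 0 → 0 < B x x)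
    (A : V →ₗ[ℝ] V) (hA : ∀ x y, B (A x) y + B x (A y) = 0) :
    LinearMap.trace ℝ V (A ∘ₗ A) ≤ 0 ∧ (LinearMap.trace ℝ V (A ∘ₗ A) = 0 → A = 0) := by
  have hp0 : ∀ x, 0 ≤ B x x := (innerCore B hs hp).re_inner_nonneg
  let _ : NormedAddCommGroup V := (innerCore B hs hp).toNormedAddCommGroup
  let _ : InnerProductSpace ℝ V := InnerProductSpace.ofCore (innerCore B hs hp).toCore
  have hin : ∀ x y : V, inner ℝ x y = B x y := fun _ _ => rfl
  have htr : LinearMap.trace ℝ V (A ∘ₗ A) =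
      - ∑ i, B (A (stdOrthonormalBasis ℝ V i)) (A (stdOrthonormalBasis ℝ V i)) := by
    rw [LinearMap.trace_eq_sum_inner _ (stdOrthonormalBasis ℝ V), ← Finset.sum_neg_distrib]
    refine Finset.sum_congr rfl fun i _ => ?_
    rw [hin, LinearMap.comp_apply]
    linarith [hA (stdOrthonormalBasis ℝ V i) (A (stdOrthonormalBasis ℝ V i))]
  refine ⟨?_, fun h0 => ?_⟩
  · rw [htr, neg_nonpos]
    exact Finset.sum_nonneg fun i _ => hp0 _
  · rw [htr, neg_eq_zero, Finset.sum_eq_zero_iff_of_nonneg fun i _ => hp0 _] at h0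
    refine (stdOrthonormalBasis ℝ V).toBasis.ext fun i => ?_
    rw [OrthonormalBasis.coe_toBasis, LinearMap.zero_apply]
    by_contra hne
    exact (hp _ hne).ne' (h0 i (Finset.mem_univ i))

variable {G : Type*} [TopologicalSpace G] [ChartedSpace (EuclideanSpace ℝ (Fin n)) G]
  [Group G] [LieGroup (𝓡 n) ∞ G]

theorem hasDerivAt_adjointCLM_expM (X Y : Model n) :
    HasDerivAt (fun t : ℝ => adjointCLM n (expM G (t • X)) Y) (modelBracket G X Y) 0 := by
  have h0 : (fun t : ℝ => expM G (t • X)) 0 = 1 := by simp [expM_zero]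
  have e : (fun t : ℝ => oneChart n G (expM G (t • X))) =
      fun t => oneChart n G (oneParam (n := n) (G := G) X t) :=
    funext fun t => congrArg _ (expM_smul_eq t X)
  have h1 := hasDerivAt_adjointCLM (n := n) (X := X) h0 (continuous_expM_smul X).continuousAt
    (by rw [e]; exact hasDerivAt_oneChart_oneParam (n := n) (G := G) X)
  have h2 := h1.clm_apply (hasDerivAt_const 0 Y)
  simpa [adCLM_apply] using h2

variable (n G) in
theorem continuous_adjointCLM : Continuous fun a : G => adjointCLM n a :=
  contMDiff_adjointCLM.continuous

/-- Averaging over a compact group gives an `Ad`-invariant inner product. -/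
theorem exists_invariant_inner [CompactSpace G] :
    ∃ B : LinearMap.BilinForm ℝ (Model n), (∀ X Y, B X Y = B Y X) ∧ (∀ X, X ≠ 0 → 0 < B X X) ∧
      ∀ (a : G) (X Y : Model n), B (adjointCLM n a X) (adjointCLM n a Y) = B X Y := by
  have hG := isTopologicalGroup_of_lieGroup n G
  let _ : MeasurableSpace G := borel G
  have _ : BorelSpace G := ⟨rfl⟩
  set μ : MeasureTheory.Measure G := MeasureTheory.Measure.haar
  set f : Model n → Model n → G → ℝ :=
    fun X Y a => inner ℝ (adjointCLM n a⁻¹ X) (adjointCLM n a⁻¹ Y) with hf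
  have hcA : ∀ X : Model n, Continuous fun a : G => adjointCLM n a⁻¹ X := fun X =>
    ((continuous_adjointCLM n G).comp continuous_inv).clm_apply continuous_const
  have hcont : ∀ X Y, Continuous (f X Y) := fun X Y => (hcA X).inner (hcA Y)
  have hint : ∀ X Y, MeasureTheory.Integrable (f X Y) μ := fun X Y =>
    (hcont X Y).integrable_of_hasCompactSupport (HasCompactSupport.of_compactSpace _)
  refine ⟨LinearMap.mk₂ ℝ (fun X Y => ∫ a, f X Y a ∂μ) ?_ ?_ ?_ ?_, ?_, ?_, ?_⟩
  · intro X X' Y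
    rw [← MeasureTheory.integral_add (hint _ _) (hint _ _)]
    exact congrArg _ (funext fun a => by simp [hf, inner_add_left])
  · intro c X Y
    rw [smul_eq_mul, ← MeasureTheory.integral_const_mul]
    exact congrArg _ (funext fun a => by simp [hf, inner_smul_left])
  · intro X Y Y'
    rw [← MeasureTheory.integral_add (hint _ _) (hint _ _)]
    exact congrArg _ (funext fun a => by simp [hf, inner_add_right])
  · intro c X Y
    rw [smul_eq_mul, ← MeasureTheory.integral_const_mul]
    exact congrArg _ (funext fun a => by simp [hf, inner_smul_right])
  · intro X Y
    simp only [LinearMap.mk₂_apply]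
    exact congrArg _ (funext fun a => real_inner_comm _ _)
  · intro X hX
    simp only [LinearMap.mk₂_apply]
    refine (hcont X X).integral_pos_of_hasCompactSupport_nonneg_nonzero
      (HasCompactSupport.of_compactSpace _) (fun a => real_inner_self_nonneg) (x := 1) ?_
    simp [hf, adjointCLM_one, hX]
  · intro b X Y
    simp only [LinearMap.mk₂_apply]
    -- Substituting b⁻¹a for a, allowed by left invariance of Haar measure, transfers Ad b to the
    -- variable of integration.
    rw [← MeasureTheory.integral_mul_left_eq_self (f X Y) b⁻¹]
    refine congrArg _ (funext fun a => ?_)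
    simp only [hf, mul_inv_rev, inv_inv, adjointCLM_mul, ContinuousLinearMap.comp_apply]

end InvariantForms

/-! ### Negativity of the Killing form -/

section CompactSimple

variable {n : ℕ} {G : Type*} [TopologicalSpace G] [ChartedSpace (EuclideanSpace ℝ (Fin n)) G]
  [Group G] [LieGroup (𝓡 n) ∞ G]

theorem eq_zero_of_forall_lie_eq_zero {𝔤 : Type*} [LieRing 𝔤] [LieAlgebra ℝ 𝔤]
    (h𝔤 : LieAlgebra.IsSimple ℝ 𝔤) {X : 𝔤} (h : ∀ Y : 𝔤, ⁅X, Y⁆ = 0) : X = 0 := by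
  have hmem : X ∈ LieAlgebra.center ℝ 𝔤 := by
    rw [LieModule.mem_maxTrivSubmodule]
    intro Y
    rw [← lie_skew, h, neg_zero]
  rw [LieAlgebra.center_eq_bot ℝ 𝔤] at hmem
  exact (LieSubmodule.mem_bot _).1 hmem

/-- The kernel of ad is the center, which vanishes for a simple algebra. -/
theorem injective_adCLM (hG : LieAlgebra.IsSimple ℝ (LieAlg n G)) :
    Function.Injective (adCLM (n := n) G) := by
  refine (injective_iff_map_eq_zero _).2 fun X hX => ?_
  refine eq_zero_of_forall_lie_eq_zero (𝔤 := LieAlg n G) hG (X := X) fun Y => ?_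
  have := congrArg (fun T : Model n →L[ℝ] Model n => T Y) hX
  exact (adCLM_apply (G := G) X Y).symm.trans this

/-- The Lie algebra is finite dimensional; stated for the module structure underlying the
Lie algebra structure. -/
instance instModuleFiniteLieAlg :
    @Module.Finite ℝ (LieAlg n G) _ LieRing.toAddCommGroup.toAddCommMonoid LieAlgebra.toModule :=
  inferInstanceAs (Module.Finite ℝ (Model n))

/-- Each ad X is skew for the averaged inner product, so tr((ad X)²) ≤ 0 with equality only if ad X
= 0, that is X = 0. -/
theorem killingForm_neg [CompactSpace G] (hG : LieAlgebra.IsSimple ℝ (LieAlg n G))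
    {X : LieAlg n G} (hX : X ≠ 0) : killingForm ℝ (LieAlg n G) X X < 0 := by
  obtain ⟨B, hs, hp, hinv⟩ := exists_invariant_inner (n := n) (G := G)
  -- Differentiate the invariance of B along exp(tX) at t = 0.
  have hskew : ∀ X Y Z : Model n, B (modelBracket G X Y) Z + B Y (modelBracket G X Z) = 0 := by
    intro X Y Z
    have hY := hasDerivAt_adjointCLM_expM (G := G) X Y
    have hZ := hasDerivAt_adjointCLM_expM (G := G) X Z
    set C : Model n →L[ℝ] Model n →L[ℝ] ℝ := LinearMap.toContinuousBilinearMap B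
    have h1 := (C.hasFDerivAt.comp_hasDerivAt 0 hY).clm_apply hZ
    have h2 : (fun t : ℝ => ((C ∘ fun t : ℝ => adjointCLM n (expM G (t • X)) Y) t)
        (adjointCLM n (expM G (t • X)) Z)) = fun _ => B Y Z := funext fun t => hinv _ _ _
    rw [h2] at h1
    have h3 := h1.unique (hasDerivAt_const (0 : ℝ) (B Y Z))
    simpa [C, expM_zero, adjointCLM_one] using h3
  let B' : LinearMap.BilinForm ℝ (LieAlg n G) := B
  have h := trace_sq_of_skew B' hs hp (LieAlgebra.ad ℝ (LieAlg n G) X)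
    (fun Y Z => hskew X Y Z)
  rw [killingForm_apply_apply]
  refine lt_of_le_of_ne h.1 fun h0 => hX ?_
  have h4 := h.2 h0
  refine injective_adCLM hG (a₁ := X) (a₂ := 0) ?_
  refine ContinuousLinearMap.ext fun Y => ?_
  rw [map_zero]
  exact (adCLM_apply (G := G) X Y).trans (congrArg (fun T : LieAlg n G →ₗ[ℝ] LieAlg n G => T Y) h4)

end CompactSimple

end HomogeneousLorentz

namespace HomogeneousLorentz

/-! ### Ad as a group of Lie algebra automorphisms -/

section AdjointAction

variable {n : ℕ} {G : Type*} [TopologicalSpace G] [ChartedSpace (EuclideanSpace ℝ (Fin n)) G]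
  [Group G] [LieGroup (𝓡 n) ∞ G]

variable (n) in
/-- `Ad a` as a linear map. -/
def AdLin (a : G) : LieAlg n G →ₗ[ℝ] LieAlg n G := (adjointCLM n a : Model n →ₗ[ℝ] Model n)

theorem AdLin_apply (a : G) (X : LieAlg n G) : AdLin n a X = Ad a X := rfl

theorem Ad_smul (a : G) (c : ℝ) (X : LieAlg n G) : Ad a (c • X) = c • Ad a X :=
  map_smul (AdLin n a) c X

theorem Ad_one (X : LieAlg n G) : Ad (1 : G) X = X :=
  congrArg (fun T : Model n →L[ℝ] Model n => T X) (adjointCLM_one (n := n) (G := G))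

theorem Ad_mul (a b : G) (X : LieAlg n G) : Ad (a * b) X = Ad a (Ad b X) :=
  congrArg (fun T : Model n →L[ℝ] Model n => T X) (adjointCLM_mul (n := n) a b)

theorem Ad_inv_Ad (a : G) (X : LieAlg n G) : Ad a⁻¹ (Ad a X) = X := by
  rw [← Ad_mul, inv_mul_cancel, Ad_one]

theorem Ad_Ad_inv (a : G) (X : LieAlg n G) : Ad a (Ad a⁻¹ X) = X := by
  rw [← Ad_mul, mul_inv_cancel, Ad_one]

theorem Ad_expG_eq_self {X Z : LieAlg n G} (h : ⁅X, Z⁆ = 0) : Ad (expG X) Z = Z := by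
  have h1 : adCLM G (X : Model n) (Z : Model n) = 0 := (adCLM_apply _ _).trans h
  exact (congrArg (fun T : Model n →L[ℝ] Model n => T Z) (adjointCLM_expM (G := G) X)).trans
    (exp_apply_eq_self h1)

/-- The bracket is a limit of difference quotients lying in V, and V is closed, being finite
dimensional. -/
theorem Ad_conj_mem {V : Submodule ℝ (LieAlg n G)} {X Y : LieAlg n G}
    (h : ∀ t : ℝ, Ad (expG (t • X)) Y ∈ V) : ⁅X, Y⁆ ∈ V := by
  let W : Submodule ℝ (Model n) := V
  have hd := (hasDerivAt_adjointCLM_expM (G := G) X Y).tendsto_slope_zero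
  have hY : (Y : Model n) ∈ W := by
    have := h 0
    have e : expG ((0 : ℝ) • X) = (1 : G) := by rw [zero_smul, expG_zero]
    rw [e, Ad_one] at this
    exact this
  refine (Submodule.closed_of_finiteDimensional W).mem_of_tendsto hd ?_
  refine Eventually.of_forall fun t => W.smul_mem _ (W.sub_mem ?_ ?_)
  · rw [zero_add]; exact h t
  · exact h 0

theorem modelBracket_eq_zero_of_adjointCLM {X Y : Model n}
    (h : ∀ t : ℝ, adjointCLM n (expM G (t • X)) Y = Y) : modelBracket G X Y = 0 := by
  have hd := hasDerivAt_adjointCLM_expM (G := G) X Y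
  have e : (fun t : ℝ => adjointCLM n (expM G (t • X)) Y) = fun _ => Y := funext h
  rw [e] at hd
  exact hd.unique (hasDerivAt_const (0 : ℝ) Y)

theorem lie_eq_zero_of_Ad {X Y : LieAlg n G} (h : ∀ t : ℝ, Ad (expG (t • X)) Y = Y) :
    ⁅X, Y⁆ = 0 :=
  modelBracket_eq_zero_of_adjointCLM (G := G) (X := X) (Y := Y) h

/-- Conjugating a velocity vector. -/
theorem velocity_conj {γ : ℝ → G} {X : LieAlg n G} (a : G) (h0 : γ 0 = 1)
    (hd : MDifferentiableAt 𝓘(ℝ, ℝ) (𝓡 n) γ 0)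
    (hX : (mfderiv 𝓘(ℝ, ℝ) (𝓡 n) γ 0 (1 : ℝ) : EuclideanSpace ℝ (Fin n)) = X) :
    MDifferentiableAt 𝓘(ℝ, ℝ) (𝓡 n) (fun t => a * γ t * a⁻¹) 0 ∧
      (mfderiv 𝓘(ℝ, ℝ) (𝓡 n) (fun t => a * γ t * a⁻¹) 0 (1 : ℝ) : EuclideanSpace ℝ (Fin n)) =
        Ad a X := by
  have h1 := (mdifferentiableAt_conj (n := n) a (γ 0)).hasMFDerivAt
  have h2 := HasMFDerivAt.comp (0 : ℝ) h1 hd.hasMFDerivAt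
  refine ⟨h2.mdifferentiableAt, ?_⟩
  have h3 := congrArg (fun T : ℝ →L[ℝ] Model n => T 1) h2.mfderiv
  refine Eq.trans h3 ?_
  rw [← hX]
  change tderiv n (fun y : G => a * y * a⁻¹) (γ 0) (mfderiv 𝓘(ℝ, ℝ) (𝓡 n) γ 0 (1 : ℝ)) =
    tderiv n (fun y : G => a * y * a⁻¹) 1 (mfderiv 𝓘(ℝ, ℝ) (𝓡 n) γ 0 (1 : ℝ))
  rw [h0]

theorem Ad_mem_lie {H : Subgroup G} {a : G} (ha : ∀ b ∈ H, a * b * a⁻¹ ∈ H) {X : LieAlg n G}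
    (hX : X ∈ lie H) : Ad a X ∈ lie H := by
  obtain ⟨γ, h0, hH, hd, hX⟩ := hX
  obtain ⟨h1, h2⟩ := velocity_conj a h0 hd hX
  exact ⟨_, by simp [h0], fun t => ha _ (hH t), h1, h2⟩

theorem isAdInvariant_lie (L : Subgroup G) : IsAdInvariant (n := n) L (lie L) :=
  fun _ ha _ hX => Ad_mem_lie (fun _ hb => L.mul_mem (L.mul_mem ha hb) (L.inv_mem ha)) hX

theorem lie_mono {H K : Subgroup G} (h : H ≤ K) : lie (n := n) H ≤ lie K :=
  fun _ ⟨γ, h0, hH, hd, hX⟩ => ⟨γ, h0, fun t => h (hH t), hd, hX⟩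

theorem lie_top : lie (n := n) (⊤ : Subgroup G) = ⊤ :=
  eq_top_iff.2 fun X _ => mem_lieM_of_expM_mem (X := X) fun _ => trivial

/-- Differentiate Ad(aγ(t)a⁻¹) Ad(a) Y = Ad(a) Ad(γ(t)) Y at t = 0, where γ has velocity X. -/
theorem adjointCLM_modelBracket (a : G) (X Y : Model n) :
    adjointCLM n a (modelBracket G X Y) =
      modelBracket G (adjointCLM n a X) (adjointCLM n a Y) := by
  obtain ⟨γ, h0, hd, hX⟩ : ∃ γ : ℝ → G, γ 0 = 1 ∧ MDifferentiableAt 𝓘(ℝ, ℝ) (𝓡 n) γ 0 ∧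
      (mfderiv 𝓘(ℝ, ℝ) (𝓡 n) γ 0 (1 : ℝ) : EuclideanSpace ℝ (Fin n)) = X :=
    ⟨oneParam (n := n) X, oneParam_zero _, (oneParam_velocity (n := n) X).1, oneParam_velocity _ |>.2⟩
  obtain ⟨h1, h2⟩ := velocity_conj (n := n) (X := X) a h0 hd hX
  have h3 := hasDerivAt_oneChart_comp (n := n) (γ := fun t => a * γ t * a⁻¹)
    (X := adjointCLM n a X) (by simp [h0]) h1 h2
  have h4 := hasDerivAt_adjointCLM (n := n) (γ := fun t => a * γ t * a⁻¹)
    (by simp [h0]) h1.continuousAt h3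
  have h5 := h4.clm_apply (hasDerivAt_const 0 (adjointCLM n a Y))
  have h6 := hasDerivAt_adjointCLM (n := n) (X := X) h0 hd.continuousAt
    (hasDerivAt_oneChart_comp h0 hd hX)
  have h7 := (adjointCLM n a).hasFDerivAt.comp_hasDerivAt (0 : ℝ)
    (h6.clm_apply (hasDerivAt_const 0 Y))
  have e : (fun t => adjointCLM n (a * γ t * a⁻¹) (adjointCLM n a Y)) =
      (adjointCLM n a) ∘ fun t => adjointCLM n (γ t) Y := by
    funext t
    have h := Ad_mul (n := n) (a * γ t * a⁻¹) a Y
    rw [inv_mul_cancel_right] at h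
    exact h.symm.trans (Ad_mul (n := n) a _ Y)
  rw [e] at h5
  have h8 := h7.unique h5
  simpa only [map_zero, add_zero, adCLM_apply] using h8

/-- `Ad a` is an automorphism of the Lie algebra. -/
theorem Ad_lie (a : G) (X Y : LieAlg n G) : Ad a ⁅X, Y⁆ = ⁅Ad a X, Ad a Y⁆ :=
  adjointCLM_modelBracket a X Y

theorem Ad_lie_mem {a : G} {Z X : LieAlg n G} (hZ : Ad a Z = Z) :
    Ad a ⁅Z, X⁆ = ⁅Z, Ad a X⁆ := by
  rw [Ad_lie, hZ]

end AdjointAction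

/-! ### From Lie algebra to group: generation by exponentials -/

section CompactSimple

variable {n : ℕ} {G : Type*} [TopologicalSpace G] [ChartedSpace (EuclideanSpace ℝ (Fin n)) G]
  [Group G] [LieGroup (𝓡 n) ∞ G] (hG : LieAlgebra.IsSimple ℝ (LieAlg n G))
include hG

theorem mem_lie_iff {H : Subgroup G} (hH : IsClosed (H : Set G)) {X : LieAlg n G} :
    X ∈ lie H ↔ ∀ t : ℝ, expG (t • X) ∈ H :=
  mem_lieM_iff (injective_adCLM hG) hH

theorem expG_mem {H : Subgroup G} (hH : IsClosed (H : Set G)) {X : LieAlg n G} (hX : X ∈ lie H) :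
    expG X ∈ H := by
  have := (mem_lie_iff hG hH).1 hX 1
  rwa [one_smul] at this

theorem le_of_expG_mem {H K : Subgroup G} (hH : IsClosed (H : Set G))
    (hH' : IsConnected (H : Set G)) (hK : ∀ X ∈ lie (n := n) H, expG X ∈ K) : H ≤ K :=
  le_of_expM_lieM_mem (n := n) (injective_adCLM hG) hH hH' hK

theorem le_of_lie_le {H K : Subgroup G} (hH : IsClosed (H : Set G))
    (hH' : IsConnected (H : Set G)) (hK : IsClosed (K : Set G))
    (h : lie (n := n) H ≤ lie K) : H ≤ K :=
  le_of_expG_mem hG hH hH' fun _ hX => expG_mem hG hK (h hX)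

theorem lie_mem_of_isAdInvariant {L : Subgroup G} (hL : IsClosed (L : Set G))
    {V : Submodule ℝ (LieAlg n G)} (hV : IsAdInvariant L V) {X Y : LieAlg n G} (hX : X ∈ lie L)
    (hY : Y ∈ V) : ⁅X, Y⁆ ∈ V :=
  Ad_conj_mem fun t => hV _ ((mem_lie_iff hG hL).1 hX t) Y hY

/-- If 𝔩 kills Z, the stabilizer of Z contains all exponentials of 𝔩, which generate the connected
group L. -/
theorem Ad_eq_self_iff {L : Subgroup G} (hL : IsClosed (L : Set G))
    (hL' : IsConnected (L : Set G)) {Z : LieAlg n G} :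
    (∀ a ∈ L, Ad a Z = Z) ↔ ∀ X ∈ lie (n := n) L, ⁅X, Z⁆ = 0 := by
  refine ⟨fun h X hX => lie_eq_zero_of_Ad fun t => h _ ((mem_lie_iff hG hL).1 hX t), fun h => ?_⟩
  let K : Subgroup G :=
    { carrier := {a | Ad a Z = Z}
      one_mem' := Ad_one Z
      mul_mem' := fun {a b} ha hb => by
        change Ad (a * b) Z = Z
        rw [Ad_mul, hb, ha]
      inv_mem' := fun {a} ha => by
        change Ad a⁻¹ Z = Z
        conv_lhs => rw [← show Ad a Z = Z from ha]
        exact Ad_inv_Ad a Z }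
  exact fun a ha => le_of_expG_mem (K := K) hG hL hL' (fun X hX => Ad_expG_eq_self (h X hX)) ha

omit hG in
theorem killingForm_lie_add (X Y Z : LieAlg n G) :
    killingForm ℝ (LieAlg n G) ⁅X, Y⁆ Z + killingForm ℝ (LieAlg n G) Y ⁅X, Z⁆ = 0 := by
  rw [add_eq_zero_iff_eq_neg, ← lie_skew, map_neg, LinearMap.neg_apply]
  exact congrArg Neg.neg (LieModule.traceForm_apply_lie_apply ℝ (LieAlg n G) (LieAlg n G) Y X Z)

/-- Each ad X is skew for the Killing form, so exponentials preserve it, and they generate the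
connected group G. -/
theorem killingForm_Ad [ConnectedSpace G] (a : G) (X Y : LieAlg n G) :
    killingForm ℝ (LieAlg n G) (Ad a X) (Ad a Y) = killingForm ℝ (LieAlg n G) X Y := by
  let K : Subgroup G :=
    { carrier := {a | ∀ X Y : LieAlg n G, killingForm ℝ (LieAlg n G) (Ad a X) (Ad a Y) =
        killingForm ℝ (LieAlg n G) X Y}
      one_mem' := fun X Y => by rw [Ad_one, Ad_one]
      mul_mem' := fun {a b} ha hb X Y => by rw [Ad_mul, Ad_mul, ha, hb]
      inv_mem' := fun {a} ha X Y => by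
        rw [← ha (Ad a⁻¹ X), Ad_Ad_inv, Ad_Ad_inv] }
  have hexp : ∀ X Y Z : Model n,
      (killingForm ℝ (LieAlg n G) : LinearMap.BilinForm ℝ (Model n)) (adjointCLM n (expM G X) Y)
        (adjointCLM n (expM G X) Z) =
      (killingForm ℝ (LieAlg n G) : LinearMap.BilinForm ℝ (Model n)) Y Z := by
    intro X Y Z
    rw [adjointCLM_expM]
    refine bilin_exp_apply _ (fun Y Z => ?_) Y Z
    rw [adCLM_apply, adCLM_apply]
    exact killingForm_lie_add (G := G) X Y Z
  have h : (⊤ : Subgroup G) ≤ K := by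
    refine le_of_expG_mem (n := n) hG isClosed_univ ?_ fun X _ Y Z => hexp X Y Z
    rw [Subgroup.coe_top]; exact isConnected_univ
  exact h (show a ∈ (⊤ : Subgroup G) from trivial) X Y

end CompactSimple

end HomogeneousLorentz

namespace HomogeneousLorentz

/-! ### Lorentzian forms in a Euclidean space -/

section LorentzForms

section Inner

variable {V : Type*} [NormedAddCommGroup V] [InnerProductSpace ℝ V] [FiniteDimensional ℝ V]

/-- A Lorentzian form has, up to scaling, a unique negative eigenvector with respect to a
Euclidean one. -/
theorem exists_fixed_direction_of_lorentz_inner (B : LinearMap.BilinForm ℝ V)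
    (hB : ∀ x y, B x y = B y x) (K : Submodule ℝ V) (hK : ∀ k ∈ K, ∀ v, B k v = 0) {v : V}
    (hv : B v v < 0) (hw : ∀ w, B v w = 0 → w ∉ K → 0 < B w w) :
    ∃ Z : V, Z ≠ 0 ∧ (∀ k ∈ K, inner ℝ Z k = 0) ∧ ∀ A : V →ₗ[ℝ] V,
      (∀ x y, inner ℝ (A x) (A y) = inner ℝ x y) → (∀ x y, B (A x) (A y) = B x y) →
        A Z = Z ∨ A Z = -Z := by
  let S : V →ₗ[ℝ] V := (InnerProductSpace.toDual ℝ V).symm.toLinearEquiv.toLinearMap ∘ₗ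
    (LinearMap.toContinuousLinearMap (𝕜 := ℝ) (E := V) (F' := ℝ)).toLinearMap ∘ₗ B
  have hS : ∀ x y, inner ℝ (S x) y = B x y := fun x y => InnerProductSpace.toDual_symm_apply
  have hSs : S.IsSymmetric := fun x y => by rw [hS, real_inner_comm, hS, hB]
  -- a negative eigenvalue
  obtain ⟨Z, c, hZ, hc, hSZ⟩ : ∃ (Z : V) (c : ℝ), Z ≠ 0 ∧ c < 0 ∧ S Z = c • Z := by
    by_contra! hcon
    refine hv.not_ge ?_
    -- By the spectral theorem B(v, v) is the sum of the eigenvalues weighted by squared coordinates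
    -- of v; were no eigenvalue negative, it could not be negative.
    rw [← hS, ← (hSs.eigenvectorBasis rfl).sum_inner_mul_inner]
    refine Finset.sum_nonneg fun i _ => ?_
    have h1 := hSs.apply_eigenvectorBasis rfl i
    rw [hSs, h1, inner_smul_right, real_inner_comm, mul_assoc]
    refine mul_nonneg ?_ (mul_self_nonneg _)
    by_contra! hneg
    exact hcon _ _ (by
      have := (hSs.eigenvectorBasis rfl).orthonormal.ne_zero i
      exact this) hneg h1
  -- orthogonal vectors in its eigenspace vanish
  have huniq : ∀ u : V, S u = c • u → inner ℝ Z u = 0 → u = 0 := by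
    intro u hu hZu
    by_contra hne
    -- This combination is B-orthogonal to v and still in the eigenspace of the negative c, so B(w,
    -- w) < 0 contradicts the positivity on the complement of v.
    set w := B v u • Z - B v Z • u with hw_def
    have hvw : B v w = 0 := by simp [hw_def]; ring
    have hww : B w w = c * inner ℝ w w := by
      rw [← hS]
      have : S w = c • w := by
        rw [hw_def, map_sub, map_smul, map_smul, hSZ, hu, smul_sub, smul_comm c, smul_comm c]
      rw [this, inner_smul_left]; rfl
    have hvZ : B v Z ≠ 0 := by
      intro h0
      have h1 := hw Z h0 fun hm => by
        have := hK Z hm Z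
        rw [← hS, hSZ, inner_smul_left] at this
        exact (mul_ne_zero hc.ne (inner_self_ne_zero.2 hZ)) this
      rw [← hS, hSZ, inner_smul_left] at h1
      have h2 : 0 < inner ℝ Z Z := real_inner_self_pos.2 hZ
      exact absurd h1 (not_lt.2 (mul_nonpos_of_nonpos_of_nonneg hc.le h2.le))
    have hw0 : w ≠ 0 := by
      intro h0
      have h1 : inner ℝ w u = 0 := by rw [h0, inner_zero_left]
      rw [hw_def, inner_sub_left, inner_smul_left, inner_smul_left, hZu, mul_zero, zero_sub,
        neg_eq_zero] at h1
      exact (mul_ne_zero hvZ (inner_self_ne_zero.2 hne)) h1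
    have hpos : 0 < inner ℝ w w := real_inner_self_pos.2 hw0
    have hneg : B w w < 0 := hww ▸ mul_neg_of_neg_of_pos hc hpos
    exact absurd (hw w hvw fun hm => hneg.ne (hK w hm w)) hneg.not_gt
  refine ⟨Z, hZ, fun k hk => ?_, fun A hA hAB => ?_⟩
  · have h1 : inner ℝ (S Z) k = 0 := by rw [hS, hB, hK k hk]
    rw [hSZ, inner_smul_left] at h1
    exact (mul_eq_zero.1 h1).resolve_left hc.ne
  · have hinj : Function.Injective A := by
      refine (injective_iff_map_eq_zero A).2 fun x hx => ?_
      have := hA x x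
      rw [hx, inner_zero_left] at this
      exact inner_self_eq_zero.1 this.symm
    have hsurj := LinearMap.injective_iff_surjective.1 hinj
    -- A map preserving both forms commutes with S, so it sends Z into the same eigenspace, which is
    -- a line.
    have hcomm : S (A Z) = c • A Z := by
      refine ext_inner_right ℝ fun y => ?_
      obtain ⟨y, rfl⟩ := hsurj y
      rw [hS, hAB, ← hS, hSZ, inner_smul_left, inner_smul_left, hA]
    have hZZ : inner ℝ Z Z ≠ (0 : ℝ) := inner_self_ne_zero.2 hZ
    set d : ℝ := inner ℝ Z (A Z) / inner ℝ Z Z with hd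
    have hu := huniq (A Z - d • Z)
      (by rw [map_sub, map_smul, hcomm, hSZ, smul_sub, smul_comm])
      (by rw [inner_sub_right, inner_smul_right, hd, div_mul_cancel₀ _ hZZ, sub_self])
    rw [sub_eq_zero] at hu
    have hd1 : d * d = 1 := by
      have := hA Z Z
      rw [hu, inner_smul_left, inner_smul_right, ← mul_assoc] at this
      exact mul_right_cancel₀ hZZ (this.trans (one_mul _).symm)
    rcases mul_self_eq_one_iff.1 hd1 with h | h
    · left; rw [hu, h, one_smul]
    · right; rw [hu, h, neg_one_smul]

/-- Project to K^⊥ and reverse the sign of the inner product along the projection Q of Z. An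
isometry that preserves K commutes with the projection, and if it fixes Z it also fixes Q, hence the
form. -/
theorem exists_lorentz_of_fixed_inner (K : Submodule ℝ V) {Z : V} (hZ : Z ∉ K) :
    ∃ B : LinearMap.BilinForm ℝ V, (∀ x y, B x y = B y x) ∧ (∀ k ∈ K, ∀ v, B k v = 0) ∧
      (∃ v, B v v < 0 ∧ ∀ w, B v w = 0 → w ∉ K → 0 < B w w) ∧
      ∀ A : V →ₗ[ℝ] V, (∀ x y, inner ℝ (A x) (A y) = inner ℝ x y) → (∀ k ∈ K, A k ∈ K) →
        A Z = Z → ∀ x y, B (A x) (A y) = B x y := by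
  set P : V →L[ℝ] V := Kᗮ.starProjection with hP
  set Q : V := P Z with hQ
  have hPmem : ∀ x, P x ∈ Kᗮ := fun x => Submodule.starProjection_apply_mem _ x
  have hPs : ∀ x y, inner ℝ (P x) y = inner ℝ x (P y) :=
    Submodule.inner_starProjection_left_eq_right _
  have hPP : ∀ x, P (P x) = P x := fun x => Submodule.starProjection_eq_self_iff.2 (hPmem x)
  have hPK : ∀ x, P x = 0 ↔ x ∈ K := fun x => by
    rw [hP, Submodule.starProjection_apply_eq_zero_iff, Submodule.orthogonal_orthogonal]
  have hQ0 : Q ≠ 0 := fun h => hZ ((hPK Z).1 h)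
  have hQQ : 0 < inner ℝ Q Q := real_inner_self_pos.2 hQ0
  have hQP : ∀ x, inner ℝ Q (P x) = inner ℝ Q x := fun x => by rw [← hPs, hQ, hPP]
  let I : LinearMap.BilinForm ℝ V := innerₗ V
  -- The factor 2/⟨Q, Q⟩ turns ⟨Q, Q⟩ into -⟨Q, Q⟩ and leaves the orthogonal complement of Q
  -- unaffected.
  let B : LinearMap.BilinForm ℝ V := I.comp (P : V →ₗ[ℝ] V) (P : V →ₗ[ℝ] V) -
    (2 / inner ℝ Q Q) • LinearMap.BilinForm.linMulLin (I Q) (I Q)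
  have hBa : ∀ x y, B x y = inner ℝ (P x) (P y) - 2 / inner ℝ Q Q * (inner ℝ Q x * inner ℝ Q y) :=
    fun x y => by simp [B, I]
  have hBQ : ∀ x, B Q x = - inner ℝ Q x := fun x => by
    have h1 : P Q = Q := hPP Z
    rw [hBa, h1, hQP, ← mul_assoc, div_mul_cancel₀ _ hQQ.ne']
    ring
  refine ⟨B, fun x y => ?_, fun k hk v => ?_, ⟨Q, ?_, fun w hw hwK => ?_⟩, fun A hA hAK hAZ x y => ?_⟩
  · rw [hBa, hBa, real_inner_comm, mul_comm (inner ℝ Q x)]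
  · have h1 : P k = 0 := (hPK k).2 hk
    rw [hBa, ← hQP k, h1]; simp
  · rw [hBQ]
    exact neg_lt_zero.2 hQQ
  · rw [hBQ, neg_eq_zero] at hw
    have h1 : inner ℝ Q w = (0 : ℝ) := hw
    rw [hBa, h1, mul_zero, mul_zero, sub_zero]
    exact real_inner_self_pos.2 fun h => hwK ((hPK w).1 h)
  · have hinj : Function.Injective A := by
      refine (injective_iff_map_eq_zero A).2 fun x hx => ?_
      have := hA x x
      rw [hx, inner_zero_left] at this
      exact inner_self_eq_zero.1 this.symm
    have hmap : K.map A = K :=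
      Submodule.eq_of_le_of_finrank_eq (Submodule.map_le_iff_le_comap.2 hAK)
        (Submodule.equivMapOfInjective A hinj K).finrank_eq.symm
    have hPA : ∀ x, P (A x) = A (P x) := by
      intro x
      have h1 : A (P x) ∈ Kᗮ := by
        refine (Submodule.mem_orthogonal _ _).2 fun k hk => ?_
        rw [← hmap] at hk
        obtain ⟨k, hk, rfl⟩ := hk
        rw [hA]
        exact (Submodule.mem_orthogonal _ _).1 (hPmem x) k hk
      have h2 : x - P x ∈ K := by rw [← hPK, map_sub, hPP, sub_self]
      have h3 : P (A (x - P x)) = 0 := (hPK _).2 (hAK _ h2)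
      rw [map_sub, map_sub, sub_eq_zero] at h3
      rw [h3]
      exact Submodule.starProjection_eq_self_iff.2 h1
    have hAQ : A Q = Q := by rw [hQ, ← hPA, hAZ]
    have hQA : ∀ x, inner ℝ Q (A x) = inner ℝ Q x := fun x => by
      conv_lhs => rw [← hAQ]
      exact hA _ _
    rw [hBa, hBa, hPA, hPA, hA, hQA, hQA]

end Inner

variable {V : Type*} [AddCommGroup V] [Module ℝ V] [FiniteDimensional ℝ V]
  (b : LinearMap.BilinForm ℝ V) (hs : ∀ x y, b x y = b y x) (hp : ∀ x, x ≠ 0 → 0 < b x x)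
include hs hp

theorem exists_fixed_direction_of_lorentz (B : LinearMap.BilinForm ℝ V)
    (hB : ∀ x y, B x y = B y x) (K : Submodule ℝ V) (hK : ∀ k ∈ K, ∀ v, B k v = 0) {v : V}
    (hv : B v v < 0) (hw : ∀ w, B v w = 0 → w ∉ K → 0 < B w w) :
    ∃ Z : V, Z ≠ 0 ∧ (∀ k ∈ K, b Z k = 0) ∧ ∀ A : V →ₗ[ℝ] V,
      (∀ x y, b (A x) (A y) = b x y) → (∀ x y, B (A x) (A y) = B x y) →
        A Z = Z ∨ A Z = -Z := by
  let _ : NormedAddCommGroup V := (innerCore b hs hp).toNormedAddCommGroup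
  let _ : InnerProductSpace ℝ V := InnerProductSpace.ofCore (innerCore b hs hp).toCore
  exact exists_fixed_direction_of_lorentz_inner B hB K hK hv hw

theorem exists_lorentz_of_fixed (K : Submodule ℝ V) {Z : V} (hZ : Z ∉ K) :
    ∃ B : LinearMap.BilinForm ℝ V, (∀ x y, B x y = B y x) ∧ (∀ k ∈ K, ∀ v, B k v = 0) ∧
      (∃ v, B v v < 0 ∧ ∀ w, B v w = 0 → w ∉ K → 0 < B w w) ∧
      ∀ A : V →ₗ[ℝ] V, (∀ x y, b (A x) (A y) = b x y) → (∀ k ∈ K, A k ∈ K) →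
        A Z = Z → ∀ x y, B (A x) (A y) = B x y := by
  let _ : NormedAddCommGroup V := (innerCore b hs hp).toNormedAddCommGroup
  let _ : InnerProductSpace ℝ V := InnerProductSpace.ofCore (innerCore b hs hp).toCore
  exact exists_lorentz_of_fixed_inner K hZ

end LorentzForms

end HomogeneousLorentz

namespace HomogeneousLorentz

/-! ### Admissible subgroups and fixed vectors -/

section Admissible

variable {n : ℕ} {G : Type*} [TopologicalSpace G] [ChartedSpace (EuclideanSpace ℝ (Fin n)) G]
  [Group G] [LieGroup (𝓡 n) ∞ G]

theorem adjointCLM_eq_tderiv_comp (a : G) :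
    (tderiv n (fun x : G => x * a⁻¹) a).comp (tderiv n (fun x : G => a * x) 1) =
      adjointCLM n a := by
  have h := tderiv_comp (n := n) (g := fun x : G => x * a⁻¹) (f := fun x : G => a * x) (x := 1)
    (mdifferentiableAt_mul_right' _ _) (mdifferentiableAt_mul_left' _ _)
  rw [mul_one] at h
  exact h.symm

/-- Left translation by a followed by right translation by a⁻¹ fixes 1 with derivative Ad a; both
leave the form invariant. -/
theorem form_Ad {L : Subgroup G} (g : InvariantLorentzMetric n L) {a : G} (ha : a ∈ L)
    (u v : LieAlg n G) : g.form 1 (Ad a u) (Ad a v) = g.form 1 u v := by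
  let F : G → LinearMap.BilinForm ℝ (Model n) := g.form
  have hl : ∀ (b a : G) (u v : Model n), F (b * a) (tderiv n (fun x : G => b * x) a u)
    (tderiv n (fun x : G => b * x) a v) = F a u v := g.left_invariant
  have hr : ∀ (a : G), ∀ b ∈ L, ∀ (u v : Model n), F (a * b) (tderiv n (fun x : G => x * b) a u)
    (tderiv n (fun x : G => x * b) a v) = F a u v := g.right_invariant
  have key : ∀ u v : Model n, F 1 (adjointCLM n a u) (adjointCLM n a v) = F 1 u v := by
    intro u v
    have h1 := hr a a⁻¹ (L.inv_mem ha) (tderiv n (fun x : G => a * x) 1 u)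
      (tderiv n (fun x : G => a * x) 1 v)
    have h2 := hl a 1 u v
    rw [mul_one] at h2
    rw [h2, mul_inv_cancel] at h1
    rw [← adjointCLM_eq_tderiv_comp]
    exact h1
  exact key u v

/-- The negative Killing form. -/
def negKilling (n : ℕ) (G : Type*) [TopologicalSpace G]
    [ChartedSpace (EuclideanSpace ℝ (Fin n)) G] [Group G] [LieGroup (𝓡 n) ∞ G] :
    LinearMap.BilinForm ℝ (LieAlg n G) := -killingForm ℝ (LieAlg n G)

theorem negKilling_apply (X Y : LieAlg n G) :
    negKilling n G X Y = -killingForm ℝ (LieAlg n G) X Y := rfl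

theorem negKilling_comm (X Y : LieAlg n G) : negKilling n G X Y = negKilling n G Y X := by
  rw [negKilling_apply, negKilling_apply]
  exact congrArg Neg.neg (LieModule.traceForm_comm ℝ (LieAlg n G) (LieAlg n G) X Y)

theorem negKilling_lie (X Y Z : LieAlg n G) :
    negKilling n G ⁅X, Y⁆ Z = negKilling n G X ⁅Y, Z⁆ :=
  congrArg Neg.neg (LieModule.traceForm_apply_lie_apply ℝ (LieAlg n G) (LieAlg n G) X Y Z)

theorem expG_half_mul (X : LieAlg n G) (t : ℝ) :
    expG ((t / 2) • X) * expG ((t / 2) • X) = expG (t • X) := by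
  rw [← expG_add_smul, add_halves]

theorem tderiv_mul_left_inv_comp (a : G) :
    (tderiv n (fun x : G => a⁻¹ * x) a).comp (tderiv n (fun x : G => a * x) 1) =
      ContinuousLinearMap.id ℝ (Model n) := by
  rw [← tderiv_mul_left_mul, inv_mul_cancel, tderiv_one_mul]

theorem tderiv_comp_mul_left_inv (a : G) :
    (tderiv n (fun x : G => a * x) 1).comp (tderiv n (fun x : G => a⁻¹ * x) a) =
      ContinuousLinearMap.id ℝ (Model n) := by
  have h := tderiv_comp (n := n) (g := fun x : G => a * x) (f := fun x : G => a⁻¹ * x) (x := a)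
    (mdifferentiableAt_mul_left' _ _) (mdifferentiableAt_mul_left' _ _)
  rw [inv_mul_cancel] at h
  rw [← h, ← tderiv_id a]
  exact tderiv_congr (Eventually.of_forall fun x => by simp)

theorem tderiv_left_left (a b : G) :
    (tderiv n (fun x : G => (b * a)⁻¹ * x) (b * a)).comp (tderiv n (fun x : G => b * x) a) =
      tderiv n (fun x : G => a⁻¹ * x) a := by
  have h := tderiv_comp (n := n) (g := fun x : G => (b * a)⁻¹ * x) (f := fun x : G => b * x) (x := a)
    (mdifferentiableAt_mul_left' _ _) (mdifferentiableAt_mul_left' _ _)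
  rw [← h]
  exact tderiv_congr (Eventually.of_forall fun x => by simp [mul_assoc])

theorem tderiv_left_right (a b : G) :
    (tderiv n (fun x : G => (a * b)⁻¹ * x) (a * b)).comp (tderiv n (fun x : G => x * b) a) =
      (adjointCLM n b⁻¹).comp (tderiv n (fun x : G => a⁻¹ * x) a) := by
  have h := tderiv_comp (n := n) (g := fun x : G => (a * b)⁻¹ * x) (f := fun x : G => x * b) (x := a)
    (mdifferentiableAt_mul_left' _ _) (mdifferentiableAt_mul_right' _ _)
  have h2 := tderiv_comp (n := n) (g := fun x : G => b⁻¹ * x * b⁻¹⁻¹) (f := fun x : G => a⁻¹ * x)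
    (x := a) (mdifferentiableAt_conj _ _) (mdifferentiableAt_mul_left' _ _)
  rw [inv_mul_cancel] at h2
  rw [← h, adjointCLM, ← h2]
  exact tderiv_congr (Eventually.of_forall fun x => by simp [mul_assoc])

/-- An `Ad_L`-invariant form on the Lie algebra spreads out to an invariant metric. -/
theorem nonempty_invariantLorentzMetric {L : Subgroup G} (B : LinearMap.BilinForm ℝ (Model n))
    (hs : ∀ x y, B x y = B y x) (hK : ∀ k ∈ lieM n L, ∀ v, B k v = 0)
    (hv : ∃ v, B v v < 0 ∧ ∀ w, B v w = 0 → w ∉ lieM n L → 0 < B w w)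
    (hA : ∀ a ∈ L, ∀ x y, B (adjointCLM n a x) (adjointCLM n a y) = B x y) :
    Nonempty (InvariantLorentzMetric n L) := by
  let T : G → Model n →L[ℝ] Model n := fun a => tderiv n (fun x : G => a⁻¹ * x) a
  let S : G → Model n →L[ℝ] Model n := fun a => tderiv n (fun x : G => a * x) 1
  have hTS : ∀ a u, T a (S a u) = u := fun a u =>
    congrArg (fun f : Model n →L[ℝ] Model n => f u) (tderiv_mul_left_inv_comp (n := n) a)
  have hST : ∀ a u, S a (T a u) = u := fun a u =>
    congrArg (fun f : Model n →L[ℝ] Model n => f u) (tderiv_comp_mul_left_inv (n := n) a)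
  let F : G → LinearMap.BilinForm ℝ (Model n) := fun a =>
    B.comp (T a : Model n →ₗ[ℝ] Model n) (T a : Model n →ₗ[ℝ] Model n)
  have hF : ∀ a u v, F a u v = B (T a u) (T a v) := fun _ _ _ => rfl
  have h_vert : ∀ a : G, ∀ u : Model n, (∃ X ∈ lieM n L, S a X = u) → ∀ v : Model n, F a u v = 0 := by
    rintro a u ⟨X, hX, rfl⟩ v
    rw [hF, hTS, hK X hX]
  have h_lor : ∀ a : G, ∃ v : Model n, F a v v < 0 ∧ ∀ w : Model n, F a v w = 0 →
      (¬ ∃ X ∈ lieM n L, S a X = w) → 0 < F a w w := by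
    intro a
    obtain ⟨v, hv1, hv2⟩ := hv
    refine ⟨S a v, by rw [hF, hTS]; exact hv1, fun w hw hwn => ?_⟩
    rw [hF, hTS] at hw
    exact hv2 _ hw fun h => hwn ⟨_, h, hST a w⟩
  have h_right : ∀ a : G, ∀ b ∈ L, ∀ u v : Model n, F (a * b) (tderiv n (fun x : G => x * b) a u)
      (tderiv n (fun x : G => x * b) a v) = F a u v := by
    intro a b hb u v
    have h := fun u => congrArg (fun f : Model n →L[ℝ] Model n => f u) (tderiv_left_right (n := n) a b)
    exact (congrArg₂ (fun x y => B x y) (h u) (h v)).trans (hA _ (L.inv_mem hb) _ _)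
  have h_left : ∀ b a : G, ∀ u v : Model n, F (b * a) (tderiv n (fun x : G => b * x) a u)
      (tderiv n (fun x : G => b * x) a v) = F a u v := by
    intro b a u v
    have h := fun u => congrArg (fun f : Model n →L[ℝ] Model n => f u) (tderiv_left_left (n := n) a b)
    exact congrArg₂ (fun x y => B x y) (h u) (h v)
  exact ⟨{ form := F
           symm := fun a u v => hs _ _
           vertical_eq_zero := h_vert
           lorentzian := h_lor
           right_invariant := h_right
           left_invariant := h_left }⟩

variable [CompactSpace G] [ConnectedSpace G] (hG : LieAlgebra.IsSimple ℝ (LieAlg n G))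
include hG

theorem negKilling_pos {X : LieAlg n G} (hX : X ≠ 0) : 0 < negKilling n G X X :=
  neg_pos.2 (killingForm_neg hG hX)

theorem negKilling_Ad (a : G) (X Y : LieAlg n G) :
    negKilling n G (Ad a X) (Ad a Y) = negKilling n G X Y :=
  congrArg Neg.neg (killingForm_Ad hG a X Y)

/-- The form at 1 and b are both preserved by L, so the negative eigenvector of the form relative to
b is fixed up to sign; taking squares in one-parameter subgroups removes the sign. -/
theorem InvariantLorentzMetric.exists_fixed {L : Subgroup G} (hL : IsClosed (L : Set G))
    (g : InvariantLorentzMetric n L) :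
    ∃ Z : LieAlg n G, Z ≠ 0 ∧ (∀ X ∈ lie L, negKilling n G Z X = 0) ∧
      ∀ X ∈ lie (n := n) L, ⁅X, Z⁆ = 0 := by
  have hvert : ∀ X ∈ lie (n := n) L, ∀ v, g.form 1 X v = 0 := fun X hX v =>
    g.vertical_eq_zero 1 X ⟨X, hX, congrArg (fun T => T X) (tderiv_one_mul (n := n) (G := G))⟩ v
  obtain ⟨v, hv, hw⟩ := g.lorentzian 1
  obtain ⟨Z, hZ, hZL, hA⟩ := exists_fixed_direction_of_lorentz (negKilling n G) negKilling_comm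
    (fun X hX => negKilling_pos hG hX) (g.form 1) (g.symm 1) (lie L) hvert hv (fun w h1 h2 =>
      hw w h1 fun ⟨X, hX, hXw⟩ => h2 (by
        have h3 := congrArg (fun T : Model n →L[ℝ] Model n => T X) (tderiv_one_mul (n := n) (G := G))
        have h4 : X = w := h3.symm.trans hXw
        exact h4 ▸ hX))
  refine ⟨Z, hZ, hZL, fun X hX => lie_eq_zero_of_Ad fun t => ?_⟩
  -- The parameter is halved so that exp(tX) is a square, on which the sign ±1 becomes 1.
  have hmem : expG ((t / 2) • X) ∈ L := (mem_lie_iff hG hL).1 hX _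
  have h := hA (AdLin n (expG ((t / 2) • X))) (fun x y => negKilling_Ad hG _ x y)
    (fun x y => form_Ad g hmem x y)
  rw [AdLin_apply] at h
  rw [← expG_half_mul, Ad_mul]
  rcases h with h | h
  · rw [h, h]
  · rw [h, ← neg_one_smul ℝ Z, Ad_smul, h, neg_one_smul, neg_neg]

/-- The closure of a normal subgroup inside L is normal, closed and still inside L. Its Lie algebra
is a proper ideal, hence zero, and a closed subgroup with zero Lie algebra is discrete. -/
theorem isAlmostEffective_of_lie_ne_top {L : Subgroup G} (hL : IsClosed (L : Set G))
    (h : lie (n := n) L ≠ ⊤) : IsAlmostEffective L := by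
  intro N hN hNL
  have hT := isTopologicalGroup_of_lieGroup n G
  set C := N.topologicalClosure
  have hCn : C.Normal := Subgroup.is_normal_topologicalClosure N
  have hCc : IsClosed (C : Set G) := N.isClosed_topologicalClosure
  have hCL : C ≤ L := N.topologicalClosure_minimal hNL hL
  have hinv : IsAdInvariant (n := n) (⊤ : Subgroup G) (lie C) := fun a _ X hX =>
    Ad_mem_lie (fun b hb => hCn.conj_mem b hb a) hX
  let I : LieIdeal ℝ (LieAlg n G) :=
    { lie (n := n) C with
      lie_mem := fun {x m} hm => lie_mem_of_isAdInvariant hG isClosed_univ hinv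
        (by rw [lie_top]; trivial) hm }
  have hI : ∀ X, X ∈ I ↔ X ∈ lie C := fun X => Iff.rfl
  have hCd : DiscreteTopology C := by
    refine discreteTopology_of_lieM_eq_bot (n := n) (injective_adCLM hG) hCc ?_
    rcases hG.eq_bot_or_eq_top I with h1 | h1
    · have h2 : lie (n := n) C = ⊥ := (Submodule.eq_bot_iff _).2 fun X hX => by
        have : X ∈ I := hX
        rw [h1] at this
        exact (LieSubmodule.mem_bot _).1 this
      exact h2
    · refine absurd (eq_top_iff.2 fun X _ => ?_) h
      have : X ∈ I := by rw [h1]; trivial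
      exact lie_mono hCL this
  exact DiscreteTopology.of_subset (s := (C : Set G)) hCd N.le_topologicalClosure

theorem isAdmissible_of_fixed {L : Subgroup G} (hL : IsClosed (L : Set G))
    (hL' : IsConnected (L : Set G)) {Z : LieAlg n G} (hZ : Z ∉ lie L)
    (hfix : ∀ X ∈ lie (n := n) L, ⁅X, Z⁆ = 0) : IsAdmissible n L := by
  refine ⟨hL, hL', isAlmostEffective_of_lie_ne_top hG hL fun h => hZ (h ▸ trivial), ?_⟩
  obtain ⟨B, hs, hK, hv, hA⟩ := exists_lorentz_of_fixed (negKilling n G) negKilling_comm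
    (fun X hX => negKilling_pos hG hX) (lie L) hZ
  refine nonempty_invariantLorentzMetric (n := n) (L := L) B hs hK hv fun a ha x y => ?_
  exact hA (AdLin n a) (fun x y => negKilling_Ad hG a x y) (fun k hk => isAdInvariant_lie L a ha k hk)
    ((Ad_eq_self_iff hG hL hL').2 hfix a ha) x y

theorem IsAdmissible.exists_fixed {L : Subgroup G} (h : IsAdmissible n L) :
    ∃ Z : LieAlg n G, Z ≠ 0 ∧ (∀ X ∈ lie L, negKilling n G Z X = 0) ∧
      ∀ X ∈ lie (n := n) L, ⁅X, Z⁆ = 0 :=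
  h.2.2.2.some.exists_fixed hG h.1

end Admissible

end HomogeneousLorentz

namespace HomogeneousLorentz

/-! ### Quaternionic bases and sp(1) -/

section Quaternionic

variable {𝔥 : Type*} [LieRing 𝔥] [LieAlgebra ℝ 𝔥]

/-- The bracket relations of the imaginary quaternions `i, j, k`. -/
structure IsQuaternionic (e : Module.Basis (Fin 3) ℝ 𝔥) : Prop where
  lie_zero_one : ⁅e 0, e 1⁆ = (2 : ℝ) • e 2
  lie_one_two : ⁅e 1, e 2⁆ = (2 : ℝ) • e 0
  lie_two_zero : ⁅e 2, e 0⁆ = (2 : ℝ) • e 1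

theorem IsQuaternionic.map {𝔥' : Type*} [LieRing 𝔥'] [LieAlgebra ℝ 𝔥']
    {e : Module.Basis (Fin 3) ℝ 𝔥} (he : IsQuaternionic e) (f : 𝔥 ≃ₗ⁅ℝ⁆ 𝔥') :
    IsQuaternionic (e.map f.toLinearEquiv) where
  lie_zero_one := by
    have := congrArg f he.lie_zero_one
    rwa [LieEquiv.map_lie, map_smul] at this
  lie_one_two := by
    have := congrArg f he.lie_one_two
    rwa [LieEquiv.map_lie, map_smul] at this
  lie_two_zero := by
    have := congrArg f he.lie_two_zero
    rwa [LieEquiv.map_lie, map_smul] at this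

theorem IsQuaternionic.lie_equiv {𝔥' : Type*} [LieRing 𝔥'] [LieAlgebra ℝ 𝔥']
    {e : Module.Basis (Fin 3) ℝ 𝔥} (he : IsQuaternionic e) {e' : Module.Basis (Fin 3) ℝ 𝔥'}
    (he' : IsQuaternionic e') : Nonempty (𝔥 ≃ₗ⁅ℝ⁆ 𝔥') := by
  let f : 𝔥 ≃ₗ[ℝ] 𝔥' := e.equiv e' (Equiv.refl _)
  have hf : ∀ i, f (e i) = e' i := fun i => e.equiv_apply i e' (Equiv.refl _)
  have h10 : ⁅e 1, e 0⁆ = -((2 : ℝ) • e 2) := by rw [← lie_skew, he.lie_zero_one]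
  have h21 : ⁅e 2, e 1⁆ = -((2 : ℝ) • e 0) := by rw [← lie_skew, he.lie_one_two]
  have h02 : ⁅e 0, e 2⁆ = -((2 : ℝ) • e 1) := by rw [← lie_skew, he.lie_two_zero]
  have h10' : ⁅e' 1, e' 0⁆ = -((2 : ℝ) • e' 2) := by rw [← lie_skew, he'.lie_zero_one]
  have h21' : ⁅e' 2, e' 1⁆ = -((2 : ℝ) • e' 0) := by rw [← lie_skew, he'.lie_one_two]
  have h02' : ⁅e' 0, e' 2⁆ = -((2 : ℝ) • e' 1) := by rw [← lie_skew, he'.lie_two_zero]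
  have h : (LieModule.toEnd ℝ 𝔥 𝔥 : 𝔥 →ₗ[ℝ] Module.End ℝ 𝔥).compr₂ f.toLinearMap =
      (LieModule.toEnd ℝ 𝔥' 𝔥' : 𝔥' →ₗ[ℝ] Module.End ℝ 𝔥').compl₁₂ f.toLinearMap f.toLinearMap := by
    refine e.ext fun i => e.ext fun j => ?_
    change f ⁅e i, e j⁆ = ⁅f (e i), f (e j)⁆
    rw [hf, hf]
    fin_cases i <;> fin_cases j <;>
      simp [he.lie_zero_one, he.lie_one_two, he.lie_two_zero, he'.lie_zero_one, he'.lie_one_two,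
        he'.lie_two_zero, h10, h21, h02, h10', h21', h02', hf]
  exact ⟨{ f with
    map_lie' := fun {x y} => congrArg (fun T => T x y) h }⟩

/-- A double bracket such as ad e₁ ∘ ad e₀ annihilates all basis components but one, so a nonzero
ideal contains a basis vector, and then the bracket relations produce the others. -/
theorem IsQuaternionic.isSimple {e : Module.Basis (Fin 3) ℝ 𝔥} (he : IsQuaternionic e) :
    LieAlgebra.IsSimple ℝ 𝔥 where
  non_abelian h := by
    have h1 := he.lie_zero_one
    rw [h.trivial] at h1
    exact (smul_ne_zero two_ne_zero (e.ne_zero 2)) h1.symm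
  eq_bot_or_eq_top I := by
    have h10 : ⁅e 1, e 0⁆ = -((2 : ℝ) • e 2) := by rw [← lie_skew, he.lie_zero_one]
    have h21 : ⁅e 2, e 1⁆ = -((2 : ℝ) • e 0) := by rw [← lie_skew, he.lie_one_two]
    have h02 : ⁅e 0, e 2⁆ = -((2 : ℝ) • e 1) := by rw [← lie_skew, he.lie_two_zero]
    refine or_iff_not_imp_left.2 fun hI => ?_
    obtain ⟨x, hx, hx0⟩ : ∃ x ∈ I, x ≠ 0 := by
      by_contra! hcon
      exact hI ((LieSubmodule.eq_bot_iff _).2 hcon)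
    have hs : ∀ {c : ℝ} {y : 𝔥}, c ≠ 0 → c • y ∈ I → y ∈ I := fun {c y} hc hy => by
      have := I.smul_mem c⁻¹ hy
      rwa [smul_smul, inv_mul_cancel₀ hc, one_smul] at this
    have hn : ∀ {y : 𝔥}, -y ∈ I → y ∈ I := fun hy => neg_mem_iff.1 hy
    have two : (2 : ℝ) ≠ 0 := two_ne_zero
    -- an ideal containing one basis vector contains all
    have h0 : e 0 ∈ I → e 1 ∈ I ∧ e 2 ∈ I := fun h =>
      ⟨hs two (he.lie_two_zero ▸ lie_mem_right ℝ 𝔥 I _ _ h),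
        hs two (hn (h10 ▸ lie_mem_right ℝ 𝔥 I _ _ h))⟩
    have h1 : e 1 ∈ I → e 0 ∈ I := fun h => hs two (hn (h21 ▸ lie_mem_right ℝ 𝔥 I _ _ h))
    have h2 : e 2 ∈ I → e 0 ∈ I := fun h => hs two (he.lie_one_two ▸ lie_mem_right ℝ 𝔥 I _ _ h)
    have hx' : x = e.repr x 0 • e 0 + e.repr x 1 • e 1 + e.repr x 2 • e 2 := by
      rw [← Fin.sum_univ_three (fun i => e.repr x i • e i), e.sum_repr]
    have hmem : e 0 ∈ I := by
      by_cases c0 : e.repr x 0 = 0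
      · by_cases c1 : e.repr x 1 = 0
        · rw [c0, c1, zero_smul, zero_smul, zero_add, zero_add] at hx'
          by_cases c2 : e.repr x 2 = 0
          · rw [c2, zero_smul] at hx'
            exact absurd hx' hx0
          · exact h2 (hs c2 (hx' ▸ hx))
        · have : ⁅e 1, ⁅e 0, x⁆⁆ = (4 * e.repr x 1) • e 0 := by
            conv_lhs => rw [hx']
            simp only [lie_add, lie_smul, lie_self, smul_zero, he.lie_zero_one, h02, lie_neg,
              he.lie_one_two, zero_add, smul_neg, neg_zero, add_zero, smul_smul]
            congr 1; ring
          exact hs (mul_ne_zero four_ne_zero c1) (this ▸ lie_mem_right ℝ 𝔥 I _ _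
            (lie_mem_right ℝ 𝔥 I _ _ hx))
      · have : ⁅e 0, ⁅e 1, x⁆⁆ = (4 * e.repr x 0) • e 1 := by
          conv_lhs => rw [hx']
          simp only [lie_add, lie_smul, lie_self, smul_zero, h10, h02, lie_neg,
            he.lie_one_two, smul_neg, add_zero, smul_smul, neg_neg]
          congr 1; ring
        exact h1 (hs (mul_ne_zero four_ne_zero c0) (this ▸ lie_mem_right ℝ 𝔥 I _ _
            (lie_mem_right ℝ 𝔥 I _ _ hx)))
    refine eq_top_iff.2 fun y _ => ?_
    rw [← e.sum_repr y]
    refine sum_mem fun i _ => I.smul_mem _ ?_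
    fin_cases i
    exacts [hmem, (h0 hmem).1, (h0 hmem).2]

/-- The standard basis of `sp(1)`. -/
def sp1Basis : Module.Basis (Fin 3) ℝ sp1 :=
  Module.Basis.ofEquivFun
    { toFun := fun q => ![(q : Quaternion ℝ).imI, (q : Quaternion ℝ).imJ, (q : Quaternion ℝ).imK]
      invFun := fun v => ⟨⟨0, v 0, v 1, v 2⟩, rfl⟩
      map_add' := fun p q => by ext i; fin_cases i <;> rfl
      map_smul' := fun c q => by ext i; fin_cases i <;> rfl
      left_inv := fun q => Subtype.ext (by
        have hq : (q : Quaternion ℝ).re = 0 := q.2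
        ext <;> simp [hq])
      right_inv := fun v => by ext i; fin_cases i <;> rfl }

theorem isQuaternionic_sp1Basis : IsQuaternionic sp1Basis := by
  have h : ∀ i, (sp1Basis i : Quaternion ℝ).re = 0 ∧
      (sp1Basis i : Quaternion ℝ).imI = (Pi.single i 1 : Fin 3 → ℝ) 0 ∧
      (sp1Basis i : Quaternion ℝ).imJ = (Pi.single i 1 : Fin 3 → ℝ) 1 ∧
      (sp1Basis i : Quaternion ℝ).imK = (Pi.single i 1 : Fin 3 → ℝ) 2 := by
    intro i
    rw [sp1Basis, Module.Basis.coe_ofEquivFun]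
    exact ⟨rfl, rfl, rfl, rfl⟩
  have key : ∀ i j k : Fin 3, (i, j, k) = (0, 1, 2) ∨ (i, j, k) = (1, 2, 0) ∨ (i, j, k) = (2, 0, 1) →
      (sp1Basis i : Quaternion ℝ) * sp1Basis j - (sp1Basis j : Quaternion ℝ) * sp1Basis i =
        (2 : ℝ) • (sp1Basis k : Quaternion ℝ) := by
    intro i j k hijk
    obtain ⟨i0, i1, i2, i3⟩ := h i
    obtain ⟨j0, j1, j2, j3⟩ := h j
    obtain ⟨k0, k1, k2, k3⟩ := h k
    ext <;> simp only [Quaternion.re_sub, Quaternion.imI_sub, Quaternion.imJ_sub,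
      Quaternion.imK_sub, Quaternion.re_mul, Quaternion.imI_mul, Quaternion.imJ_mul,
      Quaternion.imK_mul, Quaternion.re_smul, Quaternion.imI_smul, Quaternion.imJ_smul,
      Quaternion.imK_smul, i0, i1, i2, i3, j0, j1, j2, j3, k0, k1, k2, k3] <;>
    rcases hijk with h | h | h <;> obtain ⟨rfl, rfl, rfl⟩ := Prod.mk.injEq .. ▸ h <;> simp <;>
    norm_num
  exact ⟨Subtype.ext (key 0 1 2 (by simp)), Subtype.ext (key 1 2 0 (by simp)),
    Subtype.ext (key 2 0 1 (by simp))⟩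

theorem nonempty_equiv_sp1_iff :
    Nonempty (𝔥 ≃ₗ⁅ℝ⁆ sp1) ↔ ∃ e : Module.Basis (Fin 3) ℝ 𝔥, IsQuaternionic e :=
  ⟨fun ⟨f⟩ => ⟨_, isQuaternionic_sp1Basis.map f.symm⟩,
    fun ⟨_, he⟩ => he.lie_equiv isQuaternionic_sp1Basis⟩

end Quaternionic

/-! ### Orthonormal bases in dimension three -/

section OrthonormalBasis

variable {V : Type*} [AddCommGroup V] [Module ℝ V] [FiniteDimensional ℝ V]

theorem exists_orthonormal_basis_three (b : LinearMap.BilinForm ℝ V) (hs : ∀ x y, b x y = b y x)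
    (hp : ∀ x, x ≠ 0 → 0 < b x x) (h3 : Module.finrank ℝ V = 3) {Z : V} (hZ : Z ≠ 0) :
    ∃ e : Module.Basis (Fin 3) ℝ V, (∀ i j, b (e i) (e j) = if i = j then 1 else 0) ∧
      ∃ r : ℝ, r ≠ 0 ∧ e 0 = r • Z := by
  let _ : NormedAddCommGroup V := (innerCore b hs hp).toNormedAddCommGroup
  let _ : InnerProductSpace ℝ V := InnerProductSpace.ofCore (innerCore b hs hp).toCore
  have hZn : ‖Z‖ ≠ 0 := norm_ne_zero_iff.2 hZ
  have ho : Orthonormal ℝ (({0} : Set (Fin 3)).domRestrict fun _ => (‖Z‖⁻¹ • Z : V)) := by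
    refine ⟨fun i => ?_, fun i j hij => absurd (Subsingleton.elim i j) hij⟩
    change ‖‖Z‖⁻¹ • Z‖ = 1
    rw [norm_smul, norm_inv, norm_norm, inv_mul_cancel₀ hZn]
  obtain ⟨e, he⟩ := ho.exists_orthonormalBasis_extension_of_card_eq (ι := Fin 3) (by simpa using h3)
  refine ⟨e.toBasis, fun i j => ?_, ‖Z‖⁻¹, inv_ne_zero hZn, ?_⟩
  · rw [OrthonormalBasis.coe_toBasis]
    exact orthonormal_iff_ite.1 e.orthonormal i j
  · rw [OrthonormalBasis.coe_toBasis]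
    exact he 0 rfl

theorem ext_of_orthonormal_basis (b : LinearMap.BilinForm ℝ V) {e : Module.Basis (Fin 3) ℝ V}
    (he : ∀ i j, b (e i) (e j) = if i = j then 1 else 0) {X Y : V}
    (h : ∀ i, b (e i) X = b (e i) Y) : X = Y := by
  have hc : ∀ (W : V) i, b (e i) W = e.repr W i := fun W i => by
    conv_lhs => rw [← e.sum_repr W, map_sum]
    simp only [map_smul, he, smul_eq_mul, mul_ite, mul_one, mul_zero, Finset.sum_ite_eq,
      Finset.mem_univ, if_true]
  exact e.ext_elem fun i => by rw [← hc, ← hc, h]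

end OrthonormalBasis

/-! ### Lie algebras with an invariant inner product -/

section InvariantForm

variable {𝔤 : Type*} [LieRing 𝔤] [LieAlgebra ℝ 𝔤] [Module.Finite ℝ 𝔤]
  (b : LinearMap.BilinForm ℝ 𝔤) (hs : ∀ x y, b x y = b y x) (hp : ∀ x, x ≠ 0 → 0 < b x x)
  (hb : ∀ x y z, b ⁅x, y⁆ z = b x ⁅y, z⁆)
include hs hp hb

/-- In an orthonormal basis the form b([x, y], z) is alternating, so in dimension three it is one
number c: every bracket is c times the third vector. Noncommutativity gives c ≠ 0, and rescaling
normalizes it. -/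
theorem exists_isQuaternionic (h3 : Module.finrank ℝ 𝔤 = 3) (hna : ∃ x y : 𝔤, ⁅x, y⁆ ≠ 0) {Z : 𝔤}
    (hZ : Z ≠ 0) : ∃ e : Module.Basis (Fin 3) ℝ 𝔤, IsQuaternionic e ∧ ∃ r : ℝ, r ≠ 0 ∧ e 0 = r • Z := by
  obtain ⟨e, he, r, hr, hrZ⟩ := exists_orthonormal_basis_three b hs hp h3 hZ
  set c := b ⁅e 0, e 1⁆ (e 2) with hc
  have hself : ∀ x y, b x ⁅x, y⁆ = 0 := fun x y => by rw [← hb, lie_self, map_zero, LinearMap.zero_apply]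
  have hself' : ∀ x y, b y ⁅x, y⁆ = 0 := fun x y => by rw [← lie_skew, map_neg, hself, neg_zero]
  have hc1 : b (e 0) ⁅e 1, e 2⁆ = c := by rw [hc, hb]
  have hc0 : b (e 2) ⁅e 0, e 1⁆ = c := hs _ _
  have hc2 : b (e 1) ⁅e 2, e 0⁆ = c := by rw [← hb, hs, hc1]
  have h01 : ⁅e 0, e 1⁆ = c • e 2 := by
    refine ext_of_orthonormal_basis b he fun i => ?_
    rw [map_smul, he]
    fin_cases i <;> simp [hself, hself', hc0]
  have h12 : ⁅e 1, e 2⁆ = c • e 0 := by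
    refine ext_of_orthonormal_basis b he fun i => ?_
    rw [map_smul, he]
    fin_cases i <;> simp [hself, hself', hc1]
  have h20 : ⁅e 2, e 0⁆ = c • e 1 := by
    refine ext_of_orthonormal_basis b he fun i => ?_
    rw [map_smul, he]
    fin_cases i <;> simp [hself, hself', hc2]
  have hc_ne : c ≠ 0 := by
    intro h0
    obtain ⟨x, y, hxy⟩ := hna
    refine hxy ?_
    rw [h0, zero_smul] at h01 h12 h20
    have h10 : ⁅e 1, e 0⁆ = 0 := by rw [← lie_skew, h01, neg_zero]
    have h21 : ⁅e 2, e 1⁆ = 0 := by rw [← lie_skew, h12, neg_zero]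
    have h02 : ⁅e 0, e 2⁆ = 0 := by rw [← lie_skew, h20, neg_zero]
    have h : (LieModule.toEnd ℝ 𝔤 𝔤 : 𝔤 →ₗ[ℝ] Module.End ℝ 𝔤) = 0 := by
      refine e.ext fun i => e.ext fun j => ?_
      change ⁅e i, e j⁆ = 0
      fin_cases i <;> fin_cases j <;> simp [h01, h12, h20, h10, h21, h02]
    exact congrArg (fun T => T x y) h
  -- Scaling the basis by λ changes the structure constant c to λc, so λ = 2/c gives the
  -- quaternionic value 2.
  have hu : IsUnit (2 / c) := (div_ne_zero two_ne_zero hc_ne).isUnit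
  have hscale : 2 / c * (2 / c * c) = 2 * (2 / c) := by field_simp
  refine ⟨e.isUnitSMul (fun _ => hu), ⟨?_, ?_, ?_⟩, 2 / c * r,
    mul_ne_zero (div_ne_zero two_ne_zero hc_ne) hr, ?_⟩
  · simp only [Module.Basis.isUnitSMul_apply, smul_lie, lie_smul, h01, smul_smul, ← hscale]
  · simp only [Module.Basis.isUnitSMul_apply, smul_lie, lie_smul, h12, smul_smul, ← hscale]
  · simp only [Module.Basis.isUnitSMul_apply, smul_lie, lie_smul, h20, smul_smul, ← hscale]
  · rw [Module.Basis.isUnitSMul_apply, hrZ, smul_smul]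

/-- Invariance gives b([X, T], [T, X]) = b(X, [T, [T, X]]) = 0, and the left side is minus the
squared length of [T, X]. -/
theorem lie_eq_zero_of_lie_lie {T X : 𝔤} (h : ⁅T, ⁅T, X⁆⁆ = 0) : ⁅T, X⁆ = 0 := by
  by_contra hne
  refine (hp _ hne).ne' ?_
  have h1 : ⁅T, X⁆ = -⁅X, T⁆ := (lie_skew _ _).symm
  have h2 : b ⁅X, T⁆ ⁅T, X⁆ = 0 := by rw [hb, h, map_zero]
  have h3 := LinearMap.congr_fun (map_neg b ⁅X, T⁆) ⁅T, X⁆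
  rw [← h1] at h3
  rw [h3, LinearMap.neg_apply, h2, neg_zero]

/-- A maximal abelian subalgebra t through Z is Cartan: if X normalizes t, then [y, [y, X]] = 0 for
y in t, so [y, X] = 0 by `lie_eq_zero_of_lie_lie`, and maximality puts X in t. Being abelian, t lies
in the centralizer of Z. -/
theorem isRegularSubalgebra_of_centralizer_le {s : LieSubalgebra ℝ 𝔤} {Z : 𝔤}
    (hZ : ∀ X, ⁅Z, X⁆ = 0 → X ∈ s.normalizer) : IsRegularSubalgebra s := by
  -- a maximal abelian subalgebra containing `Z`
  let P : LieSubalgebra ℝ 𝔤 → Prop := fun t => Z ∈ t ∧ ∀ x ∈ t, ∀ y ∈ t, ⁅x, y⁆ = 0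
  let t₀ : LieSubalgebra ℝ 𝔤 :=
    { Submodule.span ℝ {Z} with
      lie_mem' := fun {x y} hx hy => by
        obtain ⟨a, rfl⟩ := Submodule.mem_span_singleton.1 hx
        obtain ⟨c, rfl⟩ := Submodule.mem_span_singleton.1 hy
        simp }
  have ht₀ : P t₀ := by
    refine ⟨Submodule.mem_span_singleton_self Z, fun x hx y hy => ?_⟩
    obtain ⟨a, rfl⟩ := Submodule.mem_span_singleton.1 hx
    obtain ⟨c, rfl⟩ := Submodule.mem_span_singleton.1 hy
    simp
  obtain ⟨t, -, ht⟩ := exists_maximal_ge_of_wellFoundedGT P t₀ ht₀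
  have hmax : ∀ X, (∀ y ∈ t, ⁅y, X⁆ = 0) → X ∈ t := by
    intro X hX
    have hX' : ∀ y ∈ t, ⁅X, y⁆ = 0 := fun y hy => by rw [← lie_skew, hX y hy, neg_zero]
    have hab : ∀ x ∈ t.toSubmodule ⊔ Submodule.span ℝ {X}, ∀ y ∈ t.toSubmodule ⊔ Submodule.span ℝ {X},
        ⁅x, y⁆ = 0 := by
      intro x hx y hy
      obtain ⟨x, hxt, _, hx', rfl⟩ := Submodule.mem_sup.1 hx
      obtain ⟨a, rfl⟩ := Submodule.mem_span_singleton.1 hx'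
      obtain ⟨y, hyt, _, hy', rfl⟩ := Submodule.mem_sup.1 hy
      obtain ⟨c, rfl⟩ := Submodule.mem_span_singleton.1 hy'
      simp [ht.prop.2 x hxt y hyt, hX x hxt, hX' y hyt]
    let t' : LieSubalgebra ℝ 𝔤 :=
      { t.toSubmodule ⊔ Submodule.span ℝ {X} with
        lie_mem' := fun {x y} hx hy => by
          rw [hab x hx y hy]
          exact Submodule.zero_mem _ }
    have h1 : t ≤ t' := fun x hx => Submodule.mem_sup_left hx
    exact ht.le_of_ge (y := t') ⟨h1 ht.prop.1, hab⟩ h1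
      (Submodule.mem_sup_right (Submodule.mem_span_singleton_self X))
  refine ⟨t, ⟨?_, le_antisymm (fun X hX => ?_) t.le_normalizer⟩, fun X hX => hZ X ?_⟩
  · have : IsLieAbelian t := ⟨fun x y => Subtype.ext (ht.prop.2 x x.2 y y.2)⟩
    infer_instance
  · refine hmax X fun y hy => lie_eq_zero_of_lie_lie b hs hp hb (ht.prop.2 y hy _ ?_)
    exact (t.mem_normalizer_iff' X).1 hX y hy
  · exact ht.prop.2 Z ht.prop.1 X hX

end InvariantForm

end HomogeneousLorentz

namespace HomogeneousLorentz

/-! ### Orthogonality of a quaternionic subalgebra and its centralizer -/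

section CommutingForms

variable {𝔤 : Type*} [LieRing 𝔤] [LieAlgebra ℝ 𝔤]

/-- Every basis vector of s is a multiple of a bracket, and b(A, [x, y]) = b([A, x], y) = 0. -/
theorem IsQuaternionic.form_eq_zero_of_commute {b : LinearMap.BilinForm ℝ 𝔤}
    (hb : ∀ x y z, b ⁅x, y⁆ z = b x ⁅y, z⁆) {s : LieSubalgebra ℝ 𝔤} {e : Module.Basis (Fin 3) ℝ s}
    (he : IsQuaternionic e) {A : 𝔤} (hA : ∀ Y ∈ s, ⁅Y, A⁆ = 0) {X : 𝔤} (hX : X ∈ s) :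
    b A X = 0 := by
  have hbr : ∀ x y : s, b A (⁅x, y⁆ : s) = 0 := fun x y => by
    rw [LieSubalgebra.coe_bracket, ← hb, ← lie_skew, hA x x.2, neg_zero, map_zero,
      LinearMap.zero_apply]
  have hsm : ∀ i (x y : s), ⁅x, y⁆ = (2 : ℝ) • e i → b A (e i) = 0 := fun i x y h => by
    have h1 := hbr x y
    have h2 : ((⁅x, y⁆ : s) : 𝔤) = (2 : ℝ) • (e i : 𝔤) := congrArg Subtype.val h
    rw [h2, map_smul] at h1
    exact (smul_eq_zero.1 h1).resolve_left two_ne_zero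
  have hall : (b A) ∘ₗ s.toSubmodule.subtype = 0 := by
    refine e.ext fun i => ?_
    fin_cases i
    exacts [hsm 0 _ _ he.lie_one_two, hsm 1 _ _ he.lie_two_zero, hsm 2 _ _ he.lie_zero_one]
  exact congrArg (fun T => T ⟨X, hX⟩) hall

end CommutingForms

/-! ### Identity components of subgroups -/

section IdentityComponent

variable {G : Type*} [TopologicalSpace G] [Group G] [IsTopologicalGroup G]

/-- The identity component of a subgroup. -/
def identityComponent (C : Subgroup G) : Subgroup G :=
  (Subgroup.connectedComponentOfOne C).map C.subtype

theorem coe_identityComponent (C : Subgroup G) :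
    (identityComponent C : Set G) = connectedComponentIn (C : Set G) 1 := by
  rw [connectedComponentIn_eq_image (C.one_mem)]
  rfl

theorem identityComponent_le (C : Subgroup G) : identityComponent C ≤ C :=
  Subgroup.map_subtype_le _

theorem isConnected_identityComponent (C : Subgroup G) :
    IsConnected (identityComponent C : Set G) := by
  rw [coe_identityComponent]
  exact isConnected_connectedComponentIn_iff.2 C.one_mem

theorem isClosed_identityComponent {C : Subgroup G} (hC : IsClosed (C : Set G)) :
    IsClosed (identityComponent C : Set G) :=
  hC.isClosedEmbedding_subtypeVal.isClosedMap _ isClosed_connectedComponent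

end IdentityComponent

/-! ### Centralizers in the group and in the Lie algebra -/

section Centralizers

variable {n : ℕ} {G : Type*} [TopologicalSpace G] [ChartedSpace (EuclideanSpace ℝ (Fin n)) G]
  [Group G] [LieGroup (𝓡 n) ∞ G]

/-- The centralizer of a set of Lie algebra elements, as a subgroup. -/
def centralizerSubgroup (S : Set (LieAlg n G)) : Subgroup G where
  carrier := groupCentralizer S
  one_mem' X _ := Ad_one X
  mul_mem' {a b} ha hb X hX := by
    rw [Ad_mul, hb X hX, ha X hX]
  inv_mem' {a} ha X hX := by
    conv_lhs => rw [← ha X hX]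
    exact Ad_inv_Ad a X

theorem mem_centralizerSubgroup {S : Set (LieAlg n G)} {a : G} :
    a ∈ centralizerSubgroup S ↔ ∀ X ∈ S, Ad a X = X := Iff.rfl

theorem isClosed_setOf_Ad_eq (X : Model n) : IsClosed {a : G | adjointCLM n a X = X} :=
  isClosed_eq ((continuous_adjointCLM n G).clm_apply continuous_const) continuous_const

theorem isClosed_centralizerSubgroup (S : Set (LieAlg n G)) :
    IsClosed (centralizerSubgroup S : Set G) := by
  have h : (centralizerSubgroup S : Set G) = ⋂ X ∈ S, {a : G | Ad a X = X} := by
    ext a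
    simp only [SetLike.mem_coe, mem_centralizerSubgroup, mem_iInter, mem_ofPred_eq]
  rw [h]
  exact isClosed_biInter fun X _ => isClosed_setOf_Ad_eq (n := n) X

variable (hG : LieAlgebra.IsSimple ℝ (LieAlg n G))
include hG

/-- A one-parameter subgroup of C is connected and passes through 1, so it stays in the identity
component. -/
theorem lie_identityComponent [IsTopologicalGroup G] {C : Subgroup G} (hC : IsClosed (C : Set G)) :
    lie (n := n) (identityComponent C) = lie C := by
  refine le_antisymm (lie_mono (identityComponent_le C)) fun X hX => ?_
  rw [mem_lie_iff hG (isClosed_identityComponent hC)]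
  intro t
  have h1 : IsPreconnected (range fun t : ℝ => expG (t • X) : Set G) :=
    isPreconnected_range (continuous_expM_smul (n := n) X)
  have h2 : (range fun t : ℝ => expG (t • X) : Set G) ⊆ connectedComponentIn (C : Set G) 1 := by
    refine h1.subset_connectedComponentIn ⟨0, ?_⟩ ?_
    · change expG ((0 : ℝ) • X) = 1
      rw [zero_smul, expG_zero]
    · rintro _ ⟨t, rfl⟩
      exact (mem_lie_iff hG hC).1 hX t
  rw [← coe_identityComponent] at h2
  exact h2 ⟨t, rfl⟩

theorem lie_centralizerSubgroup (S : Set (LieAlg n G)) :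
    lie (centralizerSubgroup S) = centralizer S := by
  ext X
  rw [mem_lie_iff hG (isClosed_centralizerSubgroup S)]
  have hsk : ∀ Y : LieAlg n G, ⁅X, Y⁆ = 0 ↔ ⁅Y, X⁆ = 0 := fun Y => by
    rw [← lie_skew, neg_eq_zero]
  refine ⟨fun h Y hY => (hsk Y).1 (lie_eq_zero_of_Ad fun t => h t Y hY), fun h t Y hY => ?_⟩
  refine Ad_expG_eq_self ?_
  rw [smul_lie, (hsk Y).2 (h Y hY), smul_zero]

end Centralizers

/-! ### Consequences of a special decomposition -/

section SpecialType

variable {n : ℕ} {G : Type*} [TopologicalSpace G] [ChartedSpace (EuclideanSpace ℝ (Fin n)) G]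
  [Group G] [LieGroup (𝓡 n) ∞ G] {L : Subgroup G} {m m' : Submodule ℝ (LieAlg n G)}
  {s : LieSubalgebra ℝ (LieAlg n G)}

theorem IsSpecialDecomposition.le (h : IsSpecialDecomposition L m m' s) : s.toSubmodule ≤ m :=
  h.sup_eq ▸ le_sup_left

theorem IsSpecialDecomposition.lie_eq_zero (h : IsSpecialDecomposition L m m' s)
    {A Y : LieAlg n G} (hA : A ∈ lie L) (hY : Y ∈ s) : ⁅Y, A⁆ = 0 := by
  rw [← h.centralizer_eq] at hA
  exact hA Y hY

theorem IsSpecialDecomposition.lie_eq_zero' (h : IsSpecialDecomposition L m m' s)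
    {A Y : LieAlg n G} (hA : A ∈ lie L) (hY : Y ∈ s) : ⁅A, Y⁆ = 0 := by
  rw [← lie_skew, h.lie_eq_zero hA hY, neg_zero]

theorem IsSpecialDecomposition.negKilling_eq_zero (h : IsSpecialDecomposition L m m' s)
    {A Y : LieAlg n G} (hA : A ∈ lie L) (hY : Y ∈ s) : negKilling n G Y A = 0 := by
  obtain ⟨e, he⟩ := nonempty_equiv_sp1_iff.1 h.iso_sp1
  rw [negKilling_comm]
  exact he.form_eq_zero_of_commute negKilling_lie (fun Y hY => h.lie_eq_zero hA hY) hY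

theorem IsSpecialDecomposition.exists_of_lie_eq_zero (h : IsSpecialDecomposition L m m' s)
    {X Z : LieAlg n G} (hZ : Z ∈ s) (hZ0 : Z ≠ 0) (hX : ⁅Z, X⁆ = 0) :
    ∃ A ∈ lie L, ∃ c : ℝ, X = A + c • Z := by
  have h1 : X ∈ centralizer {Z} := fun Y hY => by rw [mem_singleton_iff.1 hY, hX]
  rw [h.centralizer_singleton Z hZ hZ0] at h1
  obtain ⟨A, hA, _, hc, rfl⟩ := Submodule.mem_sup.1 h1
  obtain ⟨c, rfl⟩ := Submodule.mem_span_singleton.1 hc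
  exact ⟨A, hA, c, rfl⟩

theorem IsSpecialDecomposition.exists_ne_zero (h : IsSpecialDecomposition L m m' s) :
    ∃ Z ∈ s, Z ≠ 0 := by
  obtain ⟨e, -⟩ := nonempty_equiv_sp1_iff.1 h.iso_sp1
  exact ⟨e 0, (e 0).2, fun h0 => e.ne_zero 0 (Subtype.ext h0)⟩

theorem IsReductiveDecomposition.exists_add (h : IsReductiveDecomposition L m) (X : LieAlg n G) :
    ∃ A ∈ lie L, ∃ Y ∈ m, X = A + Y := by
  obtain ⟨A, hA, Y, hY, rfl⟩ := Submodule.mem_sup.1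
    (show X ∈ lie L ⊔ m by rw [h.1.sup_eq_top]; trivial)
  exact ⟨A, hA, Y, hY, rfl⟩

variable [CompactSpace G] [ConnectedSpace G] (hG : LieAlgebra.IsSimple ℝ (LieAlg n G))
include hG

/-- In C(Z) = 𝔩 + ℝZ the two summands are orthogonal, so a vector orthogonal to Z has no
Z-component. Minimality and the contact condition both reduce to this. -/
theorem IsSpecialDecomposition.mem_lie (h : IsSpecialDecomposition L m m' s) {X Z : LieAlg n G}
    (hZ : Z ∈ s) (hZ0 : Z ≠ 0) (hX : ⁅Z, X⁆ = 0) (hZX : negKilling n G Z X = 0) : X ∈ lie L := by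
  obtain ⟨A, hA, c, rfl⟩ := h.exists_of_lie_eq_zero hZ hZ0 hX
  rw [map_add, h.negKilling_eq_zero hA hZ, zero_add, map_smul, smul_eq_mul] at hZX
  rw [(mul_eq_zero.1 hZX).resolve_right (negKilling_pos hG hZ0).ne', zero_smul, add_zero]
  exact hA

theorem IsSpecialDecomposition.isRegularSubalgebra (h : IsSpecialDecomposition L m m' s) :
    IsRegularSubalgebra s := by
  obtain ⟨Z, hZ, hZ0⟩ := h.exists_ne_zero
  refine isRegularSubalgebra_of_centralizer_le (negKilling n G) negKilling_comm
    (fun X hX => negKilling_pos hG hX) negKilling_lie (Z := Z) fun X hX => ?_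
  obtain ⟨A, hA, c, rfl⟩ := h.exists_of_lie_eq_zero hZ hZ0 hX
  rw [LieSubalgebra.mem_normalizer_iff]
  intro Y hY
  rw [add_lie, h.lie_eq_zero' hA hY, zero_add]
  exact s.lie_mem (s.smul_mem c hZ) hY

theorem IsSpecialDecomposition.isTypeIb (h : IsSpecialDecomposition L m m' s) : IsTypeIb n L := by
  obtain ⟨e, he⟩ := nonempty_equiv_sp1_iff.1 h.iso_sp1
  refine ⟨m, h.reductive, s, h.fixed_eq.symm, ?_, he.isSimple, h.isRegularSubalgebra hG⟩
  rw [Module.finrank_eq_card_basis e, Fintype.card_fin]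

/-- Bracketing with 𝔩 preserves both summands of 𝔩 ⊕ 𝔪, so the 𝔪-component of a fixed vector is
itself fixed. -/
theorem IsReductiveDecomposition.mem_fixed (hL : IsClosed (L : Set G))
    (h : IsReductiveDecomposition L m) {A Y : LieAlg n G} (hA : A ∈ lie L) (hY : Y ∈ m)
    (hfix : ∀ X ∈ lie (n := n) L, ⁅X, A + Y⁆ = 0) : Y ∈ fixed L m := by
  refine ⟨hY, fun X hX => ?_⟩
  have h1 : ⁅X, A⁆ ∈ lie L := lie_mem_of_isAdInvariant hG hL (isAdInvariant_lie L) hX hA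
  have h2 : ⁅X, Y⁆ ∈ m := lie_mem_of_isAdInvariant hG hL h.2 hX hY
  have h3 := hfix X hX
  rw [lie_add, add_eq_zero_iff_neg_eq] at h3
  exact (Submodule.disjoint_def.1 h.1.disjoint) _ (h3 ▸ (lie L).neg_mem h1) h2

theorem IsSpecialDecomposition.isMinimalAdmissible (hL : IsClosed (L : Set G))
    (hL' : IsConnected (L : Set G)) (h : IsSpecialDecomposition L m m' s) :
    IsMinimalAdmissible n L := by
  obtain ⟨Z, hZ, hZ0⟩ := h.exists_ne_zero
  refine ⟨isAdmissible_of_fixed hG hL hL' (Z := Z) (fun hmem => hZ0 ?_)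
    (fun X hX => h.lie_eq_zero' hX hZ), fun K hK hLK => not_lt.2 ?_⟩
  · exact (Submodule.disjoint_def.1 h.reductive.1.disjoint) _ hmem (h.le hZ)
  obtain ⟨Z', hZ'0, hZK, hfix⟩ := hK.exists_fixed hG
  obtain ⟨A, hA, Y, hY, rfl⟩ := IsReductiveDecomposition.exists_add h.reductive Z'
  have hLK' : lie (n := n) L ≤ lie K := lie_mono hLK
  have hYs : Y ∈ s := by
    have := IsReductiveDecomposition.mem_fixed hG hL h.reductive hA hY fun X hX => hfix X (hLK' hX)
    rw [h.fixed_eq] at this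
    exact this
  -- The fixed vector A + Y of K is orthogonal to Lie(K), in particular to A, while Y in 𝔰 is
  -- already orthogonal to A in 𝔩.
  have hA0 : A = 0 := by
    by_contra hne
    have h1 := hZK A (hLK' hA)
    rw [map_add, LinearMap.add_apply, h.negKilling_eq_zero hA hYs, add_zero] at h1
    exact (negKilling_pos hG hne).ne' h1
  rw [hA0, zero_add] at hZ'0 hZK hfix
  have hle : lie (n := n) K ≤ lie L := fun X hX => by
    refine h.mem_lie hG hYs hZ'0 ?_ (hZK X hX)
    rw [← lie_skew, hfix X hX, neg_zero]
  exact Submodule.finrank_mono hle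

/-- Both sides are closed connected subgroups with Lie algebra C(𝔰) = 𝔩, and such a subgroup is
determined by its Lie algebra. -/
theorem IsSpecialDecomposition.coe_eq (hL : IsClosed (L : Set G))
    (hL' : IsConnected (L : Set G)) (h : IsSpecialDecomposition L m m' s) :
    (L : Set G) = connectedComponentIn (groupCentralizer (s : Set (LieAlg n G))) 1 := by
  have hT := isTopologicalGroup_of_lieGroup n G
  have hC := isClosed_centralizerSubgroup (s : Set (LieAlg n G))
  have h1 : lie (n := n) L = lie (identityComponent (centralizerSubgroup (s : Set (LieAlg n G)))) := by
    rw [lie_identityComponent hG hC, lie_centralizerSubgroup hG, h.centralizer_eq]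
  have h2 : L = identityComponent (centralizerSubgroup (s : Set (LieAlg n G))) :=
    le_antisymm (le_of_lie_le hG hL hL' (isClosed_identityComponent hC) h1.le)
      (le_of_lie_le hG (isClosed_identityComponent hC) (isConnected_identityComponent _) hL h1.ge)
  exact (congrArg SetLike.coe h2).trans (coe_identityComponent _)

theorem IsSpecialDecomposition.isInvariantContactStructure (hL : IsClosed (L : Set G))
    (hL' : IsConnected (L : Set G)) (h : IsSpecialDecomposition L m m' s) {Z : LieAlg n G}
    (hZ : Z ∈ s) (hZ0 : Z ≠ 0) :
    IsInvariantContactStructure L (lie L ⊔ (m ⊓ killingPerp Z)) := by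
  have hmem : ∀ X, X ∈ killingPerp Z ↔ negKilling n G Z X = 0 := fun X => by
    rw [negKilling_apply, neg_eq_zero]
    exact LinearMap.mem_ker
  -- Since 𝔩 is orthogonal to Z, the hyperplane is the full orthogonal complement of Z in 𝔤.
  have hd : lie L ⊔ (m ⊓ killingPerp Z) = killingPerp Z := by
    refine le_antisymm (sup_le (fun A hA => (hmem A).2 (h.negKilling_eq_zero hA hZ)) inf_le_right)
      fun X hX => ?_
    obtain ⟨A, hA, Y, hY, rfl⟩ := IsReductiveDecomposition.exists_add h.reductive X
    refine Submodule.add_mem_sup hA ⟨hY, ?_⟩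
    rw [hmem, map_add, h.negKilling_eq_zero hA hZ, zero_add] at hX
    exact (hmem Y).2 hX
  refine ⟨le_sup_left, ?_, ?_, ?_⟩
  · rw [hd]
    intro a ha X hX
    have hfix := (Ad_eq_self_iff hG hL hL').2 (fun X hX => h.lie_eq_zero' hX hZ) a ha
    rw [hmem] at hX ⊢
    rw [← hfix, negKilling_Ad hG, hX]
  · rw [hd]
    refine Module.Dual.finrank_ker_add_one_of_ne_zero (f := killingForm ℝ (LieAlg n G) Z) fun h0 => ?_
    have h1 := killingForm_neg hG hZ0
    rw [h0] at h1
    exact lt_irrefl _ h1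
  · rw [hd]
    intro X hX hXd
    rw [hmem] at hX
    refine h.mem_lie hG hZ hZ0 ?_ hX
    by_contra hne
    -- The Levi form is tested on Y = [Z, X]: invariance gives b(Z, [X, [Z, X]]) = b([Z, X], [Z,
    -- X]).
    have h1 : ⁅Z, X⁆ ∈ killingPerp Z := by
      rw [hmem, ← negKilling_lie, lie_self, map_zero, LinearMap.zero_apply]
    have h2 := hXd _ h1
    rw [hmem, ← negKilling_lie] at h2
    exact (negKilling_pos hG hne).ne' h2

end SpecialType

end HomogeneousLorentz

namespace HomogeneousLorentz

/-! ### Determinants of maps commuting with an antilinear one -/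

section SemilinearDet

variable {V : Type*} [AddCommGroup V] [Module ℂ V] [FiniteDimensional ℂ V]

/-- The determinant of an endomorphism that commutes with an antilinear automorphism is real. -/
theorem conj_det_of_commute_antilinear (A : V →ₗ[ℂ] V) (τ : V →ₛₗ[starRingEnd ℂ] V)
    (hτ : Function.Injective τ) (h : ∀ v, A (τ v) = τ (A v)) :
    starRingEnd ℂ (LinearMap.det A) = LinearMap.det A := by
  let β := Module.finBasis ℂ V
  have hli : LinearIndependent ℂ fun i => τ (β i) := by
    rw [Fintype.linearIndependent_iff]
    intro g hg i
    have h1 : τ (∑ j, starRingEnd ℂ (g j) • β j) = 0 := by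
      rw [map_sum, ← hg]
      exact Finset.sum_congr rfl fun j _ => by rw [map_smulₛₗ, Complex.conj_conj]
    have h2 := Fintype.linearIndependent_iff.1 β.linearIndependent _
      (hτ (h1.trans (map_zero τ).symm)) i
    exact (map_eq_zero_iff _ (starRingEnd ℂ).injective).1 h2
  let γ := basisOfLinearIndependentOfCardEqFinrank' _ hli (by simp)
  have hγ : ∀ i, γ i = τ (β i) := fun i => by
    rw [coe_basisOfLinearIndependentOfCardEqFinrank']
  -- In the image basis under τ the matrix of A is the complex conjugate of its matrix in the
  -- original basis, and the determinant does not depend on the basis.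
  have hM : LinearMap.toMatrix γ γ A = (LinearMap.toMatrix β β A).map (starRingEnd ℂ) := by
    ext i j
    rw [LinearMap.toMatrix_apply, Matrix.map_apply, LinearMap.toMatrix_apply]
    have h1 : A (γ j) = ∑ i, starRingEnd ℂ (β.repr (A (β j)) i) • γ i := by
      rw [hγ, h]
      conv_lhs => rw [← β.sum_repr (A (β j)), map_sum]
      exact Finset.sum_congr rfl fun i _ => by rw [map_smulₛₗ, hγ]
    rw [h1, γ.repr_sum_self]
  conv_lhs => rw [← LinearMap.det_toMatrix β A, RingHom.map_det]
  conv_rhs => rw [← LinearMap.det_toMatrix γ A, hM]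
  rfl

end SemilinearDet

/-! ### Exponentials acting as rotations -/

section RotationFormula

/-- On the span of U and AU the operator A turns with angular speed 2. Undoing the rotation gives a
vector whose image under exp(tA) is constant in t; this yields two linear relations, for U and for
AU, which are solved using sin² + cos² = 1. -/
theorem exp_smul_apply_of_sq {E : Type*} [NormedAddCommGroup E] [NormedSpace ℝ E] [CompleteSpace E]
    {A : E →L[ℝ] E} {U : E} (hU : A (A U) = (-4 : ℝ) • U) (t : ℝ) :
    NormedSpace.exp (t • A) U = Real.cos (2 * t) • U + (Real.sin (2 * t) / 2) • A U := by
  have key : ∀ U : E, A (A U) = (-4 : ℝ) • U → NormedSpace.exp (t • A)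
      (Real.cos (2 * t) • U - (Real.sin (2 * t) / 2) • A U) = U := by
    intro U hU
    have hd : ∀ s : ℝ, HasDerivAt (fun s : ℝ => NormedSpace.exp (s • A)
        (Real.cos (2 * s) • U - (Real.sin (2 * s) / 2) • A U)) 0 s := by
      intro s
      have h2 : HasDerivAt (fun s : ℝ => 2 * s) 2 s := by
        simpa using (hasDerivAt_id s).const_mul (2 : ℝ)
      have hc := h2.cos.smul_const U
      have hs := (h2.sin.div_const 2).smul_const (A U)
      have h1 := (hasDerivAt_exp_smul_const (𝕂 := ℝ) A s).clm_apply (hc.sub hs)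
      refine h1.congr_deriv ?_
      change NormedSpace.exp (s • A) (A (Real.cos (2 * s) • U - (Real.sin (2 * s) / 2) • A U)) +
        NormedSpace.exp (s • A) _ = 0
      rw [← map_add, map_sub, map_smul, map_smul, hU]
      refine (congrArg _ ?_).trans (map_zero (NormedSpace.exp (s • A)))
      module
    have := is_const_of_deriv_eq_zero (fun s => (hd s).differentiableAt) (fun s => (hd s).deriv) t 0
    simpa [NormedSpace.exp_zero] using this
  have h1 := key U hU
  have h2 := key (A U) (by rw [hU, map_smul])
  rw [hU] at h2
  rw [map_sub, map_smul, map_smul] at h1 h2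
  rw [map_smul] at h2
  have hcs := Real.sin_sq_add_cos_sq (2 * t)
  set P := NormedSpace.exp (t • A) U
  set Q := NormedSpace.exp (t • A) (A U)
  calc P = (Real.sin (2 * t) ^ 2 + Real.cos (2 * t) ^ 2) • P := by rw [hcs, one_smul]
    _ = Real.cos (2 * t) • (Real.cos (2 * t) • P - (Real.sin (2 * t) / 2) • Q) +
        (Real.sin (2 * t) / 2) • (Real.cos (2 * t) • Q - (Real.sin (2 * t) / 2) • (-4 : ℝ) • P) := by
      module
    _ = _ := by rw [h1, h2]

variable {n : ℕ} {G : Type*} [TopologicalSpace G] [ChartedSpace (EuclideanSpace ℝ (Fin n)) G]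
  [Group G] [LieGroup (𝓡 n) ∞ G]

theorem adjointCLM_expM_rotation {X U : Model n}
    (hU : modelBracket G X (modelBracket G X U) = (-4 : ℝ) • U) (t : ℝ) :
    adjointCLM n (expM G (t • X)) U =
      Real.cos (2 * t) • U + (Real.sin (2 * t) / 2) • modelBracket G X U := by
  rw [adjointCLM_expM, map_smul, ← adCLM_apply]
  refine exp_smul_apply_of_sq ?_ t
  rw [adCLM_apply, adCLM_apply, hU]

theorem Ad_expG_rotation {X U : LieAlg n G} (hU : ⁅X, ⁅X, U⁆⁆ = (-4 : ℝ) • U) (t : ℝ) :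
    Ad (expG (t • X)) U = Real.cos (2 * t) • U + (Real.sin (2 * t) / 2) • ⁅X, U⁆ :=
  adjointCLM_expM_rotation (G := G) (X := X) (U := U) hU t

theorem adjointCLM_comm_expM {a : G} {X : Model n} (h : adjointCLM n a X = X) (U : Model n) :
    adjointCLM n a (adjointCLM n (expM G X) U) = adjointCLM n (expM G X) (adjointCLM n a U) := by
  have hc : Commute (adjointCLM n a) (adCLM G X) := by
    refine ContinuousLinearMap.ext fun Y => ?_
    change adjointCLM n a (adCLM G X Y) = adCLM G X (adjointCLM n a Y)
    rw [adCLM_apply, adCLM_apply, adjointCLM_modelBracket, h]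
  have h1 := hc.exp_right
  rw [← adjointCLM_expM] at h1
  exact congrArg (fun T : Model n →L[ℝ] Model n => T U) h1

theorem Ad_comm_expG {a : G} {X : LieAlg n G} (h : Ad a X = X) (U : LieAlg n G) :
    Ad a (Ad (expG X) U) = Ad (expG X) (Ad a U) :=
  adjointCLM_comm_expM (n := n) (X := X) h U

theorem modelBracket_jacobi (X Y U : Model n) (h : modelBracket G X Y = 0) :
    modelBracket G X (modelBracket G Y U) = modelBracket G Y (modelBracket G X U) := by
  have key : ∀ X Y U : LieAlg n G, ⁅X, Y⁆ = 0 → ⁅X, ⁅Y, U⁆⁆ = ⁅Y, ⁅X, U⁆⁆ := by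
    intro X Y U h
    rw [leibniz_lie, h, zero_lie, zero_add]
  exact key X Y U h

theorem adjointCLM_expM_add {X Y : Model n} (h : modelBracket G X Y = 0) :
    adjointCLM n (expM G (X + Y)) =
      (adjointCLM n (expM G X)).comp (adjointCLM n (expM G Y)) := by
  have hc : Commute (adCLM G X) (adCLM G Y) := by
    refine ContinuousLinearMap.ext fun U => ?_
    change adCLM G X (adCLM G Y U) = adCLM G Y (adCLM G X U)
    simp only [adCLM_apply]
    exact modelBracket_jacobi X Y U h
  let _ : NormedAlgebra ℚ (Model n →L[ℝ] Model n) := NormedAlgebra.restrictScalars ℚ ℝ _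
  rw [adjointCLM_expM, map_add, NormedSpace.exp_add_of_commute hc, ← adjointCLM_expM,
    ← adjointCLM_expM]
  rfl

theorem Ad_expG_add {X Y : LieAlg n G} (h : ⁅X, Y⁆ = 0) (U : LieAlg n G) :
    Ad (expG (X + Y)) U = Ad (expG X) (Ad (expG Y) U) :=
  congrArg (fun T : Model n →L[ℝ] Model n => T U)
    (adjointCLM_expM_add (G := G) (X := X) (Y := Y) h)

end RotationFormula

/-! ### The complex space where (ad Z)² = -4 -/

section RotSpace

variable {𝔤 : Type*} [LieRing 𝔤] [LieAlgebra ℝ 𝔤]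

/-- The subspace on which `(ad Z)² = -4`. -/
def rotSubmodule (Z : 𝔤) : Submodule ℝ 𝔤 where
  carrier := {U | ⁅Z, ⁅Z, U⁆⁆ = (-4 : ℝ) • U}
  zero_mem' := by simp
  add_mem' {U V} hU hV := by
    change ⁅Z, ⁅Z, U + V⁆⁆ = (-4 : ℝ) • (U + V)
    rw [lie_add, lie_add, hU, hV, smul_add]
  smul_mem' c U hU := by
    change ⁅Z, ⁅Z, c • U⁆⁆ = (-4 : ℝ) • (c • U)
    rw [lie_smul, lie_smul, hU, smul_comm]

theorem mem_rotSubmodule {Z U : 𝔤} : U ∈ rotSubmodule Z ↔ ⁅Z, ⁅Z, U⁆⁆ = (-4 : ℝ) • U := Iff.rfl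

theorem lie_mem_rotSubmodule {Z U : 𝔤} (hU : U ∈ rotSubmodule Z) : ⁅Z, U⁆ ∈ rotSubmodule Z := by
  rw [mem_rotSubmodule] at *
  rw [hU, lie_smul]

/-- The subspace on which `(ad Z)² = -4`, as a complex vector space with complex structure
`ad Z / 2`. -/
def RotSpace (Z : 𝔤) : Type _ := rotSubmodule Z

variable {Z : 𝔤}

instance : AddCommGroup (RotSpace Z) := inferInstanceAs (AddCommGroup (rotSubmodule Z))

/-- The underlying vector. -/
def RotSpace.val (U : RotSpace Z) : 𝔤 := Subtype.val (p := (· ∈ rotSubmodule Z)) U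

theorem RotSpace.lie_lie (U : RotSpace Z) : ⁅Z, ⁅Z, U.val⁆⁆ = (-4 : ℝ) • U.val :=
  Subtype.property (p := (· ∈ rotSubmodule Z)) U

theorem RotSpace.ext {U V : RotSpace Z} (h : U.val = V.val) : U = V := Subtype.ext h

/-- A vector with `(ad Z)² U = -4 U`, as an element of the complex vector space. -/
def RotSpace.mk (U : 𝔤) (hU : U ∈ rotSubmodule Z) : RotSpace Z := ⟨U, hU⟩

instance : Module ℂ (RotSpace Z) where
  smul z U := RotSpace.mk (z.re • U.val + (z.im / 2) • ⁅Z, U.val⁆)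
    (add_mem (Submodule.smul_mem _ _ U.lie_lie)
      (Submodule.smul_mem _ _ (lie_mem_rotSubmodule U.lie_lie)))
  one_smul U := RotSpace.ext (by
    change (1 : ℂ).re • U.val + ((1 : ℂ).im / 2) • ⁅Z, U.val⁆ = U.val
    simp)
  mul_smul z w U := RotSpace.ext (by
    change (z * w).re • U.val + ((z * w).im / 2) • ⁅Z, U.val⁆ =
      z.re • (w.re • U.val + (w.im / 2) • ⁅Z, U.val⁆) +
        (z.im / 2) • ⁅Z, w.re • U.val + (w.im / 2) • ⁅Z, U.val⁆⁆
    rw [lie_add, lie_smul, lie_smul, U.lie_lie, Complex.mul_re, Complex.mul_im]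
    module)
  smul_zero z := RotSpace.ext (by
    change z.re • (0 : 𝔤) + (z.im / 2) • ⁅Z, (0 : 𝔤)⁆ = 0
    simp)
  smul_add z U V := RotSpace.ext (by
    change z.re • (U.val + V.val) + (z.im / 2) • ⁅Z, U.val + V.val⁆ =
      (z.re • U.val + (z.im / 2) • ⁅Z, U.val⁆) + (z.re • V.val + (z.im / 2) • ⁅Z, V.val⁆)
    rw [lie_add]
    module)
  add_smul z w U := RotSpace.ext (by
    change (z + w).re • U.val + ((z + w).im / 2) • ⁅Z, U.val⁆ =
      (z.re • U.val + (z.im / 2) • ⁅Z, U.val⁆) + (w.re • U.val + (w.im / 2) • ⁅Z, U.val⁆)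
    rw [Complex.add_re, Complex.add_im]
    module)
  zero_smul U := RotSpace.ext (by
    change (0 : ℂ).re • U.val + ((0 : ℂ).im / 2) • ⁅Z, U.val⁆ = 0
    simp)

theorem RotSpace.val_smul (z : ℂ) (U : RotSpace Z) :
    (z • U).val = z.re • U.val + (z.im / 2) • ⁅Z, U.val⁆ := rfl

variable (Z) in
/-- The inclusion of the complex vector space in the Lie algebra. -/
def RotSpace.incl : RotSpace Z →ₗ[ℝ] 𝔤 where
  toFun := RotSpace.val
  map_add' _ _ := rfl
  map_smul' r U := by
    rw [← Complex.coe_smul r U, RotSpace.val_smul]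
    simp

theorem RotSpace.incl_injective : Function.Injective (RotSpace.incl Z) := fun _ _ h => RotSpace.ext h

instance [Module.Finite ℝ 𝔤] : FiniteDimensional ℂ (RotSpace Z) := by
  have : FiniteDimensional ℝ (RotSpace Z) :=
    FiniteDimensional.of_injective (RotSpace.incl Z) RotSpace.incl_injective
  exact FiniteDimensional.right ℝ ℂ (RotSpace Z)

/-- A map that commutes with `ad Z` acts complex linearly. -/
def RotSpace.map (A : 𝔤 →ₗ[ℝ] 𝔤) (hA : ∀ U, A ⁅Z, U⁆ = ⁅Z, A U⁆) : RotSpace Z →ₗ[ℂ] RotSpace Z where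
  toFun U := RotSpace.mk (A U.val) (by rw [mem_rotSubmodule, ← hA, ← hA, U.lie_lie, map_smul])
  map_add' U V := RotSpace.ext (map_add A _ _)
  map_smul' z U := RotSpace.ext (by
    change A (z.re • U.val + (z.im / 2) • ⁅Z, U.val⁆) =
      z.re • A U.val + (z.im / 2) • ⁅Z, A U.val⁆
    rw [map_add, map_smul, map_smul, hA])

/-- A map that anticommutes with `ad Z` acts antilinearly. -/
def RotSpace.antiMap (A : 𝔤 →ₗ[ℝ] 𝔤) (hA : ∀ U, A ⁅Z, U⁆ = -⁅Z, A U⁆) :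
    RotSpace Z →ₛₗ[starRingEnd ℂ] RotSpace Z where
  toFun U := RotSpace.mk (A U.val) (by
    have h : ⁅Z, A U.val⁆ = -A ⁅Z, U.val⁆ := by rw [hA, neg_neg]
    rw [mem_rotSubmodule, h, lie_neg, ← hA, U.lie_lie, map_smul])
  map_add' U V := RotSpace.ext (map_add A _ _)
  map_smul' z U := RotSpace.ext (by
    change A (z.re • U.val + (z.im / 2) • ⁅Z, U.val⁆) =
      (starRingEnd ℂ z).re • A U.val + ((starRingEnd ℂ z).im / 2) • ⁅Z, A U.val⁆
    rw [map_add, map_smul, map_smul, hA, Complex.conj_re, Complex.conj_im]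
    module)

theorem RotSpace.antiMap_injective {A : 𝔤 →ₗ[ℝ] 𝔤} (hA : ∀ U, A ⁅Z, U⁆ = -⁅Z, A U⁆)
    (h : Function.Injective A) : Function.Injective (RotSpace.antiMap A hA) :=
  fun _ _ hUV => RotSpace.ext (h (congrArg RotSpace.val hUV))

end RotSpace

end HomogeneousLorentz

namespace HomogeneousLorentz

/-! ### The determinant character of the centralizer of Z -/

section RotationCharacter

variable {n : ℕ} {G : Type*} [TopologicalSpace G] [ChartedSpace (EuclideanSpace ℝ (Fin n)) G]
  [Group G] [LieGroup (𝓡 n) ∞ G]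

/-- The complex linear action of the centralizer of `Z` on the space where `(ad Z)² = -4`. -/
def rotRep (Z : LieAlg n G) :
    centralizerSubgroup ({Z} : Set (LieAlg n G)) →* Module.End ℂ (RotSpace Z) where
  toFun a := RotSpace.map (AdLin n (a : G)) fun _ => Ad_lie_mem (a.2 Z rfl)
  map_one' := LinearMap.ext fun U => RotSpace.ext (Ad_one U.val)
  map_mul' a b := LinearMap.ext fun U => RotSpace.ext (Ad_mul (a : G) b U.val)

theorem val_rotRep (Z : LieAlg n G) (a : centralizerSubgroup ({Z} : Set (LieAlg n G)))
    (U : RotSpace Z) : (rotRep Z a U).val = Ad (a : G) U.val := rfl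

/-- The determinant of the complex linear action of the centralizer of `Z`. -/
def rotChar (Z : LieAlg n G) : centralizerSubgroup ({Z} : Set (LieAlg n G)) →* ℂ :=
  (LinearMap.det (A := ℂ) (M := RotSpace Z)).comp (rotRep Z)

theorem rotChar_apply (Z : LieAlg n G) (a : centralizerSubgroup ({Z} : Set (LieAlg n G))) :
    rotChar Z a = LinearMap.det (rotRep Z a) := rfl

theorem continuous_coeff (ℓ : Model n →ₗ[ℝ] ℂ) (u : Model n) :
    Continuous fun a : G => ℓ (adjointCLM n a u) :=
  (LinearMap.toContinuousLinearMap ℓ).continuous.comp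
    ((continuous_adjointCLM n G).clm_apply continuous_const)

theorem differentiableAt_coeff (ℓ : Model n →ₗ[ℝ] ℂ) (u X : Model n) :
    DifferentiableAt ℝ (fun t : ℝ => ℓ (adjointCLM n (expM G (t • X)) u)) 0 :=
  ((LinearMap.toContinuousLinearMap ℓ).hasFDerivAt.comp_hasDerivAt (0 : ℝ)
    (hasDerivAt_adjointCLM_expM (G := G) X u)).differentiableAt

theorem differentiableAt_det {ι : Type*} [Fintype ι] [DecidableEq ι] {M : ℝ → Matrix ι ι ℂ} {t : ℝ}
    (h : ∀ i j, DifferentiableAt ℝ (fun s => M s i j) t) :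
    DifferentiableAt ℝ (fun s => (M s).det) t := by
  simp only [Matrix.det_apply']
  fun_prop

/-- The determinant is a polynomial in matrix coefficients of Ad. A real linear retraction of 𝔤 onto
the subspace extends these coefficients to all of G, where the regularity of Ad applies. -/
theorem exists_rotChar_extension (Z : LieAlg n G) :
    ∃ F : G → ℂ, Continuous F ∧
      (∀ X : LieAlg n G, DifferentiableAt ℝ (fun t : ℝ => F (expG (t • X))) 0) ∧
      ∀ a : centralizerSubgroup ({Z} : Set (LieAlg n G)), rotChar Z a = F a := by
  classical
  let β := Module.finBasis ℂ (RotSpace Z)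
  obtain ⟨r, hr⟩ := (RotSpace.incl Z).exists_leftInverse_of_injective
    (LinearMap.ker_eq_bot.2 RotSpace.incl_injective)
  have hr' : ∀ U : RotSpace Z, r U.val = U := fun U => congrArg (fun T => T U) hr
  let ℓ := fun i => ((β.coord i).restrictScalars ℝ) ∘ₗ r
  refine ⟨fun a => Matrix.det fun i j => ℓ i (Ad a (β j).val), ?_, fun X => ?_, fun a => ?_⟩
  · exact Continuous.matrix_det (continuous_matrix fun i j =>
      continuous_coeff (n := n) (G := G) (ℓ i) (β j).val)
  · exact differentiableAt_det fun i j =>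
      differentiableAt_coeff (n := n) (G := G) (ℓ i) (β j).val X
  · rw [rotChar_apply, ← LinearMap.det_toMatrix β]
    congr 1
    ext i j
    rw [LinearMap.toMatrix_apply]
    change β.repr (rotRep Z a (β j)) i = β.repr (r (Ad (a : G) (β j).val)) i
    rw [← val_rotRep, hr']

/-- The subgroup of the centralizer of `Z` on which the determinant is positive. -/
def phaseKernel (Z : LieAlg n G) : Subgroup G :=
  Subgroup.map (centralizerSubgroup ({Z} : Set (LieAlg n G))).subtype
    -- Nonnegativity is a closed condition; on a group the determinant never vanishes, so it amounts
    -- to positivity.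
    { carrier := {a | ∃ r : ℝ, 0 ≤ r ∧ rotChar Z a = r}
      one_mem' := ⟨1, zero_le_one, by simp⟩
      mul_mem' := by
        rintro a b ⟨r, hr, ha⟩ ⟨s, hs, hb⟩
        exact ⟨r * s, mul_nonneg hr hs, by rw [map_mul, ha, hb, Complex.ofReal_mul]⟩
      inv_mem' := by
        rintro a ⟨r, hr, ha⟩
        refine ⟨r⁻¹, inv_nonneg.2 hr, ?_⟩
        rw [Complex.ofReal_inv, ← ha]
        exact eq_inv_of_mul_eq_one_left (by rw [← map_mul, inv_mul_cancel, map_one]) }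

theorem mem_phaseKernel {Z : LieAlg n G} {a : G} : a ∈ phaseKernel Z ↔
    ∃ ha : a ∈ centralizerSubgroup ({Z} : Set (LieAlg n G)), ∃ r : ℝ, 0 ≤ r ∧ rotChar Z ⟨a, ha⟩ = r := by
  constructor
  · rintro ⟨b, hb, rfl⟩
    exact ⟨b.2, hb⟩
  · rintro ⟨ha, h⟩
    exact ⟨⟨a, ha⟩, h, rfl⟩

theorem isClosed_phaseKernel (Z : LieAlg n G) : IsClosed (phaseKernel Z : Set G) := by
  obtain ⟨F, hF, -, hFχ⟩ := exists_rotChar_extension Z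
  have h : (phaseKernel Z : Set G) = (centralizerSubgroup ({Z} : Set (LieAlg n G)) : Set G) ∩
      F ⁻¹' {z | z.im = 0 ∧ 0 ≤ z.re} := by
    ext a
    rw [SetLike.mem_coe, mem_phaseKernel]
    constructor
    · rintro ⟨ha, r, hr, h⟩
      rw [hFχ] at h
      exact ⟨ha, by simp [h], by simp [h, hr]⟩
    · rintro ⟨ha, h1, h2⟩
      exact ⟨ha, (F a).re, h2, by rw [hFχ]; exact Complex.ext rfl (by simpa using h1)⟩
  rw [h]
  refine (isClosed_centralizerSubgroup _).inter (IsClosed.preimage hF ?_)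
  exact (isClosed_eq Complex.continuous_im continuous_const).inter
    (isClosed_le continuous_const Complex.continuous_re)

theorem expG_smul_mem_centralizerSubgroup {Z X : LieAlg n G} (h : ⁅X, Z⁆ = 0) (t : ℝ) :
    expG (t • X) ∈ centralizerSubgroup ({Z} : Set (LieAlg n G)) := by
  intro Y hY
  rw [mem_singleton_iff.1 hY]
  exact Ad_expG_eq_self (by rw [smul_lie, h, smul_zero])

theorem rotRep_expG_self (Z : LieAlg n G) (t : ℝ) :
    rotRep Z ⟨expG (t • Z), expG_smul_mem_centralizerSubgroup (lie_self Z) t⟩ =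
      Complex.exp ((2 * t : ℝ) * Complex.I) • LinearMap.id := by
  refine LinearMap.ext fun U => RotSpace.ext ?_
  rw [val_rotRep, LinearMap.smul_apply, LinearMap.id_apply, RotSpace.val_smul,
    Complex.exp_ofReal_mul_I_re, Complex.exp_ofReal_mul_I_im]
  exact Ad_expG_rotation U.lie_lie t

theorem rotChar_expG_self (Z : LieAlg n G) (t : ℝ) :
    rotChar Z ⟨expG (t • Z), expG_smul_mem_centralizerSubgroup (lie_self Z) t⟩ =
      Complex.exp ((2 * t * Module.finrank ℂ (RotSpace Z) : ℝ) * Complex.I) := by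
  rw [rotChar_apply, rotRep_expG_self, LinearMap.det_smul, LinearMap.det_id, mul_one,
    ← Complex.exp_nat_mul]
  congr 1
  push_cast
  ring

/-- Multiplicative functions on the line that are differentiable at `0` are exponentials. -/
theorem eq_exp_of_differentiableAt {φ : ℝ → ℂ} (h0 : φ 0 = 1) (hmul : ∀ s t, φ (s + t) = φ s * φ t)
    (hd : DifferentiableAt ℝ φ 0) : ∃ A : ℂ, ∀ t : ℝ, φ t = Complex.exp (t * A) := by
  refine ⟨deriv φ 0, fun t => ?_⟩
  have hf : ∀ s, HasDerivAt φ (φ s * deriv φ 0) s := by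
    intro s
    have h1 : HasDerivAt (fun u => φ s * φ (u - s)) (φ s * deriv φ 0) s := by
      have h2 : HasDerivAt φ (deriv φ 0) (s - s) := by rw [sub_self]; exact hd.hasDerivAt
      exact (h2.comp_sub_const s s).const_mul (φ s)
    refine h1.congr_of_eventuallyEq (Eventually.of_forall fun u => ?_)
    change φ u = φ s * φ (u - s)
    rw [← hmul, add_sub_cancel]
  rw [eq_exp_smul_of_hasDerivAt h0 hf t, Complex.exp_eq_exp_ℂ, Complex.real_smul]

variable (hG : LieAlgebra.IsSimple ℝ (LieAlg n G))
include hG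

/-- With d the complex dimension, the determinant along exp(tZ) is e^{2itd}, which equals -1 at t =
π/(2d). -/
theorem not_mem_lie_phaseKernel {Z : LieAlg n G} (hZ : Nontrivial (RotSpace Z)) :
    Z ∉ lie (phaseKernel Z) := by
  intro hmem
  have hd : (Module.finrank ℂ (RotSpace Z) : ℝ) ≠ 0 := Nat.cast_ne_zero.2 Module.finrank_pos.ne'
  obtain ⟨_, r, hr, h⟩ := mem_phaseKernel.1 ((mem_lie_iff hG (isClosed_phaseKernel Z)).1 hmem
    (Real.pi / (2 * Module.finrank ℂ (RotSpace Z))))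
  rw [rotChar_expG_self] at h
  have h1 : 2 * (Real.pi / (2 * Module.finrank ℂ (RotSpace Z))) * Module.finrank ℂ (RotSpace Z) =
      Real.pi := by field_simp
  rw [h1, Complex.exp_pi_mul_I] at h
  have h2 := congrArg Complex.re h
  simp only [Complex.neg_re, Complex.one_re, Complex.ofReal_re] at h2
  linarith

/-- Along exp(tX) the determinant is e^{tA} for a complex number A. Its phase is linear in t and can
be cancelled by a multiple of Z, whose own phase moves at speed 2d. -/
theorem exists_sub_smul_mem_lie_phaseKernel {Z X : LieAlg n G} (hZ : Nontrivial (RotSpace Z))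
    (hX : ⁅X, Z⁆ = 0) : ∃ c : ℝ, X - c • Z ∈ lie (phaseKernel Z) := by
  have hd : (Module.finrank ℂ (RotSpace Z) : ℝ) ≠ 0 := Nat.cast_ne_zero.2 Module.finrank_pos.ne'
  obtain ⟨F, -, hFd, hFχ⟩ := exists_rotChar_extension Z
  have hadd : ∀ s t : ℝ, (⟨expG ((s + t) • X), expG_smul_mem_centralizerSubgroup hX _⟩ :
      centralizerSubgroup ({Z} : Set (LieAlg n G))) =
      ⟨expG (s • X), expG_smul_mem_centralizerSubgroup hX _⟩ *
        ⟨expG (t • X), expG_smul_mem_centralizerSubgroup hX _⟩ := fun s t =>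
    Subtype.ext (expG_add_smul s t X)
  obtain ⟨A, hA⟩ := eq_exp_of_differentiableAt
    (φ := fun t => rotChar Z ⟨expG (t • X), expG_smul_mem_centralizerSubgroup hX t⟩)
    (by
      rw [hFχ]
      have h1 := (hFχ 1).symm.trans (map_one _)
      have e : expG ((0 : ℝ) • X) = (1 : G) := by rw [zero_smul, expG_zero]
      exact (congrArg F e).trans h1)
    (fun s t => by rw [hadd, map_mul])
    ((hFd X).congr_of_eventuallyEq (Eventually.of_forall fun t => hFχ _))
  set c : ℝ := A.im / (2 * Module.finrank ℂ (RotSpace Z)) with hc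
  refine ⟨c, (mem_lie_iff hG (isClosed_phaseKernel Z)).2 fun t => mem_phaseKernel.2 ?_⟩
  have hXZ : ⁅X - c • Z, Z⁆ = 0 := by
    rw [sub_lie, hX, smul_lie, lie_self, smul_zero, sub_zero]
  refine ⟨expG_smul_mem_centralizerSubgroup hXZ t, Real.exp (t * A.re), (Real.exp_pos _).le, ?_⟩
  have hrep : rotRep Z ⟨expG (t • (X - c • Z)), expG_smul_mem_centralizerSubgroup hXZ t⟩ =
      rotRep Z ⟨expG (t • X), expG_smul_mem_centralizerSubgroup hX t⟩ *
        rotRep Z ⟨expG ((-(t * c)) • Z), expG_smul_mem_centralizerSubgroup (lie_self Z) _⟩ := by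
    refine LinearMap.ext fun U => RotSpace.ext ?_
    have h1 : t • (X - c • Z) = t • X + (-(t * c)) • Z := by module
    -- X and Z commute, so exp of the sum acts as the composition and the determinants multiply.
    have h2 : ⁅t • X, (-(t * c)) • Z⁆ = 0 := by rw [smul_lie, lie_smul, hX, smul_zero, smul_zero]
    change Ad (expG (t • (X - c • Z))) U.val =
      Ad (expG (t • X)) (Ad (expG ((-(t * c)) • Z)) U.val)
    rw [h1, Ad_expG_add h2]
  rw [rotChar_apply, hrep, map_mul, ← rotChar_apply, ← rotChar_apply, rotChar_expG_self, hA,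
    ← Complex.exp_add, Complex.ofReal_exp]
  congr 1
  have h3 : 2 * -(t * c) * (Module.finrank ℂ (RotSpace Z) : ℝ) = -(t * A.im) := by
    rw [hc]; field_simp
  have h4 : (t : ℂ) * A = t * A.re + t * A.im * Complex.I := by
    rw [mul_assoc, ← mul_add, Complex.re_add_im]
  rw [h3, h4]
  push_cast
  ring

/-- As w reverses Z, Ad w anticommutes with ad Z and acts antilinearly. An element of L commutes
with Ad w, so its determinant is real, and the determinant of a square is then nonnegative.
Exponentials are squares and generate L. -/
theorem le_phaseKernel {L : Subgroup G} (hL : IsClosed (L : Set G)) (hL' : IsConnected (L : Set G))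
    {Z : LieAlg n G} (hZ : ∀ X ∈ lie (n := n) L, ⁅X, Z⁆ = 0) {w : G} (hw : Ad w Z = -Z)
    (hwL : ∀ a ∈ L, ∀ U : LieAlg n G, Ad a (Ad w U) = Ad w (Ad a U)) : L ≤ phaseKernel Z := by
  refine le_of_expG_mem (n := n) hG hL hL' fun X hX => ?_
  have hX1 : expG ((1 / 2 : ℝ) • X) ∈ L := (mem_lie_iff hG hL).1 hX _
  have hX2 := expG_smul_mem_centralizerSubgroup (hZ X hX) (1 / 2)
  have hanti : ∀ U : LieAlg n G, AdLin n w ⁅Z, U⁆ = -⁅Z, AdLin n w U⁆ := fun U => by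
    rw [AdLin_apply, AdLin_apply, Ad_lie, hw, neg_lie]
  have hinj : Function.Injective (AdLin n w) := fun U V hUV => by
    have h1 : Ad w U = Ad w V := hUV
    rw [← Ad_inv_Ad w U, h1, Ad_inv_Ad]
  have hconj := conj_det_of_commute_antilinear (rotRep Z ⟨_, hX2⟩) (RotSpace.antiMap (AdLin n w) hanti)
    (RotSpace.antiMap_injective hanti hinj) fun U => RotSpace.ext (hwL _ hX1 U.val)
  obtain ⟨r, hr⟩ := Complex.conj_eq_iff_real.1 hconj
  have hmul : expG X = expG ((1 / 2 : ℝ) • X) * expG ((1 / 2 : ℝ) • X) := by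
    rw [expG_half_mul, one_smul]
  rw [mem_phaseKernel, hmul]
  refine ⟨mul_mem hX2 hX2, r * r, mul_self_nonneg r, ?_⟩
  have h2 := map_mul (rotChar Z) ⟨_, hX2⟩ ⟨_, hX2⟩
  rw [rotChar_apply Z ⟨_, hX2⟩, hr] at h2
  rw [Complex.ofReal_mul]
  exact h2

end RotationCharacter

end HomogeneousLorentz

namespace HomogeneousLorentz

/-! ### Minimal admissible of Type Ib implies special type -/

section TypeIb

variable {n : ℕ} {G : Type*} [TopologicalSpace G] [ChartedSpace (EuclideanSpace ℝ (Fin n)) G]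
  [Group G] [LieGroup (𝓡 n) ∞ G] [CompactSpace G] [ConnectedSpace G]
  (hG : LieAlgebra.IsSimple ℝ (LieAlg n G))
include hG

theorem exists_isQuaternionic_subalgebra {s : LieSubalgebra ℝ (LieAlg n G)}
    (h3 : Module.finrank ℝ s = 3) (hs : LieAlgebra.IsSimple ℝ s) {Z : LieAlg n G} (hZ : Z ∈ s)
    (hZ0 : Z ≠ 0) :
    ∃ e : Module.Basis (Fin 3) ℝ s, IsQuaternionic e ∧ ∃ r : ℝ, r ≠ 0 ∧ (e 0 : LieAlg n G) = r • Z := by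
  have _ : Module.Finite ℝ s := Module.finite_of_finrank_pos (by rw [h3]; norm_num)
  let b : LinearMap.BilinForm ℝ s :=
    (negKilling n G).compl₁₂ (s.incl : s →ₗ[ℝ] LieAlg n G) (s.incl : s →ₗ[ℝ] LieAlg n G)
  have hb : ∀ x y : s, b x y = negKilling n G (x : LieAlg n G) (y : LieAlg n G) := fun _ _ => rfl
  have hna : ∃ x y : s, ⁅x, y⁆ ≠ 0 := by
    by_contra! hcon
    exact hs.non_abelian ⟨hcon⟩
  obtain ⟨e, he, r, hr, h⟩ := exists_isQuaternionic b (fun x y => negKilling_comm _ _)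
    (fun x hx => negKilling_pos hG fun h0 => hx (Subtype.ext h0))
    (fun x y z => negKilling_lie (x : LieAlg n G) y z) h3 hna (Z := ⟨Z, hZ⟩)
    (fun h0 => hZ0 (congrArg Subtype.val h0))
  exact ⟨e, he, r, hr, congrArg Subtype.val h⟩

/-- The identity component of K is admissible because it fixes Z, and it contains the connected
group L; maximality of L leaves no room in dimension. -/
theorem IsMinimalAdmissible.lie_eq {L K : Subgroup G} (h : IsMinimalAdmissible n L)
    (hK : IsClosed (K : Set G)) (hLK : L ≤ K) {Z : LieAlg n G} (hZ : Z ∉ lie K)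
    (hfix : ∀ X ∈ lie (n := n) K, ⁅X, Z⁆ = 0) : lie (n := n) K = lie L := by
  have hT := isTopologicalGroup_of_lieGroup n G
  have hC := isClosed_identityComponent hK
  have hlie := lie_identityComponent hG hK
  have hle : lie (n := n) L ≤ lie (identityComponent K) := hlie ▸ lie_mono hLK
  have hadm : IsAdmissible n (identityComponent K) :=
    isAdmissible_of_fixed hG hC (isConnected_identityComponent K) (hlie ▸ hZ) (hlie ▸ hfix)
  have h1 := h.2 _ hadm (le_of_lie_le hG h.1.1 h.1.2.1 hC hle)
  rw [← hlie]
  exact (Submodule.eq_of_le_of_finrank_le hle (not_lt.1 h1)).symm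

variable {L : Subgroup G} {s : LieSubalgebra ℝ (LieAlg n G)}

theorem IsMinimalAdmissible.centralizer_eq (h : IsMinimalAdmissible n L)
    (hLs : ∀ X ∈ lie (n := n) L, ∀ Y ∈ s, ⁅X, Y⁆ = 0) {e : Module.Basis (Fin 3) ℝ s}
    (he : IsQuaternionic e) : centralizer (s : Set (LieAlg n G)) = lie L := by
  have hC := isClosed_centralizerSubgroup (s : Set (LieAlg n G))
  have hlie := lie_centralizerSubgroup hG (s : Set (LieAlg n G))
  rw [← hlie]
  -- The vector e₀ is fixed by the centralizer of 𝔰 but does not belong to it, since [e₀, e₁] ≠ 0.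
  refine h.lie_eq hG hC (fun a ha Y hY => ?_) (Z := e 0) (fun h0 => ?_) fun X hX => ?_
  · exact (Ad_eq_self_iff hG h.1.1 h.1.2.1).2 (fun X hX => hLs X hX Y hY) a ha
  · rw [hlie] at h0
    have h1 := h0 (e 1) (e 1).2
    have h2 : ⁅e 0, e 1⁆ = 0 := by
      rw [← lie_skew, neg_eq_zero]
      exact Subtype.ext h1
    rw [he.lie_zero_one] at h2
    exact smul_ne_zero two_ne_zero (e.ne_zero 2) h2
  · rw [hlie] at hX
    rw [← lie_skew, hX (e 0) (e 0).2, neg_zero]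

/-- The space where (ad e₀)² = -4 contains e₁, so the determinant character is not trivial along e₀.
The half-turn comes from exp((π/2)e₂), because ad e₂ rotates e₀ at angular speed 2, and L commutes
with it since L fixes e₂. -/
theorem IsMinimalAdmissible.lie_phaseKernel (h : IsMinimalAdmissible n L)
    (hLs : ∀ X ∈ lie (n := n) L, ∀ Y ∈ s, ⁅X, Y⁆ = 0) {e : Module.Basis (Fin 3) ℝ s}
    (he : IsQuaternionic e) :
    Nontrivial (RotSpace (e 0 : LieAlg n G)) ∧ lie (n := n) (phaseKernel (e 0 : LieAlg n G)) = lie L := by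
  have h01 : ⁅(e 0 : LieAlg n G), (e 1 : LieAlg n G)⁆ = (2 : ℝ) • (e 2 : LieAlg n G) :=
    congrArg Subtype.val he.lie_zero_one
  have h12 : ⁅(e 1 : LieAlg n G), (e 2 : LieAlg n G)⁆ = (2 : ℝ) • (e 0 : LieAlg n G) :=
    congrArg Subtype.val he.lie_one_two
  have h20 : ⁅(e 2 : LieAlg n G), (e 0 : LieAlg n G)⁆ = (2 : ℝ) • (e 1 : LieAlg n G) :=
    congrArg Subtype.val he.lie_two_zero
  have hnt : Nontrivial (RotSpace (e 0 : LieAlg n G)) := by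
    refine ⟨RotSpace.mk (e 1 : LieAlg n G) ?_, 0, fun h0 => e.ne_zero 1 (Subtype.ext ?_)⟩
    · rw [mem_rotSubmodule, h01, lie_smul, ← lie_skew, h20]
      module
    · exact congrArg RotSpace.val h0
  refine ⟨hnt, ?_⟩
  have hfix : ∀ X ∈ lie (n := n) L, ⁅X, (e 0 : LieAlg n G)⁆ = 0 := fun X hX => hLs X hX _ (e 0).2
  refine h.lie_eq hG (isClosed_phaseKernel _) ?_ (not_mem_lie_phaseKernel hG hnt) fun X hX => ?_
  · -- rotation by `π` about `e 2` reverses `e 0`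
    refine le_phaseKernel hG h.1.1 h.1.2.1 hfix
      (w := expG ((Real.pi / 2) • (e 2 : LieAlg n G))) ?_ fun a ha U => Ad_comm_expG ?_ U
    · rw [Ad_expG_rotation]
      · rw [mul_div_cancel₀ _ (two_ne_zero' ℝ), Real.cos_pi, Real.sin_pi, zero_div, zero_smul,
          add_zero, neg_one_smul]
      · rw [h20, lie_smul, ← lie_skew, h12]
        module
    · rw [Ad_smul, (Ad_eq_self_iff hG h.1.1 h.1.2.1).2 (fun X hX => hLs X hX _ (e 2).2) a ha]
  · have hle : phaseKernel (e 0 : LieAlg n G) ≤ centralizerSubgroup {(e 0 : LieAlg n G)} :=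
      fun a ha => (mem_phaseKernel.1 ha).1
    have h1 := lie_mono hle hX
    rw [lie_centralizerSubgroup hG] at h1
    rw [← lie_skew, h1 _ rfl, neg_zero]

/-- The phase kernel has Lie algebra 𝔩 and is complemented by ℝZ in C(Z). A quaternionic basis can
be started along any nonzero Z in 𝔰, so this covers all of them. -/
theorem IsMinimalAdmissible.centralizer_singleton (h : IsMinimalAdmissible n L)
    (hLs : ∀ X ∈ lie (n := n) L, ∀ Y ∈ s, ⁅X, Y⁆ = 0) (h3 : Module.finrank ℝ s = 3)
    (hs : LieAlgebra.IsSimple ℝ s) {Z : LieAlg n G} (hZ : Z ∈ s) (hZ0 : Z ≠ 0) :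
    centralizer {Z} = lie L ⊔ Submodule.span ℝ {Z} := by
  obtain ⟨e, he, r, hr, her⟩ := exists_isQuaternionic_subalgebra hG h3 hs hZ hZ0
  obtain ⟨hnt, hlie⟩ := h.lie_phaseKernel hG hLs he
  refine le_antisymm (fun X hX => ?_) (sup_le (fun X hX Y hY => ?_) ?_)
  · have h0 : ⁅X, (e 0 : LieAlg n G)⁆ = 0 := by
      rw [her, lie_smul, ← lie_skew, hX Z rfl, neg_zero, smul_zero]
    obtain ⟨c, hc⟩ := exists_sub_smul_mem_lie_phaseKernel hG hnt h0
    rw [hlie] at hc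
    have h1 : X = (X - c • (e 0 : LieAlg n G)) + (c * r) • Z := by
      rw [her]; module
    rw [h1]
    exact Submodule.add_mem_sup hc (Submodule.smul_mem _ _ (Submodule.mem_span_singleton_self Z))
  · rw [mem_singleton_iff.1 hY, ← lie_skew, hLs X hX Z hZ, neg_zero]
  · rw [Submodule.span_singleton_le_iff_mem]
    intro Y hY
    rw [mem_singleton_iff.1 hY, lie_self]

theorem isCompl_orthogonal (V : Submodule ℝ (LieAlg n G)) :
    IsCompl V ((negKilling n G).orthogonal V) := by
  refine LinearMap.BilinForm.isCompl_orthogonal_of_restrict_nondegenerate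
    (fun x y h => by rw [negKilling_comm, h]) ?_
  have hr : ((negKilling n G).restrict V).IsRefl := fun x y h => by
    exact (negKilling_comm _ _).trans h
  refine hr.nondegenerate_iff_separatingLeft.2 fun x hx => ?_
  by_contra hne
  exact (negKilling_pos hG fun h0 => hne (Subtype.ext h0)).ne' (hx x)

theorem IsMinimalAdmissible.isContactOfSpecialType (h : IsMinimalAdmissible n L)
    (hIb : IsTypeIb n L) : IsContactOfSpecialType n L := by
  obtain ⟨m, hm, s, hsm, h3, hs, -⟩ := hIb
  have hmem : ∀ Y ∈ s, Y ∈ fixed L m := fun Y hY => hsm ▸ hY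
  have hLs : ∀ X ∈ lie L, ∀ Y ∈ s, ⁅X, Y⁆ = 0 := fun X hX Y hY => (hmem Y hY).2 X hX
  have hsle : s.toSubmodule ≤ m := fun Y hY => (hmem Y hY).1
  obtain ⟨Z, hZ, hZ0⟩ : ∃ Z ∈ s, Z ≠ 0 := by
    have : Nontrivial s := Module.nontrivial_of_finrank_pos (R := ℝ) (by rw [h3]; norm_num)
    obtain ⟨Z, hZ⟩ := exists_ne (0 : s)
    exact ⟨Z, Z.2, fun h0 => hZ (Subtype.ext h0)⟩
  obtain ⟨e, he, -⟩ := exists_isQuaternionic_subalgebra hG h3 hs hZ hZ0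
  have hcompl := isCompl_orthogonal hG s.toSubmodule
  -- The complement 𝔪' is the b-orthogonal of 𝔰 inside 𝔪; it is `Ad`-invariant under L because L
  -- preserves 𝔪 and b and fixes 𝔰 pointwise.
  refine ⟨m, m ⊓ (negKilling n G).orthogonal s.toSubmodule, s, hm, ?_, ?_, ?_, hsm.symm,
    nonempty_equiv_sp1_iff.2 ⟨e, he⟩, h.centralizer_eq hG hLs he,
    fun Z hZ hZ0 => h.centralizer_singleton hG hLs h3 hs hZ hZ0⟩
  · rw [inf_comm, ← sup_inf_assoc_of_le _ hsle, hcompl.sup_eq_top, top_inf_eq]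
  · exact hcompl.disjoint.mono_right inf_le_right
  · intro a ha X hX
    refine ⟨hm.2 a ha X hX.1, fun Y hY => ?_⟩
    have hfix := (Ad_eq_self_iff hG h.1.1 h.1.2.1).2 (fun X hX => hLs X hX Y hY) a ha
    have h1 : negKilling n G Y X = 0 := hX.2 Y hY
    change negKilling n G Y (Ad a X) = 0
    rw [← hfix, negKilling_Ad hG, h1]

end TypeIb

end HomogeneousLorentz

end

theorem mainTheorem10 (n : ℕ) (G : Type*) [TopologicalSpace G]
    [ChartedSpace (EuclideanSpace ℝ (Fin n)) G] [Group G] [LieGroup (𝓡 n) ∞ G]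
    [CompactSpace G] [ConnectedSpace G]
    (hG : LieAlgebra.IsSimple ℝ (GroupLieAlgebra (𝓡 n) G))
    (L : Subgroup G) (hL : IsClosed (L : Set G)) (hL' : IsConnected (L : Set G)) :
    ((IsMinimalAdmissible n L ∧ IsTypeIb n L) ↔ IsContactOfSpecialType n L) ∧
    ∀ (m m' : Submodule ℝ (GroupLieAlgebra (𝓡 n) G))
      (s : LieSubalgebra ℝ (GroupLieAlgebra (𝓡 n) G)),
      IsSpecialDecomposition L m m' s →
        IsRegularSubalgebra s ∧
        (L : Set G) =
          connectedComponentIn (groupCentralizer (s : Set (GroupLieAlgebra (𝓡 n) G))) 1 ∧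
        ∀ Z ∈ s, Z ≠ 0 → IsInvariantContactStructure L (lie L ⊔ (m ⊓ killingPerp Z)) := by
  refine ⟨⟨fun h => h.1.isContactOfSpecialType hG h.2, ?_⟩, fun m m' s h =>
    ⟨h.isRegularSubalgebra hG, h.coe_eq hG hL hL',
      fun Z hZ hZ0 => h.isInvariantContactStructure hG hL hL' hZ hZ0⟩⟩
  rintro ⟨m, m', s, h⟩
  exact ⟨h.isMinimalAdmissible hG hL hL', h.isTypeIb hG⟩
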